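/- **Theorem (the ZH-calculus is complete).** Let $D_1$ and $D_2$ be ZH-diagrams with the same number $m\ge 0$ of inputs and the same number $n\ge 0$ of outputs. If $[\![D_1]\!]=[\![D_2]\!]$, then $D_1$ is convertible into $D_2$ using the rules of the ZH-calculus, together with the rule "only topology matters". *Diagrams and interpretation.* ZH-diagrams are string diagrams built, by sequential composition and juxtaposition, from Z-spiders $Z_{m,n}$ and H-boxes $H_{m,n}(a)$ ($m$ inputs, $n$ outputs, $m,n\ge 0$, $a\in\mathbb C$), straight and crossing wires, cups and caps. A diagram with $m$ inputs and $n$ outputs is interpreted as a $2^n\times 2^m$ complex matrix: $$[\![Z_{m,n}]\!]=|0\rangle^{\otimes n}\langle 0|^{\otimes m}+|1\rangle^{\otimes n}\langle 1|^{\otimes m},\qquad [\![H_{m,n}(a)]\!]=\sum_{i_1,\dots,i_m,j_1,\dots,j_n\in\{0,1\}} a^{i_1\cdots i_m j_1\cdots j_n}\,|j_1\dots j_n\rangle\langle i_1\dots i_m|$$ (with $0^0=1$, and an empty product equal to $1$); wires act as identities and permutations of tensor factors, the cup is $|00\rangle+|11\rangle$, the cap is $\langle 00|+\langle 11|$; composition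 is the matrix product and juxtaposition the tensor product. *Derived generators.* Write $h=H_{1,1}(-1)$ and $\langle a\rangle=H_{0,0}(a)$ (a scalar), and write $E\circ D$ for "first $D$, then $E$". The grey spider is $X_{m,n}=\langle\frac12\rangle\otimes(h^{\otimes n}\circ Z_{m,n}\circ h^{\otimes m})$ and NOT is $\neg=\langle\frac12\rangle\otimes\bigl(h\circ(1\otimes H_{1,0}(-1))\circ Z_{1,2}\circ h\bigr)$, where $1$ is a single wire. *Rules*, for all $m,n\ge 0$ and $a,b\in\mathbb C$: * (ZS1) $Z_{1,n}\circ Z_{m,1}=Z_{m,n}$. * (ZS2) $Z_{1,1}=1$. * (HS1) $H_{1,n}(-1)\circ h\circ H_{m,1}(a)=\langle 2\rangle\otimes H_{m,n}(a)$. * (HS2) $h\circ h=\langle 2\rangle\otimes 1$. * (BA1) $Z_{1,n}\circ X_{m,1}$ equals the complete bipartite diagram of $m$ lower vertices $Z_{1,n}$ and $n$ upper vertices $X_{m,1}$, in which every lower vertex is joined by one wire to every upper vertex. * (BA2) $X_{1,n}\circ H_{m,1}(-1)$ equals the complete bipartite diagram of $m$ lower vertices $Z_{1,n}$ and $n$ upper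 vertices $H_{m,1}(-1)$. * (M) $Z_{2,1}\circ(H_{0,1}(a)\otimes H_{0,1}(b))=H_{0,1}(ab)$. * (U) $H_{0,1}(1)=Z_{0,1}$. * (A) $Z_{2,1}\circ\bigl(H_{1,1}(a)\otimes(H_{1,1}(b)\circ\neg)\bigr)\circ\mathrm{cup}=\langle 2\rangle\otimes H_{0,1}\bigl(\tfrac{a+b}2\bigr)$. * (I) $H_{0,1}(a)\otimes Z_{0,1}=(Z_{2,1}\otimes Z_{2,1})\circ\sigma\circ\bigl(H_{0,2}(a)\otimes((1\otimes\neg)\circ H_{0,2}(a))\bigr)$, where $\sigma$ crosses the second and the third of four wires. * (O) $\langle 2\rangle\otimes\bigl(T\circ(Z_{1,2}\otimes Z_{0,2})\bigr)=T\circ(Z_{1,2}\otimes Z_{0,1}\otimes Z_{0,1})$, where $T=(H_{2,1}(-1)\otimes H_{2,1}(-1))\circ(1\otimes 1\otimes\neg\otimes 1)\circ\sigma$. "Only topology matters" means that diagrams that can be deformed into one another are identified (equality of string diagrams in a compact closed category whose wires are self-dual), and that Z-spiders and H-boxes are symmetric and undirected: inputs may be permuted, outputs may be permuted, and an input may be bent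 by a cup into an output, or an output by a cap into an input. *Convertible* means related by finitely many applications of these rules, in either direction and to any part of a diagram. -/

import Mathlib

namespace ZH

/-- ZH-diagrams with `m` inputs (bottom) and `n` outputs (top).

* `Z m n` is the Z-spider (white dot) and `H m n a` the H-box with label `a`, each with `m` inputs
  and `n` outputs.
* `wires e` consists of plain wires that connect the input `k` to the output `e k`: straight wires,
  the empty diagram and crossings of wires are instances.
* `cup` has two outputs and `cap` has two inputs: the two curved wires.
* `comp D E` is sequential composition (first `D`, then `E` on top of it),
  `tensor D E` is juxtaposition (`D` to the left of `E`). -/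
inductive Diagram : ℕ → ℕ → Type where
  | Z (m n : ℕ) : Diagram m n
  | H (m n : ℕ) (a : ℂ) : Diagram m n
  | wires {m n : ℕ} (e : Fin m ≃ Fin n) : Diagram m n
  | cup : Diagram 0 2
  | cap : Diagram 2 0
  | comp {m n k : ℕ} (D : Diagram m n) (E : Diagram n k) : Diagram m k
  | tensor {m n m' n' : ℕ} (D : Diagram m n) (E : Diagram m' n') : Diagram (m + m') (n + n')

namespace Diagram

infixl:65 " ⨟ " => Diagram.comp
infixl:70 " ⊠ " => Diagram.tensor

/-- The interpretation of a diagram `m → n` as a `2 ^ n × 2 ^ m` matrix. Rows are indexed by the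
bit strings of the outputs, columns by the bit strings of the inputs. -/
noncomputable def interp : {m n : ℕ} → Diagram m n → Matrix (Fin n → Fin 2) (Fin m → Fin 2) ℂ
  | _, _, Z _ _ => Matrix.of fun y x =>
      (if (∀ j, y j = 0) ∧ (∀ i, x i = 0) then 1 else 0) +
        (if (∀ j, y j = 1) ∧ (∀ i, x i = 1) then 1 else 0)
  | _, _, H _ _ a => Matrix.of fun y x => a ^ ((∏ i, (x i : ℕ)) * ∏ j, (y j : ℕ))
  | _, _, wires e => Matrix.of fun y x => if ∀ i, y (e i) = x i then 1 else 0
  | _, _, cup => Matrix.of fun y _ => if y 0 = y 1 then 1 else 0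
  | _, _, cap => Matrix.of fun _ x => if x 0 = x 1 then 1 else 0
  | _, _, comp D E => interp E * interp D
  | _, _, @tensor m n m' n' D E => Matrix.of fun y x =>
      interp D (fun j => y (Fin.castAdd n' j)) (fun i => x (Fin.castAdd m' i)) *
        interp E (fun j => y (Fin.natAdd n j)) (fun i => x (Fin.natAdd m i))

/-- `n` parallel straight wires. -/
def idn (n : ℕ) : Diagram n n := wires (Equiv.refl (Fin n))

/-- A single straight wire. -/
def wire : Diagram 1 1 := idn 1

/-- The empty diagram. -/
def empty : Diagram 0 0 := idn 0

/-- The crossing of two wires. -/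
def cross : Diagram 2 2 := wires (Equiv.swap 0 1)

/-- The same diagram, with its numbers of inputs and outputs written in another way. -/
def recast {m n m' n' : ℕ} (hm : m = m') (hn : n = n') (D : Diagram m n) : Diagram m' n' :=
  wires (finCongr hm.symm) ⨟ D ⨟ wires (finCongr hn)

/-- `k` copies of a diagram, side by side. -/
def copies {m n : ℕ} (D : Diagram m n) : (k : ℕ) → Diagram (k * m) (k * n)
  | 0 => recast (Nat.zero_mul m).symm (Nat.zero_mul n).symm empty
  | k + 1 => recast (Nat.succ_mul k m).symm (Nat.succ_mul k n).symm (copies D k ⊠ D)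

/-- `n` copies of a diagram with one input and one output, side by side. -/
def onEach (D : Diagram 1 1) (n : ℕ) : Diagram n n :=
  recast (Nat.mul_one n) (Nat.mul_one n) (copies D n)

/-- The scalar H-box. -/
def scalar (a : ℂ) : Diagram 0 0 := H 0 0 a

/-- The (unnormalised) Hadamard box: the binary H-box with label `-1`. -/
def had : Diagram 1 1 := H 1 1 (-1)

/-- The grey spider: a Z-spider with a Hadamard box on each leg, and the scalar `1 / 2`. -/
noncomputable def grey (m n : ℕ) : Diagram m n := (onEach had m ⨟ Z m n ⨟ onEach had n) ⊠ scalar (1 / 2)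

/-- NOT: a Z-spider that carries the unary H-box with label `-1`, between two Hadamard boxes, and
the scalar `1 / 2`. -/
noncomputable def neg : Diagram 1 1 := (had ⨟ Z 1 2 ⨟ (wire ⊠ H 1 0 (-1)) ⨟ had) ⊠ scalar (1 / 2)

/-- The wires that join each of `m` groups of `n` wires to each of `n` groups of `m` wires:
the wire `j` of the group `i` becomes the wire `i` of the group `j`. -/
def transposeWires (m n : ℕ) : Diagram (m * n) (n * m) :=
  wires (finProdFinEquiv.symm.trans ((Equiv.prodComm (Fin m) (Fin n)).trans finProdFinEquiv))

/-- The complete bipartite graph whose lower vertices are `m` copies of `P`, with one input each,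
and whose upper vertices are `n` copies of `Q`, with one output each. -/
def bipartite {m n : ℕ} (P : Diagram 1 n) (Q : Diagram m 1) : Diagram m n :=
  recast (Nat.mul_one m) (Nat.mul_one n) (copies P m ⨟ transposeWires m n ⨟ copies Q n)

/-- The upper part of both sides of the ortho rule: for wires `x₁ x₂ k₁ k₂`, an H-box on `x₁, k₁`
and an H-box on the negation of `x₂` and on `k₂`, each with one output. -/
noncomputable def orthoTop : Diagram 4 2 :=
  wires (Equiv.swap 1 2) ⨟ (idn 2 ⊠ neg ⊠ wire) ⨟ (H 2 1 (-1) ⊠ H 2 1 (-1))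

/-- The rules of the ZH-calculus. -/
inductive Rule : {m n : ℕ} → Diagram m n → Diagram m n → Prop where
  | zs1 (m n : ℕ) : Rule (Z m 1 ⨟ Z 1 n) (Z m n)
  | zs2 : Rule (Z 1 1) wire
  | hs1 (m n : ℕ) (a : ℂ) : Rule (H m 1 a ⨟ had ⨟ H 1 n (-1)) (H m n a ⊠ scalar 2)
  | hs2 : Rule (had ⨟ had) (wire ⊠ scalar 2)
  | ba1 (m n : ℕ) : Rule (grey m 1 ⨟ Z 1 n) (bipartite (Z 1 n) (grey m 1))
  | ba2 (m n : ℕ) : Rule (H m 1 (-1) ⨟ grey 1 n) (bipartite (Z 1 n) (H m 1 (-1)))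
  | mul (a b : ℂ) : Rule ((H 0 1 a ⊠ H 0 1 b) ⨟ Z 2 1) (H 0 1 (a * b))
  | unit : Rule (H 0 1 1) (Z 0 1)
  | average (a b : ℂ) :
      Rule (cup ⨟ (H 1 1 a ⊠ (neg ⨟ H 1 1 b)) ⨟ Z 2 1) (H 0 1 ((a + b) / 2) ⊠ scalar 2)
  | intro (a : ℂ) :
      Rule (H 0 1 a ⊠ Z 0 1)
        ((H 0 2 a ⊠ (H 0 2 a ⨟ (wire ⊠ neg))) ⨟ wires (Equiv.swap (1 : Fin 4) 2) ⨟
          (Z 2 1 ⊠ Z 2 1))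
  | ortho :
      Rule (((Z 1 2 ⊠ Z 0 2) ⨟ orthoTop) ⊠ scalar 2)
        ((Z 1 2 ⊠ (Z 0 1 ⊠ Z 0 1)) ⨟ orthoTop)

/-- "Only the topology matters". Plain wires form the symmetry of a strict symmetric monoidal
category, the cup and the cap make it compact closed with every wire its own dual, and the
generators are symmetric and undirected. -/
inductive Topo : {m n : ℕ} → Diagram m n → Diagram m n → Prop where
  | id_comp {m n : ℕ} (D : Diagram m n) : Topo (idn m ⨟ D) D
  | comp_id {m n : ℕ} (D : Diagram m n) : Topo (D ⨟ idn n) D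
  | comp_assoc {m n k l : ℕ} (D : Diagram m n) (E : Diagram n k) (F : Diagram k l) :
      Topo (D ⨟ E ⨟ F) (D ⨟ (E ⨟ F))
  | empty_tensor {m n : ℕ} (D : Diagram m n) :
      Topo (recast (Nat.zero_add m) (Nat.zero_add n) (empty ⊠ D)) D
  | tensor_empty {m n : ℕ} (D : Diagram m n) : Topo (D ⊠ empty) D
  | tensor_assoc {m n m' n' m'' n'' : ℕ} (D : Diagram m n) (E : Diagram m' n')
      (F : Diagram m'' n'') :
      Topo (recast (Nat.add_assoc m m' m'') (Nat.add_assoc n n' n'') (D ⊠ E ⊠ F)) (D ⊠ (E ⊠ F))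
  | interchange {m n k m' n' k' : ℕ} (D : Diagram m n) (E : Diagram n k)
      (D' : Diagram m' n') (E' : Diagram n' k') :
      Topo ((D ⊠ D') ⨟ (E ⊠ E')) ((D ⨟ E) ⊠ (D' ⨟ E'))
  | wires_comp {m n k : ℕ} (e : Fin m ≃ Fin n) (f : Fin n ≃ Fin k) :
      Topo (wires e ⨟ wires f) (wires (e.trans f))
  | wires_tensor {m n m' n' : ℕ} (e : Fin m ≃ Fin n) (f : Fin m' ≃ Fin n') :
      Topo (wires e ⊠ wires f)
        (wires (finSumFinEquiv.symm.trans ((Equiv.sumCongr e f).trans finSumFinEquiv)))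
  | slide {m n m' n' : ℕ} (D : Diagram m n) (E : Diagram m' n') :
      Topo ((D ⊠ E) ⨟ wires finAddFlip) (wires finAddFlip ⨟ (E ⊠ D))
  | snake_left : Topo ((cup ⊠ wire : Diagram 1 3) ⨟ (wire ⊠ cap : Diagram 3 1)) wire
  | snake_right : Topo ((wire ⊠ cup : Diagram 1 3) ⨟ (cap ⊠ wire : Diagram 3 1)) wire
  | cup_cross : Topo (cup ⨟ cross) cup
  | cross_cap : Topo (cross ⨟ cap) cap
  | Z_perm_inputs {m n : ℕ} (e : Fin m ≃ Fin m) : Topo (wires e ⨟ Z m n) (Z m n)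
  | Z_perm_outputs {m n : ℕ} (e : Fin n ≃ Fin n) : Topo (Z m n ⨟ wires e) (Z m n)
  | Z_bend_input (m n : ℕ) : Topo ((idn m ⊠ cup : Diagram m (m + 2)) ⨟
        (Z (m + 1) n ⊠ wire : Diagram (m + 1 + 1) (n + 1))) (Z m (n + 1))
  | Z_bend_output (m n : ℕ) : Topo ((Z m (n + 1) ⊠ wire : Diagram (m + 1) (n + 1 + 1)) ⨟
        (idn n ⊠ cap : Diagram (n + 2) n)) (Z (m + 1) n)
  | H_perm_inputs {m n : ℕ} (a : ℂ) (e : Fin m ≃ Fin m) : Topo (wires e ⨟ H m n a) (H m n a)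
  | H_perm_outputs {m n : ℕ} (a : ℂ) (e : Fin n ≃ Fin n) : Topo (H m n a ⨟ wires e) (H m n a)
  | H_bend_input (m n : ℕ) (a : ℂ) :
      Topo ((idn m ⊠ cup : Diagram m (m + 2)) ⨟
        (H (m + 1) n a ⊠ wire : Diagram (m + 1 + 1) (n + 1))) (H m (n + 1) a)
  | H_bend_output (m n : ℕ) (a : ℂ) :
      Topo ((H m (n + 1) a ⊠ wire : Diagram (m + 1) (n + 1 + 1)) ⨟
        (idn n ⊠ cap : Diagram (n + 2) n)) (H (m + 1) n a)

/-- `Convertible D E`: the diagram `D` can be rewritten into `E` by finitely many applications, in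
either direction and to any part of a diagram, of the rules and of topological deformations. -/
inductive Convertible : {m n : ℕ} → Diagram m n → Diagram m n → Prop where
  | rule {m n : ℕ} {D E : Diagram m n} (h : Rule D E) : Convertible D E
  | topo {m n : ℕ} {D E : Diagram m n} (h : Topo D E) : Convertible D E
  | refl {m n : ℕ} (D : Diagram m n) : Convertible D D
  | symm {m n : ℕ} {D E : Diagram m n} (h : Convertible D E) : Convertible E D
  | trans {m n : ℕ} {D E F : Diagram m n} (h : Convertible D E) (h' : Convertible E F) :
      Convertible D F
  | comp {m n k : ℕ} {D D' : Diagram m n} {E E' : Diagram n k}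
      (h : Convertible D D') (h' : Convertible E E') : Convertible (D ⨟ E) (D' ⨟ E')
  | tensor {m n m' n' : ℕ} {D D' : Diagram m n} {E E' : Diagram m' n'}
      (h : Convertible D D') (h' : Convertible E E') : Convertible (D ⊠ E) (D' ⊠ E')

end Diagram

end ZH

/-! Diagrams modulo convertibility form a symmetric monoidal category. Spider fusion makes a single
wire `A` a commutative monoid under `join`; its states behave like functions of one bit under
pointwise product. For a commutative monoid `X`, a homomorphism `A ⟶ X` plays the role of a Boolean
function (it is the pullback along it). Rules BA1 and BA2, turned upside down by transposition, say
that XOR (`greyFork`), AND (`conj`) and the constants 0 and 1 (`greyDiscard`, `one`) are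
homomorphisms. Convolution along them therefore makes the set `Poly X` of homomorphisms a
commutative ring of characteristic 2. An H-box becomes the state `H a p`, to be read as the function
a^p.

The remaining rules are identities between such powers. M and U say a^p b^p = (ab)^p and 1^p = 1;
rule I says a^p = a^{pq} a^{p(1+q)}; rule A says that the sum over a bit y of a^{py} b^{p(1+y)} is
2((a+b)/2)^p. Rule O concerns two functions of y, one depending on y only where p holds and the
other only where p fails: twice the sum of their product is the product of their sums (`sum_ortho`).
Applied to powers of -1, it forces p(1+p) = 0 (`mul_one_add_self`). So `Poly X` is a Boolean ring,
and the minterms in given variables are orthogonal idempotents with sum 1.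

A function f on bit strings is encoded by `normalForm`, the product over all strings b of f(b)
raised to the minterm of b. Multiplication and substitution act on the values (`normalForm_mul`,
`normalForm_eq`), and summing out a variable adds values (`sum_normalForm`): minterms are
orthogonal, so `sum_ortho` distributes the sum over the product. Hence every diagram acts on normal
forms by its own matrix (`represents_interp`). A morphism is determined by that matrix: bend its
inputs into outputs and apply the result to the normal form on no wires, which is the empty diagram
(`Represents.unique`). -/

open CategoryTheory MonoidalCategory
open scoped MonObj

/-! ### The symmetric monoidal category of diagrams modulo convertibility -/

namespace ZH

open Diagram

/-- Convertibility as an equivalence relation. -/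
def convSetoid (m n : ℕ) : Setoid (Diagram m n) where
  r D E := Convertible D E
  iseqv := ⟨.refl, .symm, .trans⟩

/-- Diagrams up to convertibility. -/
def Mor (m n : ℕ) : Type := Quotient (convSetoid m n)

namespace Mor

/-- The class of a diagram. -/
def mk {m n : ℕ} (D : Diagram m n) : Mor m n := Quotient.mk (convSetoid m n) D

theorem mk_eq {m n : ℕ} {D E : Diagram m n} : mk D = mk E ↔ Convertible D E :=
  ⟨fun h => Quotient.exact h, fun h => Quotient.sound (s := convSetoid m n) h⟩

theorem ind {m n : ℕ} {p : Mor m n → Prop} (h : ∀ D, p (mk D)) (f : Mor m n) : p f :=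
  Quotient.ind h f

/-- Sequential composition. -/
def comp {m n k : ℕ} : Mor m n → Mor n k → Mor m k :=
  Quotient.map₂ Diagram.comp (fun _ _ h _ _ h' => .comp h h')

/-- Juxtaposition. -/
def tensor {m n m' n' : ℕ} : Mor m n → Mor m' n' → Mor (m + m') (n + n') :=
  Quotient.map₂ Diagram.tensor (fun _ _ h _ _ h' => .tensor h h')

/-- Plain wires. -/
def wires {m n : ℕ} (e : Fin m ≃ Fin n) : Mor m n := mk (.wires e)

theorem rule {m n : ℕ} {D E : Diagram m n} (h : Rule D E) : mk D = mk E := mk_eq.2 (.rule h)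

theorem topo {m n : ℕ} {D E : Diagram m n} (h : Topo D E) : mk D = mk E := mk_eq.2 (.topo h)

theorem id_comp {m n : ℕ} (f : Mor m n) : comp (wires (Equiv.refl _)) f = f := by
  induction f using ind
  exact topo (.id_comp _)

theorem comp_id {m n : ℕ} (f : Mor m n) : comp f (wires (Equiv.refl _)) = f := by
  induction f using ind
  exact topo (.comp_id _)

theorem assoc {m n k l : ℕ} (f : Mor m n) (g : Mor n k) (h : Mor k l) :
    comp (comp f g) h = comp f (comp g h) := by
  induction f using ind
  induction g using ind
  induction h using ind
  exact topo (.comp_assoc _ _ _)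

theorem interchange {m n k m' n' k' : ℕ} (f : Mor m n) (g : Mor n k) (f' : Mor m' n')
    (g' : Mor n' k') : comp (tensor f f') (tensor g g') = tensor (comp f g) (comp f' g') := by
  induction f using ind
  induction g using ind
  induction f' using ind
  induction g' using ind
  exact topo (.interchange _ _ _ _)

theorem wires_comp {m n k : ℕ} (e : Fin m ≃ Fin n) (f : Fin n ≃ Fin k) :
    comp (wires e) (wires f) = wires (e.trans f) := topo (.wires_comp e f)

/-- Two bijections side by side. -/
def sumWires {m n m' n' : ℕ} (e : Fin m ≃ Fin n) (f : Fin m' ≃ Fin n') :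
    Fin (m + m') ≃ Fin (n + n') :=
  finSumFinEquiv.symm.trans ((Equiv.sumCongr e f).trans finSumFinEquiv)

@[simp] theorem sumWires_castAdd {m n m' n' : ℕ} (e : Fin m ≃ Fin n) (f : Fin m' ≃ Fin n')
    (i : Fin m) : sumWires e f (Fin.castAdd m' i) = Fin.castAdd n' (e i) := by
  simp [sumWires]

@[simp] theorem sumWires_natAdd {m n m' n' : ℕ} (e : Fin m ≃ Fin n) (f : Fin m' ≃ Fin n')
    (i : Fin m') : sumWires e f (Fin.natAdd m i) = Fin.natAdd n (f i) := by
  simp [sumWires]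

theorem wires_tensor {m n m' n' : ℕ} (e : Fin m ≃ Fin n) (f : Fin m' ≃ Fin n') :
    tensor (wires e) (wires f) = wires (sumWires e f) := topo (.wires_tensor e f)

theorem slide {m n m' n' : ℕ} (f : Mor m n) (g : Mor m' n') :
    comp (tensor f g) (wires finAddFlip) = comp (wires finAddFlip) (tensor g f) := by
  induction f using ind
  induction g using ind
  exact topo (.slide _ _)

theorem wires_self_comp {m n : ℕ} (e : Fin m ≃ Fin n) :
    comp (wires e) (wires e.symm) = wires (Equiv.refl _) := by simp [wires_comp]

theorem symm_wires_self_comp {m n : ℕ} (e : Fin m ≃ Fin n) :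
    comp (wires e.symm) (wires e) = wires (Equiv.refl _) := by simp [wires_comp]

/-- A recast is composition with wires at both ends, so the axioms stated with `recast` become
naturality squares for the unitors and the associator. -/
theorem of_recast {m n m' n' : ℕ} (hm : m = m') (hn : n = n') {f : Mor m n} {g : Mor m' n'}
    (h : comp (comp (wires (finCongr hm.symm)) f) (wires (finCongr hn)) = g) :
    comp f (wires (finCongr hn)) = comp (wires (finCongr hm)) g := by
  subst hm hn h
  simp only [finCongr_refl, comp_id, id_comp]

theorem zero_tensor {m n : ℕ} (f : Mor m n) :
    comp (tensor (wires (Equiv.refl (Fin 0))) f) (wires (finCongr (Nat.zero_add n))) =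
      comp (wires (finCongr (Nat.zero_add m))) f := by
  induction f using ind
  exact of_recast _ _ (topo (.empty_tensor _))

theorem tensor_zero {m n : ℕ} (f : Mor m n) :
    tensor f (wires (Equiv.refl (Fin 0))) = f := by
  induction f using ind
  exact topo (.tensor_empty _)

theorem tensor_assoc {m n m' n' m'' n'' : ℕ} (f : Mor m n) (g : Mor m' n') (h : Mor m'' n'') :
    comp (tensor (tensor f g) h) (wires (finCongr (Nat.add_assoc n n' n''))) =
      comp (wires (finCongr (Nat.add_assoc m m' m''))) (tensor f (tensor g h)) := by
  induction f using ind
  induction g using ind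
  induction h using ind
  exact of_recast _ _ (topo (.tensor_assoc _ _ _))

theorem sumWires_refl (m n : ℕ) :
    sumWires (Equiv.refl (Fin m)) (Equiv.refl (Fin n)) = Equiv.refl _ := by
  simp [sumWires]

theorem wires_congr {m n : ℕ} {e f : Fin m ≃ Fin n} (h : ∀ i, (e i : ℕ) = f i) :
    wires e = wires f := by
  congr 1
  ext i
  exact h i

theorem sumWires_val {m n m' n' : ℕ} (e : Fin m ≃ Fin n) (f : Fin m' ≃ Fin n')
    (i : Fin (m + m')) : (sumWires e f i : ℕ) =
      if h : (i : ℕ) < m then (e ⟨i, h⟩ : ℕ) else n + f ⟨i - m, by omega⟩ := by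
  induction i using Fin.addCases <;> simp

theorem finAddFlip_val {m n : ℕ} (i : Fin (m + n)) :
    (finAddFlip i : ℕ) = if (i : ℕ) < m then n + (i : ℕ) else (i : ℕ) - m := by
  induction i using Fin.addCases <;> simp

/-- Coherence of plain wires is an equality of bijections of index sets, checked on values by linear
arithmetic; the same holds for the triangle and the hexagons below. -/
theorem wires_pentagon (a b c d : ℕ) :
    comp (tensor (wires (finCongr (Nat.add_assoc a b c))) (wires (Equiv.refl (Fin d))))
      (comp (wires (finCongr (Nat.add_assoc a (b + c) d)))
        (tensor (wires (Equiv.refl (Fin a))) (wires (finCongr (Nat.add_assoc b c d))))) =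
      comp (wires (finCongr (Nat.add_assoc (a + b) c d)))
        (wires (finCongr (Nat.add_assoc a b (c + d)))) := by
  simp only [wires_tensor, wires_comp]
  refine wires_congr fun i => ?_
  simp [sumWires_val]
  split_ifs <;> omega

theorem wires_triangle (a b : ℕ) :
    comp (wires (finCongr (Nat.add_assoc a 0 b)))
      (tensor (wires (Equiv.refl (Fin a))) (wires (finCongr (Nat.zero_add b)))) =
      tensor (wires (finCongr (Nat.add_zero a))) (wires (Equiv.refl (Fin b))) := by
  simp only [wires_tensor, wires_comp]
  refine wires_congr fun i => ?_
  simp [sumWires_val]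

theorem wires_hexagon_forward (a b c : ℕ) :
    comp (wires (finCongr (Nat.add_assoc a b c))) (comp (wires finAddFlip)
      (wires (finCongr (Nat.add_assoc b c a)))) =
      comp (tensor (wires finAddFlip) (wires (Equiv.refl (Fin c))))
        (comp (wires (finCongr (Nat.add_assoc b a c)))
          (tensor (wires (Equiv.refl (Fin b))) (wires finAddFlip))) := by
  simp only [wires_tensor, wires_comp]
  refine wires_congr fun i => ?_
  simp [sumWires_val, finAddFlip_val]
  split_ifs <;> omega

theorem wires_hexagon_reverse (a b c : ℕ) :
    comp (wires (finCongr (Nat.add_assoc a b c)).symm) (comp (wires finAddFlip)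
      (wires (finCongr (Nat.add_assoc c a b)).symm)) =
      comp (tensor (wires (Equiv.refl (Fin a))) (wires finAddFlip))
        (comp (wires (finCongr (Nat.add_assoc a c b)).symm)
          (tensor (wires finAddFlip) (wires (Equiv.refl (Fin b))))) := by
  simp only [wires_tensor, wires_comp]
  refine wires_congr fun i => ?_
  simp [sumWires_val, finAddFlip_val]
  split_ifs <;> omega

theorem wires_flip_flip (a b : ℕ) :
    comp (wires (finAddFlip (m := a) (n := b))) (wires finAddFlip) = wires (Equiv.refl _) := by
  simp only [wires_comp]
  refine wires_congr fun i => ?_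
  simp [finAddFlip_val]
  split_ifs <;> omega

end Mor

/-- The number of wires at one end of a diagram, as an object of a category. -/
structure Wires where
  /-- The number of wires. -/
  num : ℕ

namespace Wires

open Mor

instance : Category Wires where
  Hom X Y := Mor X.num Y.num
  id X := Mor.wires (Equiv.refl _)
  comp f g := Mor.comp f g
  id_comp := Mor.id_comp
  comp_id := Mor.comp_id
  assoc := Mor.assoc

/-- Plain wires as an isomorphism. -/
def isoWires {X Y : Wires} (e : Fin X.num ≃ Fin Y.num) : X ≅ Y where
  hom := Mor.wires e
  inv := Mor.wires e.symm
  hom_inv_id := Mor.wires_self_comp e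
  inv_hom_id := Mor.symm_wires_self_comp e

instance : MonoidalCategoryStruct Wires where
  tensorObj X Y := ⟨X.num + Y.num⟩
  whiskerLeft X _ _ f := Mor.tensor (Mor.wires (Equiv.refl (Fin X.num))) f
  whiskerRight f Y := Mor.tensor f (Mor.wires (Equiv.refl (Fin Y.num)))
  tensorHom f g := Mor.tensor f g
  tensorUnit := ⟨0⟩
  associator X Y Z := isoWires (finCongr (Nat.add_assoc X.num Y.num Z.num))
  leftUnitor X := isoWires (finCongr (Nat.zero_add X.num))
  rightUnitor X := isoWires (finCongr (Nat.add_zero X.num))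

instance : MonoidalCategory Wires := MonoidalCategory.ofTensorHom
  (id_tensorHom_id := fun X Y => by
    change Mor.tensor (Mor.wires _) (Mor.wires _) = Mor.wires _
    rw [Mor.wires_tensor, Mor.sumWires_refl]; rfl)
  (id_tensorHom := fun _ _ _ _ => rfl)
  (tensorHom_id := fun _ _ => rfl)
  (tensorHom_comp_tensorHom := fun f₁ f₂ g₁ g₂ => Mor.interchange f₁ g₁ f₂ g₂)
  (associator_naturality := fun f g h => Mor.tensor_assoc f g h)
  (leftUnitor_naturality := fun f => Mor.zero_tensor f)
  (rightUnitor_naturality := fun {X Y} f => by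
    change Mor.comp (Mor.tensor f (Mor.wires (Equiv.refl (Fin 0)))) (Mor.wires (Equiv.refl _)) =
      Mor.comp (Mor.wires (Equiv.refl _)) f
    rw [Mor.tensor_zero, Mor.comp_id, Mor.id_comp])
  (pentagon := fun W X Y Z => Mor.wires_pentagon W.num X.num Y.num Z.num)
  (triangle := fun X Y => Mor.wires_triangle X.num Y.num)

instance : BraidedCategory Wires where
  braiding _ _ := isoWires finAddFlip
  braiding_naturality_right X _ _ f := Mor.slide (Mor.wires (Equiv.refl (Fin X.num))) f
  braiding_naturality_left f Z := Mor.slide f (Mor.wires (Equiv.refl (Fin Z.num)))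
  hexagon_forward X Y Z := Mor.wires_hexagon_forward X.num Y.num Z.num
  hexagon_reverse X Y Z := Mor.wires_hexagon_reverse X.num Y.num Z.num

instance : SymmetricCategory Wires where
  symmetry X Y := Mor.wires_flip_flip X.num Y.num

end Wires

end ZH

/-! ### Bending wires; symmetric undirected vertices -/

namespace ZH.Wires

/-- A single wire. -/
abbrev A : Wires := ⟨1⟩

/-- The class of a diagram, as a morphism. -/
def cls {m n : ℕ} (D : Diagram m n) : (⟨m⟩ : Wires) ⟶ ⟨n⟩ := Mor.mk D

theorem cls_eq {m n : ℕ} {D E : Diagram m n} : cls D = cls E ↔ Diagram.Convertible D E := Mor.mk_eq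

theorem cls_comp {m n k : ℕ} (D : Diagram m n) (E : Diagram n k) :
    cls (D ⨟ E) = cls D ≫ cls E := rfl

theorem cls_tensor {m n m' n' : ℕ} (D : Diagram m n) (E : Diagram m' n') :
    cls (D ⊠ E) = cls D ⊗ₘ cls E := rfl

theorem cls_topo {m n : ℕ} {D E : Diagram m n} (h : Diagram.Topo D E) : cls D = cls E :=
  Mor.topo h

theorem cls_rule {m n : ℕ} {D E : Diagram m n} (h : Diagram.Rule D E) : cls D = cls E :=
  Mor.rule h

theorem cls_recast {m n : ℕ} (hm : m = m) (hn : n = n) (D : Diagram m n) :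
    cls (Diagram.recast hm hn D) = cls D := by
  change (𝟙 _ ≫ cls D) ≫ 𝟙 _ = _
  simp

/-- Two wires that meet. -/
def cup : 𝟙_ Wires ⟶ A ⊗ A := cls Diagram.cup

/-- Two wires that meet. -/
def cap : A ⊗ A ⟶ 𝟙_ Wires := cls Diagram.cap

/-- Bends the last input into an output. -/
def bendIn {X Y : Wires} (f : X ⊗ A ⟶ Y) : X ⟶ Y ⊗ A :=
  (ρ_ X).inv ≫ X ◁ cup ≫ (α_ X A A).inv ≫ f ▷ A

/-- Bends the last output into an input. -/
def bendOut {X Y : Wires} (f : X ⟶ Y ⊗ A) : X ⊗ A ⟶ Y :=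
  f ▷ A ≫ (α_ Y A A).hom ≫ Y ◁ cap ≫ (ρ_ Y).hom

/-- `m + 1 + 1` and `m + 2` agree definitionally, so the coherence isomorphisms in `bendIn` unfold
to identity wires and `Mor.id_comp` removes them. The same device recurs throughout. -/
theorem bendIn_eq {m n : ℕ} (f : (⟨m⟩ ⊗ A : Wires) ⟶ ⟨n⟩) :
    bendIn f = (⟨m⟩ : Wires) ◁ cup ≫ f ▷ A :=
  (Mor.id_comp _).trans (congrArg (Mor.comp _) (Mor.id_comp _))

theorem bendOut_eq {m n : ℕ} (f : (⟨m⟩ : Wires) ⟶ ⟨n⟩ ⊗ A) :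
    bendOut f = f ▷ A ≫ (⟨n⟩ : Wires) ◁ cap :=
  congrArg (Mor.comp _) ((Mor.id_comp _).trans (Mor.comp_id _))

theorem snake_left : (λ_ A).inv ≫ cup ▷ A ≫ (α_ A A A).hom ≫ A ◁ cap ≫ (ρ_ A).hom = 𝟙 A :=
  ((Mor.id_comp _).trans (congrArg (Mor.comp _) ((Mor.id_comp _).trans (Mor.comp_id _)))).trans
    (cls_topo .snake_left)

theorem snake_right : (ρ_ A).inv ≫ A ◁ cup ≫ (α_ A A A).inv ≫ cap ▷ A ≫ (λ_ A).hom = 𝟙 A :=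
  ((Mor.id_comp _).trans (congrArg (Mor.comp _) ((Mor.id_comp _).trans (Mor.comp_id _)))).trans
    (cls_topo .snake_right)

theorem braid_cap : (β_ A A).hom ≫ cap = cap := by
  have h : cls (Diagram.cross ⨟ Diagram.cap) = cls Diagram.cap := cls_topo .cross_cap
  have e : (β_ A A).hom = cls Diagram.cross := Mor.wires_congr (by decide)
  rw [e]
  exact h

theorem bendOut_bendIn {X Y : Wires} (f : X ⊗ A ⟶ Y) : bendOut (bendIn f) = f := by
  have h : bendOut (bendIn f) =
      (X ◁ ((λ_ A).inv ≫ cup ▷ A ≫ (α_ A A A).hom ≫ A ◁ cap ≫ (ρ_ A).hom)) ≫ f := by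
    simp only [bendOut, bendIn, comp_whiskerRight, Category.assoc]
    rw [associator_naturality_left_assoc, ← whisker_exchange_assoc, rightUnitor_naturality]
    monoidal
  rw [h, snake_left]; simp

theorem bendIn_bendOut {X Y : Wires} (f : X ⟶ Y ⊗ A) : bendIn (bendOut f) = f := by
  have h : bendIn (bendOut f) =
      f ≫ (Y ◁ ((ρ_ A).inv ≫ A ◁ cup ≫ (α_ A A A).inv ≫ cap ▷ A ≫ (λ_ A).hom)) := by
    simp only [bendOut, bendIn, comp_whiskerRight]
    rw [← associator_inv_naturality_left_assoc, whisker_exchange_assoc, ← rightUnitor_inv_naturality_assoc]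
    monoidal
  rw [h, snake_right]; simp

/-- A family of vertices that are symmetric and undirected. -/
structure Spider (S : ∀ m n : ℕ, (⟨m⟩ : Wires) ⟶ ⟨n⟩) : Prop where
  perm_in : ∀ m n (e : Fin m ≃ Fin m), (isoWires e : (⟨m⟩ : Wires) ≅ ⟨m⟩).hom ≫ S m n = S m n
  perm_out : ∀ m n (e : Fin n ≃ Fin n), S m n ≫ (isoWires e : (⟨n⟩ : Wires) ≅ ⟨n⟩).hom = S m n
  bendIn : ∀ m n, bendIn (X := ⟨m⟩) (Y := ⟨n⟩) (S (m + 1) n) = S m (n + 1)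
  bendOut : ∀ m n, bendOut (X := ⟨m⟩) (Y := ⟨n⟩) (S m (n + 1)) = S (m + 1) n

/-- Z-spiders. -/
def zed (m n : ℕ) : (⟨m⟩ : Wires) ⟶ ⟨n⟩ := cls (.Z m n)

/-- H-boxes. -/
def box (a : ℂ) (m n : ℕ) : (⟨m⟩ : Wires) ⟶ ⟨n⟩ := cls (.H m n a)

theorem spider_zed : Spider zed where
  perm_in _ _ e := cls_topo (.Z_perm_inputs e)
  perm_out _ _ e := cls_topo (.Z_perm_outputs e)
  bendIn m n := (bendIn_eq _).trans <| cls_topo (.Z_bend_input m n)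
  bendOut m n := (bendOut_eq _).trans <| cls_topo (.Z_bend_output m n)

theorem spider_box (a : ℂ) : Spider (box a) where
  perm_in _ _ e := cls_topo (.H_perm_inputs a e)
  perm_out _ _ e := cls_topo (.H_perm_outputs a e)
  bendIn m n := (bendIn_eq _).trans <| cls_topo (.H_bend_input m n a)
  bendOut m n := (bendOut_eq _).trans <| cls_topo (.H_bend_output m n a)

end ZH.Wires

/-! ### Scalars in a monoidal category -/

namespace ZH

section Scalars

variable {C : Type*} [Category* C] [MonoidalCategory C]

/-- A morphism next to a scalar. -/
def withScalar (s : 𝟙_ C ⟶ 𝟙_ C) {X Y : C} (f : X ⟶ Y) : X ⟶ Y :=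
  (ρ_ X).inv ≫ (f ⊗ₘ s) ≫ (ρ_ Y).hom

theorem withScalar_comp (s : 𝟙_ C ⟶ 𝟙_ C) {X Y Z : C} (f : X ⟶ Y) (g : Y ⟶ Z) :
    withScalar s f ≫ g = withScalar s (f ≫ g) := by
  simp [withScalar, MonoidalCategory.tensorHom_def']

theorem comp_withScalar (s : 𝟙_ C ⟶ 𝟙_ C) {X Y Z : C} (f : X ⟶ Y) (g : Y ⟶ Z) :
    f ≫ withScalar s g = withScalar s (f ≫ g) := by
  rw [withScalar, withScalar, rightUnitor_inv_naturality_assoc, ← tensorHom_id,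
    tensorHom_comp_tensorHom_assoc, Category.id_comp]

theorem withScalar_id (s : 𝟙_ C ⟶ 𝟙_ C) : withScalar s (𝟙 (𝟙_ C)) = s := by
  simp [withScalar, unitors_equal, unitors_inv_equal]

theorem whiskerLeft_withScalar (s : 𝟙_ C ⟶ 𝟙_ C) (W : C) {X Y : C} (f : X ⟶ Y) :
    W ◁ withScalar s f = withScalar s (W ◁ f) := by
  simp only [withScalar, MonoidalCategory.tensorHom_def]
  monoidal

/-- The scalar is kept on the right of a morphism, so letting it pass a wire on that side takes the
symmetry. -/
theorem withScalar_whiskerRight [SymmetricCategory C] (s : 𝟙_ C ⟶ 𝟙_ C) (W : C) {X Y : C} (f : X ⟶ Y) :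
    withScalar s f ▷ W = withScalar s (f ▷ W) := by
  have h : withScalar s f ▷ W = (β_ X W).hom ≫ W ◁ withScalar s f ≫ (β_ W Y).hom := by
    rw [BraidedCategory.braiding_naturality_right]; simp
  rw [h, whiskerLeft_withScalar, withScalar_comp, comp_withScalar,
    BraidedCategory.braiding_naturality_right]
  simp

theorem withScalar_withScalar (s t : 𝟙_ C ⟶ 𝟙_ C) {X Y : C} (f : X ⟶ Y) :
    withScalar s (withScalar t f) = withScalar (t ≫ s) f := by
  simp only [withScalar, MonoidalCategory.tensorHom_def]
  monoidal

/-- The Eckmann–Hilton argument: both composites are the two scalars side by side. -/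
theorem scalar_comm (s t : 𝟙_ C ⟶ 𝟙_ C) : s ≫ t = t ≫ s := by
  have h₁ : (λ_ (𝟙_ C)).hom ≫ s ≫ t = 𝟙_ C ◁ s ≫ t ▷ 𝟙_ C ≫ (ρ_ _).hom := by
    rw [rightUnitor_naturality, ← leftUnitor_naturality_assoc, unitors_equal]
  have h₂ : (λ_ (𝟙_ C)).hom ≫ t ≫ s = t ▷ 𝟙_ C ≫ 𝟙_ C ◁ s ≫ (ρ_ _).hom := by
    rw [← unitors_equal, leftUnitor_naturality, unitors_equal, rightUnitor_naturality_assoc]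
  rw [← cancel_epi (λ_ (𝟙_ C)).hom, h₁, h₂, whisker_exchange_assoc]

theorem withScalar_comm (s t : 𝟙_ C ⟶ 𝟙_ C) {X Y : C} (f : X ⟶ Y) :
    withScalar s (withScalar t f) = withScalar t (withScalar s f) := by
  rw [withScalar_withScalar, withScalar_withScalar, scalar_comm]

theorem one_withScalar {X Y : C} (f : X ⟶ Y) : withScalar (𝟙 _) f = f := by
  simp [withScalar]

theorem withScalar_tensor [SymmetricCategory C] (s : 𝟙_ C ⟶ 𝟙_ C) {X Y X' Y' : C} (f : X ⟶ Y) (g : X' ⟶ Y') :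
    withScalar s f ⊗ₘ g = withScalar s (f ⊗ₘ g) := by
  rw [MonoidalCategory.tensorHom_def, withScalar_whiskerRight, withScalar_comp,
    ← MonoidalCategory.tensorHom_def]

theorem tensor_withScalar (s : 𝟙_ C ⟶ 𝟙_ C) {X Y X' Y' : C} (f : X ⟶ Y) (g : X' ⟶ Y') :
    f ⊗ₘ withScalar s g = withScalar s (f ⊗ₘ g) := by
  rw [MonoidalCategory.tensorHom_def, whiskerLeft_withScalar, comp_withScalar, ← MonoidalCategory.tensorHom_def]

end Scalars

/-! ### The commutative monoid on a wire; self-dual objects and transposes -/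

namespace Wires

theorem whiskerRight_bendOut {X' X Y : Wires} (f : X' ⟶ X) (g : X ⟶ Y ⊗ A) :
    f ▷ A ≫ bendOut g = bendOut (f ≫ g) := by
  simp [bendOut]

theorem bendIn_comp {X Y Y' : Wires} (f : X ⊗ A ⟶ Y) (g : Y ⟶ Y') :
    bendIn f ≫ g ▷ A = bendIn (f ≫ g) := by
  simp [bendIn]

/-- Fusion of Z-spiders. -/
theorem zed_comp (m n : ℕ) : zed m 1 ≫ zed 1 n = zed m n := cls_rule (.zs1 m n)

theorem zed_one_one : zed 1 1 = 𝟙 A := cls_rule .zs2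

/-- The Z-spider with two inputs and one output. -/
def join : A ⊗ A ⟶ A := zed 2 1

/-- The Z-spider with one input and two outputs. -/
def fork : A ⟶ A ⊗ A := zed 1 2

/-- The Z-spider with one output. -/
def unit : 𝟙_ Wires ⟶ A := zed 0 1

/-- The Z-spider with one input. -/
def discard : A ⟶ 𝟙_ Wires := zed 1 0

/-- Rule ZS1 fuses spiders whose connecting wire is their only leg on that side. Bending one leg of
`fork` yields fusion next to a further input. -/
theorem zed_succ_one (m : ℕ) : zed m 1 ▷ A ≫ join = (zed (m + 1) 1 : ⟨m⟩ ⊗ A ⟶ A) := by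
  have h : join = bendOut fork := (spider_zed.bendOut 1 1).symm
  rw [h, whiskerRight_bendOut, ← spider_zed.bendOut m 1]
  exact congrArg bendOut (zed_comp m 2)

theorem braid_join : (β_ A A).hom ≫ join = join := spider_zed.perm_in 2 1 _

/-- Both bracketings are the spider with three inputs: commutativity turns one into the other up to
a permutation of inputs, which the spider absorbs. -/
theorem join_assoc : join ▷ A ≫ join = (α_ A A A).hom ≫ A ◁ join ≫ join := by
  have h : A ◁ join ≫ join = (β_ A (A ⊗ A)).hom ≫ join ▷ A ≫ join := by
    rw [← BraidedCategory.braiding_naturality_right_assoc, braid_join]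
  rw [h]
  have h₂ : join ▷ A ≫ join = (zed 3 1 : (A ⊗ A) ⊗ A ⟶ A) := zed_succ_one 2
  rw [h₂]
  exact ((Mor.id_comp _).trans (spider_zed.perm_in 3 1 (finAddFlip (m := 1) (n := 2)))).symm

theorem unit_join : unit ▷ A ≫ join = (λ_ A).hom := (zed_succ_one 0).trans zed_one_one

instance : MonObj A where
  one := unit
  mul := join
  one_mul := unit_join
  mul_one := by
    rw [← braid_join, BraidedCategory.braiding_naturality_right_assoc, unit_join,
      braiding_leftUnitor]
  mul_assoc := join_assoc

instance : IsCommMonObj A where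
  mul_comm := braid_join

/-- Objects with a chosen self-duality. -/
class SelfDual (X : Wires) where
  /-- The cap. -/
  cp : X ⊗ X ⟶ 𝟙_ Wires
  /-- The cup. -/
  cu : 𝟙_ Wires ⟶ X ⊗ X
  braid_cp : (β_ X X).hom ≫ cp = cp
  zigzag : (λ_ X).inv ≫ cu ▷ X ≫ (α_ X X X).hom ≫ X ◁ cp ≫ (ρ_ X).hom = 𝟙 X

open SelfDual

instance : SelfDual A := ⟨cap, cup, braid_cap, snake_left⟩

instance : SelfDual (𝟙_ Wires) := ⟨(λ_ _).hom, (λ_ _).inv,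
  by rw [braiding_leftUnitor, unitors_equal], by monoidal⟩

theorem tensorμ_tensorμ (X Y Z W : Wires) : tensorμ X Y Z W ≫ tensorμ X Z Y W = 𝟙 _ := by
  have h : tensorμ X Z Y W = tensorδ X Y Z W := by
    simp [tensorμ, tensorδ, SymmetricCategory.braiding_swap_eq_inv_braiding]
  rw [h, tensorμ_tensorδ]

/-- The interchange maps `tensorμ` separate the two factors, and each factor then satisfies its own
zigzag. -/
theorem zigzag_tensor {X Y : Wires} [SelfDual X] [SelfDual Y] :
    (λ_ (X ⊗ Y)).inv ≫ ((λ_ _).inv ≫ (cu (X := X) ⊗ₘ cu (X := Y)) ≫ tensorμ X X Y Y) ▷ (X ⊗ Y) ≫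
      (α_ (X ⊗ Y) (X ⊗ Y) (X ⊗ Y)).hom ≫ (X ⊗ Y) ◁ (tensorμ X Y X Y ≫
        (cp (X := X) ⊗ₘ cp (X := Y)) ≫ (λ_ _).hom) ≫ (ρ_ (X ⊗ Y)).hom = 𝟙 (X ⊗ Y) := by
  have h₁ : tensorμ X X Y Y ▷ (X ⊗ Y) ≫ (α_ (X ⊗ Y) (X ⊗ Y) (X ⊗ Y)).hom =
      tensorμ (X ⊗ X) (Y ⊗ Y) X Y ≫ ((α_ X X X).hom ⊗ₘ (α_ Y Y Y).hom) ≫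
        tensorμ X (X ⊗ X) Y (Y ⊗ Y) ≫ (X ⊗ Y) ◁ tensorμ X X Y Y := by
    rw [← associator_monoidal, reassoc_of% tensorμ_tensorμ]
  have h₂ : (λ_ (X ⊗ Y)).inv ≫ (λ_ (𝟙_ Wires)).inv ▷ (X ⊗ Y) ≫ tensorμ (𝟙_ _) (𝟙_ _) X Y =
      (λ_ X).inv ⊗ₘ (λ_ Y).inv := by
    have h := leftUnitor_monoidal X Y
    rw [← cancel_mono ((λ_ X).hom ⊗ₘ (λ_ Y).hom), h]
    simp only [Category.assoc, tensorHom_comp_tensorHom, Iso.inv_hom_id, id_tensorHom_id, ← h]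
    rw [h, reassoc_of% tensorμ_tensorμ, inv_hom_whiskerRight_assoc, Iso.inv_hom_id]
  have h₃ : tensorμ X (X ⊗ X) Y (Y ⊗ Y) ≫ (X ⊗ Y) ◁ (cp (X := X) ⊗ₘ cp (X := Y)) =
      (X ◁ cp ⊗ₘ Y ◁ cp) ≫ tensorμ X (𝟙_ _) Y (𝟙_ _) := by
    simpa using (tensorμ_natural (𝟙 X) (cp (X := X)) (𝟙 Y) (cp (X := Y))).symm
  simp only [comp_whiskerRight, whiskerLeft_comp, Category.assoc]
  rw [reassoc_of% h₁, ← whiskerLeft_comp_assoc _ (tensorμ X X Y Y), tensorμ_tensorμ,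
    whiskerLeft_id, Category.id_comp, reassoc_of% h₃,
    tensorμ_natural_left_assoc, ← rightUnitor_monoidal, reassoc_of% h₂]
  simp only [tensorHom_comp_tensorHom, zigzag, id_tensorHom_id]

/-- The caps stand side by side rather than nested, so transposition keeps the order of tensor
factors; this is what makes `Mate.tensor` hold. -/
instance {X Y : Wires} [SelfDual X] [SelfDual Y] : SelfDual (X ⊗ Y) where
  cp := tensorμ X Y X Y ≫ (cp ⊗ₘ cp) ≫ (λ_ _).hom
  cu := (λ_ _).inv ≫ (cu ⊗ₘ cu) ≫ tensorμ X X Y Y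
  braid_cp := by
    have h := SymmetricCategory.tensorμ_braid_swap X Y
    have h' : (β_ (X ⊗ Y) (X ⊗ Y)).hom ≫ tensorμ X Y X Y =
        tensorμ X Y X Y ≫ ((β_ X X).hom ⊗ₘ (β_ Y Y).hom) := by
      have h₂ := congrArg (fun z => tensorμ X Y X Y ≫ z ≫ tensorμ X Y X Y) h
      simpa [tensorμ_tensorμ, reassoc_of% tensorμ_tensorμ] using h₂
    rw [reassoc_of% h', tensorHom_comp_tensorHom_assoc, braid_cp, braid_cp]
  zigzag := zigzag_tensor

/-- `g` is obtained from `f` by turning it upside down. -/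
def Mate {X Y : Wires} [SelfDual X] [SelfDual Y] (f : X ⟶ Y) (g : Y ⟶ X) : Prop :=
  f ▷ Y ≫ cp (X := Y) = X ◁ g ≫ cp (X := X)

namespace Mate

variable {X Y Z X' Y' : Wires} [SelfDual X] [SelfDual Y] [SelfDual Z] [SelfDual X'] [SelfDual Y']

theorem comp {f : X ⟶ Y} {g : Y ⟶ X} {f' : Y ⟶ Z} {g' : Z ⟶ Y} (h : Mate f g) (h' : Mate f' g') :
    Mate (f ≫ f') (g' ≫ g) := by
  unfold Mate at *
  rw [comp_whiskerRight, Category.assoc, h', whiskerLeft_comp, Category.assoc, ← h,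
    whisker_exchange_assoc]

theorem symm {f : X ⟶ Y} {g : Y ⟶ X} (h : Mate f g) : Mate g f := by
  unfold Mate at *
  rw [← braid_cp (X := X), BraidedCategory.braiding_naturality_left_assoc, ← h,
    ← BraidedCategory.braiding_naturality_right_assoc, braid_cp]

theorem withScalar {f : X ⟶ Y} {g : Y ⟶ X} (h : Mate f g) (s : 𝟙_ Wires ⟶ 𝟙_ Wires) :
    Mate (withScalar s f) (withScalar s g) := by
  unfold Mate at *
  rw [withScalar_whiskerRight, whiskerLeft_withScalar, withScalar_comp, withScalar_comp, h]

theorem id : Mate (𝟙 X) (𝟙 X) := by simp [Mate]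

theorem tensor {f : X ⟶ Y} {g : Y ⟶ X} {f' : X' ⟶ Y'} {g' : Y' ⟶ X'} (h : Mate f g)
    (h' : Mate f' g') : Mate (f ⊗ₘ f') (g ⊗ₘ g') := by
  unfold Mate at *
  change (f ⊗ₘ f') ▷ (Y ⊗ Y') ≫ tensorμ Y Y' Y Y' ≫ (cp ⊗ₘ cp) ≫ _ =
    (X ⊗ X') ◁ (g ⊗ₘ g') ≫ tensorμ X X' X X' ≫ (cp ⊗ₘ cp) ≫ _
  rw [tensorμ_natural_left_assoc, tensorμ_natural_right_assoc, tensorHom_comp_tensorHom_assoc,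
    tensorHom_comp_tensorHom_assoc, h, h']

theorem unique {f : X ⟶ Y} {g g' : Y ⟶ X} (h : Mate f g) (h' : Mate f g') : g = g' := by
  have key : ∀ g : Y ⟶ X, (λ_ Y).inv ≫ cu ▷ Y ≫ (α_ X X Y).hom ≫ X ◁ (X ◁ g ≫ cp) ≫
      (ρ_ X).hom = g := by
    intro g
    calc _ = g ≫ (λ_ X).inv ≫ cu ▷ X ≫ (α_ X X X).hom ≫ X ◁ cp ≫ (ρ_ X).hom := by
          rw [leftUnitor_inv_naturality_assoc, whisker_exchange_assoc, tensor_whiskerLeft]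
          simp
      _ = g := by rw [zigzag, Category.comp_id]
  rw [← key g, ← key g', ← h, ← h']

-- By uniqueness of mates, an equation between two morphisms can be turned upside down: the mates of
-- its two sides are equal.
end Mate

end Wires

end ZH

/-! ### Transposes of crossings and spiders -/

namespace ZH.Wires

open SelfDual

/-- The crossing of the second and the third of four wires. -/
theorem tensorμ_A : tensorμ A A A A = cls (.wires (Equiv.swap (1 : Fin 4) 2)) := by
  have h : tensorμ A A A A = Mor.comp (Mor.wires (finCongr (Nat.add_assoc 1 1 2)))
      (Mor.comp (Mor.tensor (Mor.wires (Equiv.refl (Fin 1)))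
        (Mor.wires (finCongr (Nat.add_assoc 1 1 1)).symm))
      (Mor.comp (Mor.tensor (Mor.wires (Equiv.refl (Fin 1)))
        (Mor.tensor (Mor.wires finAddFlip) (Mor.wires (Equiv.refl (Fin 1)))))
      (Mor.comp (Mor.tensor (Mor.wires (Equiv.refl (Fin 1)))
        (Mor.wires (finCongr (Nat.add_assoc 1 1 1))))
      (Mor.wires (finCongr (Nat.add_assoc 1 1 2)).symm)))) := rfl
  rw [h]
  simp only [Mor.wires_tensor, Mor.wires_comp]
  exact Mor.wires_congr (by decide)

theorem cap_slide {C : Type*} [Category* C] [MonoidalCategory C] [SymmetricCategory C] {X : C}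
    (c : X ⊗ X ⟶ 𝟙_ C) : X ◁ (β_ X X).hom ≫ (α_ X X X).inv ≫ c ▷ X ≫ (λ_ X).hom =
      (α_ X X X).inv ≫ (β_ X X).hom ▷ X ≫ (α_ X X X).hom ≫ X ◁ c ≫ (ρ_ X).hom := by
  have h := BraidedCategory.braiding_naturality_left c X
  rw [BraidedCategory.braiding_tensor_left_hom] at h
  have h' : c ▷ X ≫ (λ_ X).hom = (c ▷ X ≫ (β_ (𝟙_ _) X).hom) ≫ (ρ_ X).hom := by
    rw [Category.assoc, braiding_rightUnitor]
  rw [h', h]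
  simp only [Category.assoc, Iso.inv_hom_id_assoc]
  rw [← whiskerLeft_comp_assoc, SymmetricCategory.symmetry]
  simp

/-- Converts caps side by side into nested caps, the shape that arises when the legs of a spider are
bent one at a time. -/
theorem tensorμ_cap_cap {C : Type*} [Category* C] [MonoidalCategory C] [SymmetricCategory C] {X : C}
    (c : X ⊗ X ⟶ 𝟙_ C) : tensorμ X X X X ≫ (c ⊗ₘ c) ≫ (λ_ _).hom =
      (X ⊗ X) ◁ (β_ X X).hom ≫ (α_ (X ⊗ X) X X).inv ≫
        ((α_ X X X).hom ≫ X ◁ c ≫ (ρ_ X).hom) ▷ X ≫ c := by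
  have h : (β_ X X).hom ▷ X ≫ (α_ X X X).hom ≫ X ◁ c ≫ (ρ_ X).hom =
      (α_ X X X).hom ≫ X ◁ (β_ X X).hom ≫ (α_ X X X).inv ≫ c ▷ X ≫ (λ_ X).hom := by
    rw [cap_slide]; simp
  calc _ = 𝟙 _ ⊗≫ X ◁ ((β_ X X).hom ▷ X ≫ (α_ X X X).hom ≫ X ◁ c ≫ (ρ_ X).hom) ⊗≫ c := by
        rw [tensorHom_def']; simp only [tensorμ]; monoidal
    _ = _ := by rw [h]; monoidal

theorem tensorμ_unit {C : Type*} [Category* C] [MonoidalCategory C] [SymmetricCategory C] :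
    tensorμ (𝟙_ C) (𝟙_ _) (𝟙_ _) (𝟙_ _) ≫ ((λ_ (𝟙_ C)).hom ⊗ₘ (λ_ _).hom) =
      ((λ_ (𝟙_ C)).hom ⊗ₘ (λ_ _).hom) := by
  simp only [tensorμ, braiding_tensorUnit_left]
  monoidal

theorem cp_tensor_A : cp (X := A ⊗ A) = (A ⊗ A) ◁ (β_ A A).hom ≫ (α_ (A ⊗ A) A A).inv ≫
    ((α_ A A A).hom ≫ A ◁ cap ≫ (ρ_ A).hom) ▷ A ≫ cap := tensorμ_cap_cap cap

/-- Both sides are plain wires, so this is an equality of permutations of eight indices. -/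
theorem tensorμ_tensorμ_A : (tensorμ A A A A ⊗ₘ tensorμ A A A A) ≫
    tensorμ (A ⊗ A) (A ⊗ A) (A ⊗ A) (A ⊗ A) ≫ (tensorμ A A A A ⊗ₘ tensorμ A A A A) =
      tensorμ (A ⊗ A) (A ⊗ A) (A ⊗ A) (A ⊗ A) ≫ (tensorμ A A A A ⊗ₘ tensorμ A A A A) ≫
        tensorμ (A ⊗ A) (A ⊗ A) (A ⊗ A) (A ⊗ A) := by
  have h : tensorμ (A ⊗ A) (A ⊗ A) (A ⊗ A) (A ⊗ A) =
      Mor.comp (Mor.wires (finCongr (Nat.add_assoc 2 2 4)))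
      (Mor.comp (Mor.tensor (Mor.wires (Equiv.refl (Fin 2)))
        (Mor.wires (finCongr (Nat.add_assoc 2 2 2)).symm))
      (Mor.comp (Mor.tensor (Mor.wires (Equiv.refl (Fin 2)))
        (Mor.tensor (Mor.wires finAddFlip) (Mor.wires (Equiv.refl (Fin 2)))))
      (Mor.comp (Mor.tensor (Mor.wires (Equiv.refl (Fin 2)))
        (Mor.wires (finCongr (Nat.add_assoc 2 2 2))))
      (Mor.wires (finCongr (Nat.add_assoc 2 2 4)).symm)))) := rfl
  rw [h, tensorμ_A]
  change Mor.comp (Mor.tensor (Mor.wires _) (Mor.wires _)) (Mor.comp _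
    (Mor.tensor (Mor.wires _) (Mor.wires _))) =
      Mor.comp _ (Mor.comp (Mor.tensor (Mor.wires _) (Mor.wires _)) _)
  simp only [Mor.wires_tensor, Mor.wires_comp]
  exact Mor.wires_congr (by decide)

/-- The crossing is an involution, and applying it to both arguments of the cap changes nothing
(`key`); so it is its own transpose. -/
theorem mate_tensorμ : Mate (tensorμ A A A A) (tensorμ A A A A) := by
  have key : (tensorμ A A A A ⊗ₘ tensorμ A A A A) ≫ cp (X := (A ⊗ A) ⊗ (A ⊗ A)) =
      cp (X := (A ⊗ A) ⊗ (A ⊗ A)) := by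
    change (tensorμ A A A A ⊗ₘ tensorμ A A A A) ≫ tensorμ (A ⊗ A) (A ⊗ A) (A ⊗ A) (A ⊗ A) ≫
      ((tensorμ A A A A ≫ (cap ⊗ₘ cap) ≫ (λ_ _).hom) ⊗ₘ
        (tensorμ A A A A ≫ (cap ⊗ₘ cap) ≫ (λ_ _).hom)) ≫ (λ_ _).hom =
      tensorμ (A ⊗ A) (A ⊗ A) (A ⊗ A) (A ⊗ A) ≫
      ((tensorμ A A A A ≫ (cap ⊗ₘ cap) ≫ (λ_ _).hom) ⊗ₘ
        (tensorμ A A A A ≫ (cap ⊗ₘ cap) ≫ (λ_ _).hom)) ≫ (λ_ _).hom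
    have h : ((tensorμ A A A A ≫ (cap ⊗ₘ cap) ≫ (λ_ _).hom) ⊗ₘ
        (tensorμ A A A A ≫ (cap ⊗ₘ cap) ≫ (λ_ _).hom)) = (tensorμ A A A A ⊗ₘ tensorμ A A A A) ≫
          ((cap ⊗ₘ cap) ⊗ₘ (cap ⊗ₘ cap)) ≫ ((λ_ (𝟙_ Wires)).hom ⊗ₘ (λ_ _).hom) := by
      simp only [tensorHom_comp_tensorHom]
    rw [h]
    simp only [Category.assoc]
    rw [reassoc_of% tensorμ_tensorμ_A, ← tensorμ_natural_assoc]
    rw [reassoc_of% (tensorμ_unit (C := Wires))]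
  unfold Mate
  conv_rhs => rw [← key, tensorHom_def'_assoc, ← whiskerLeft_comp_assoc, tensorμ_tensorμ,
    whiskerLeft_id, Category.id_comp]

namespace Spider

variable {S : ∀ m n : ℕ, (⟨m⟩ : Wires) ⟶ ⟨n⟩} (hS : Spider S)

theorem bend_one (hS : Spider S) (m : ℕ) : (S m 1 : (⟨m⟩ : Wires) ⟶ A) ▷ A ≫ cap = (S (m + 1) 0) := by
  rw [← hS.bendOut m 0, bendOut_eq]
  congr 1
  have := Mor.zero_tensor cap
  exact (((Mor.comp_id _).symm.trans this).trans (Mor.id_comp _)).symm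

theorem mate_zero_one (hS : Spider S) : Mate (X := 𝟙_ _) (Y := A) (S 0 1) (S 1 0) := by
  have h := hS.bend_one 0
  unfold Mate
  rw [id_whiskerLeft, Category.assoc, Category.assoc]
  change _ = _ ≫ _ ≫ (λ_ (𝟙_ Wires)).inv ≫ (λ_ (𝟙_ Wires)).hom
  rw [Iso.inv_hom_id, Category.comp_id]
  exact h.trans (Mor.id_comp _).symm

theorem mate_one_one (hS : Spider S) : Mate (X := A) (Y := A) (S 1 1) (S 1 1) := by
  have h := hS.bend_one 1
  change S 1 1 ▷ A ≫ cap = A ◁ S 1 1 ≫ cap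
  conv_rhs => rw [← braid_cap, BraidedCategory.braiding_naturality_right_assoc, h]
  refine h.trans ?_
  exact (hS.perm_in 2 0 (finAddFlip (m := 1) (n := 1))).symm

/-- With all legs bent into inputs, both sides become `S 3 0` up to a permutation of its inputs,
which is absorbed. -/
theorem mate_two_one (hS : Spider S) : Mate (X := A ⊗ A) (Y := A) (S 2 1) (S 1 2) := by
  have h := hS.bend_one 2
  have h₁ : Wires.bendOut (X := A) (Y := A) (S 1 2) = S 2 1 := hS.bendOut 1 1
  obtain ⟨f, hf⟩ : ∃ f : A ⟶ A ⊗ A, f = S 1 2 := ⟨_, rfl⟩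
  obtain ⟨g, hg⟩ : ∃ g : A ⊗ A ⟶ A, g = S 2 1 := ⟨_, rfl⟩
  obtain ⟨k, hk⟩ : ∃ k : (A ⊗ A) ⊗ A ⟶ 𝟙_ _, k = S 3 0 := ⟨_, rfl⟩
  rw [← hg] at h h₁ ⊢
  rw [← hf] at h₁ ⊢
  have h' : g ▷ A ≫ cap = k := h.trans hk.symm
  have h₂ : f ▷ (A ⊗ A) ≫ cp = A ◁ (β_ A A).hom ≫ (α_ A A A).inv ≫ k := by
    rw [cp_tensor_A, ← whisker_exchange_assoc, ← h', ← h₁]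
    simp [Wires.bendOut]
  unfold Mate
  conv_rhs => rw [← braid_cp, BraidedCategory.braiding_naturality_right_assoc, h₂]
  refine h'.trans ?_
  have h₃ : Mor.comp (Mor.wires (finAddFlip (m := 2) (n := 1)))
      (Mor.comp (Mor.tensor (Mor.wires (Equiv.refl (Fin 1))) (Mor.wires (finAddFlip (m := 1) (n := 1))))
        (Mor.comp (Mor.wires (Equiv.refl _)) (S 3 0))) = S 3 0 := by
    rw [Mor.wires_tensor, Mor.id_comp, ← Mor.assoc, Mor.wires_comp]
    exact hS.perm_in 3 0 _
  rw [hk]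
  exact h₃.symm

end Spider

end ZH.Wires

namespace ZH

namespace Wires

/-- The scalar `a`. -/
def scal (a : ℂ) : 𝟙_ Wires ⟶ 𝟙_ Wires := box a 0 0

theorem cls_tensor_scalar {m n : ℕ} (D : Diagram m n) (a : ℂ) :
    cls (D ⊠ Diagram.scalar a) = withScalar (scal a) (cls D) := by
  exact ((Mor.id_comp _).trans (Mor.comp_id _)).symm

end Wires
end ZH

/-! ### The rules as equations between morphisms -/

namespace ZH.Wires

open Diagram (recast copies onEach bipartite transposeWires)

theorem cls_recast_recast {m m' m'' n n' n'' : ℕ} (hm : m = m') (hn : n = n') (hm' : m' = m'')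
    (hn' : n' = n'') (D : Diagram m n) :
    cls (recast hm' hn' (recast hm hn D)) = cls (recast (hm.trans hm') (hn.trans hn') D) := by
  subst hm hn hm' hn'
  simp only [cls_recast]

theorem cls_recast_tensor {m m' n n' k l : ℕ} (hm : m = m') (hn : n = n') (D : Diagram m n)
    (E : Diagram k l) :
    cls (recast hm hn D ⊠ E) = cls (recast (congrArg (· + k) hm) (congrArg (· + l) hn) (D ⊠ E)) := by
  subst hm hn
  simp only [cls_recast, cls_tensor]

theorem cls_recast_congr {m m' n n' : ℕ} (hm : m = m') (hn : n = n') {D E : Diagram m n}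
    (h : cls D = cls E) : cls (recast hm hn D) = cls (recast hm hn E) := by
  subst hm hn
  simp only [cls_recast, h]

theorem cls_copies_one {m n : ℕ} (D : Diagram m n) :
    cls (copies D 1) = cls (recast (Nat.one_mul m).symm (Nat.one_mul n).symm D) := by
  change cls (recast _ _ (recast _ _ Diagram.empty ⊠ D)) = _
  rw [cls_recast_congr _ _ (cls_recast_tensor _ _ _ _), cls_recast_recast,
    ← cls_recast_congr _ _ (cls_topo (.empty_tensor D)), cls_recast_recast]

theorem cls_copies_two {m n : ℕ} (D : Diagram m n) :
    cls (copies D 2) = cls (recast (Nat.two_mul m).symm (Nat.two_mul n).symm (D ⊠ D)) := by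
  change cls (recast _ _ (copies D 1 ⊠ D)) = _
  have h : cls (copies D 1 ⊠ D) = cls (recast (Nat.one_mul m).symm (Nat.one_mul n).symm D ⊠ D) := by
    rw [cls_tensor, cls_copies_one, ← cls_tensor]
  rw [cls_recast_congr _ _ h, cls_recast_congr _ _ (cls_recast_tensor _ _ _ _), cls_recast_recast]

/-- The binary H-box with label `-1`. -/
def had : A ⟶ A := box (-1) 1 1

theorem onEach_had_zero : cls (onEach Diagram.had 0) = 𝟙 (𝟙_ Wires) :=
  (cls_recast rfl rfl _).trans (cls_recast rfl rfl _)

theorem onEach_had_one : cls (onEach Diagram.had 1) = had :=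
  (cls_recast rfl rfl _).trans ((cls_copies_one _).trans (cls_recast rfl rfl _))

theorem onEach_had_two : cls (onEach Diagram.had 2) = (had ⊗ₘ had : A ⊗ A ⟶ A ⊗ A) :=
  (cls_recast rfl rfl _).trans ((cls_copies_two _).trans (cls_recast rfl rfl _))

/-- Grey spiders. -/
noncomputable def grey (m n : ℕ) : (⟨m⟩ : Wires) ⟶ ⟨n⟩ := cls (Diagram.grey m n)

theorem grey_eq (m n : ℕ) : grey m n = withScalar (scal (1 / 2))
    ((cls (onEach Diagram.had m) ≫ zed m n) ≫ cls (onEach Diagram.had n)) :=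
  cls_tensor_scalar _ _

/-- The grey spider with one output. -/
noncomputable def greyUnit : 𝟙_ Wires ⟶ A := grey 0 1
/-- The grey spider with one input. -/
noncomputable def greyDiscard : A ⟶ 𝟙_ Wires := grey 1 0
/-- The grey spider with one input and two outputs. -/
noncomputable def greyFork : A ⟶ A ⊗ A := grey 1 2
/-- The grey spider with two inputs and one output. -/
noncomputable def greyJoin : A ⊗ A ⟶ A := grey 2 1

theorem greyUnit_eq : greyUnit = withScalar (scal (1 / 2)) (unit ≫ had) := by
  rw [greyUnit, grey_eq, onEach_had_one, onEach_had_zero]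
  exact congrArg _ (congrArg (· ≫ had) (Category.id_comp unit))

theorem greyDiscard_eq : greyDiscard = withScalar (scal (1 / 2)) (had ≫ discard) := by
  rw [greyDiscard, grey_eq, onEach_had_one, onEach_had_zero]
  exact congrArg _ (Category.comp_id (had ≫ discard))

theorem greyFork_eq : greyFork = withScalar (scal (1 / 2)) (had ≫ fork ≫ (had ⊗ₘ had)) := by
  rw [greyFork, grey_eq, onEach_had_one, onEach_had_two]
  exact congrArg _ (Category.assoc had fork (had ⊗ₘ had))

theorem greyJoin_eq : greyJoin = withScalar (scal (1 / 2)) ((had ⊗ₘ had) ≫ join ≫ had) := by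
  rw [greyJoin, grey_eq, onEach_had_one, onEach_had_two]
  exact congrArg _ (Category.assoc (had ⊗ₘ had) join had)

theorem grey_one_one : grey 1 1 = withScalar (scal (1 / 2)) (had ≫ had) := by
  rw [grey_eq, onEach_had_one, zed_one_one]
  exact congrArg _ (congrArg (· ≫ had) (Category.comp_id had))

/-- The bialgebra rules are needed only in arities at most 2, where they express compatibility with
units and binary operations. At such literals the recast is trivial. -/
theorem cls_bipartite_two_two (P : Diagram 1 2) (Q : Diagram 2 1) : cls (bipartite P Q) =
    ((cls P ⊗ₘ cls P : A ⊗ A ⟶ (A ⊗ A) ⊗ (A ⊗ A)) ≫ tensorμ A A A A ≫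
      (cls Q ⊗ₘ cls Q) : A ⊗ A ⟶ A ⊗ A) := by
  have h₁ : cls (copies P 2) = (cls P ⊗ₘ cls P : A ⊗ A ⟶ (A ⊗ A) ⊗ (A ⊗ A)) :=
    (cls_copies_two P).trans (cls_recast rfl rfl _)
  have h₂ : cls (copies Q 2) = (cls Q ⊗ₘ cls Q : (A ⊗ A) ⊗ (A ⊗ A) ⟶ A ⊗ A) :=
    (cls_copies_two Q).trans (cls_recast rfl rfl _)
  have h₃ : cls (transposeWires 2 2) = tensorμ A A A A := by
    rw [tensorμ_A]; exact Mor.wires_congr (by decide)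
  refine (cls_recast rfl rfl _).trans ?_
  rw [cls_comp, cls_comp, h₁, h₂, h₃]
  exact Category.assoc _ _ _

theorem cls_bipartite_two_zero (P : Diagram 1 0) (Q : Diagram 2 1) : cls (bipartite P Q) =
    ((cls P ⊗ₘ cls P : A ⊗ A ⟶ 𝟙_ _ ⊗ 𝟙_ _) ≫ (λ_ _).hom : A ⊗ A ⟶ 𝟙_ Wires) := by
  have h₁ : cls (copies P 2) = (cls P ⊗ₘ cls P : A ⊗ A ⟶ 𝟙_ _ ⊗ 𝟙_ _) :=
    (cls_copies_two P).trans (cls_recast rfl rfl _)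
  have h₂ : cls (copies Q 0) = 𝟙 (𝟙_ Wires) := cls_recast rfl rfl _
  have h₃ : cls (transposeWires 2 0) = (λ_ (𝟙_ Wires)).hom := Mor.wires_congr (by decide)
  refine (cls_recast rfl rfl _).trans ?_
  rw [cls_comp, cls_comp, h₁, h₂, h₃]
  exact Category.comp_id ((cls P ⊗ₘ cls P : A ⊗ A ⟶ 𝟙_ _ ⊗ 𝟙_ _) ≫ (λ_ (𝟙_ Wires)).hom)

theorem cls_bipartite_zero_two (P : Diagram 1 2) (Q : Diagram 0 1) : cls (bipartite P Q) =
    ((λ_ _).inv ≫ (cls Q ⊗ₘ cls Q : 𝟙_ _ ⊗ 𝟙_ _ ⟶ A ⊗ A) : 𝟙_ Wires ⟶ A ⊗ A) := by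
  have h₁ : cls (copies P 0) = 𝟙 (𝟙_ Wires) := cls_recast rfl rfl _
  have h₂ : cls (copies Q 2) = (cls Q ⊗ₘ cls Q : 𝟙_ _ ⊗ 𝟙_ _ ⟶ A ⊗ A) :=
    (cls_copies_two Q).trans (cls_recast rfl rfl _)
  have h₃ : cls (transposeWires 0 2) = (λ_ (𝟙_ Wires)).inv := Mor.wires_congr (by decide)
  refine (cls_recast rfl rfl _).trans ?_
  rw [cls_comp, cls_comp, h₁, h₂, h₃]
  exact congrArg (· ≫ (cls Q ⊗ₘ cls Q : 𝟙_ _ ⊗ 𝟙_ _ ⟶ A ⊗ A))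
    (Category.id_comp (λ_ (𝟙_ Wires)).inv)

theorem cls_bipartite_zero_one (P : Diagram 1 1) (Q : Diagram 0 1) :
    cls (bipartite P Q) = cls Q := by
  have h₁ : cls (copies P 0) = 𝟙 (𝟙_ Wires) := cls_recast rfl rfl _
  have h₂ : cls (copies Q 1) = cls Q := (cls_copies_one Q).trans (cls_recast rfl rfl _)
  have h₃ : cls (transposeWires 0 1) = 𝟙 (𝟙_ Wires) := Mor.wires_congr (by decide)
  refine (cls_recast rfl rfl _).trans ?_
  rw [cls_comp, cls_comp, h₁, h₂, h₃]
  exact (congrArg (· ≫ cls Q) (Category.id_comp (𝟙 (𝟙_ Wires)))).trans (Category.id_comp _)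

theorem cls_bipartite_zero_zero (P : Diagram 1 0) (Q : Diagram 0 1) :
    cls (bipartite P Q) = 𝟙 (𝟙_ Wires) := by
  have h₁ : cls (copies P 0) = 𝟙 (𝟙_ Wires) := cls_recast rfl rfl _
  have h₂ : cls (copies Q 0) = 𝟙 (𝟙_ Wires) := cls_recast rfl rfl _
  have h₃ : cls (transposeWires 0 0) = 𝟙 (𝟙_ Wires) := Mor.wires_congr (by decide)
  refine (cls_recast rfl rfl _).trans ?_
  rw [cls_comp, cls_comp, h₁, h₂, h₃]
  exact (congrArg (· ≫ 𝟙 (𝟙_ Wires)) (Category.id_comp (𝟙 (𝟙_ Wires)))).trans (Category.id_comp _)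

/-- The H-box with label `-1`, two inputs and one output. -/
def boxJoin : A ⊗ A ⟶ A := box (-1) 2 1
/-- The H-box with label `-1`, one input and two outputs. -/
def boxFork : A ⟶ A ⊗ A := box (-1) 1 2
/-- The H-box with one output. -/
def state (a : ℂ) : 𝟙_ Wires ⟶ A := box a 0 1
/-- The H-box with one input. -/
def effect (a : ℂ) : A ⟶ 𝟙_ Wires := box a 1 0
/-- The H-box with two outputs. -/
def state₂ (a : ℂ) : 𝟙_ Wires ⟶ A ⊗ A := box a 0 2

theorem had_had : had ≫ had = withScalar (scal 2) (𝟙 A) :=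
  (cls_rule .hs2).trans (cls_tensor_scalar Diagram.wire 2)

theorem box_had_box (m n : ℕ) (a : ℂ) :
    box a m 1 ≫ had ≫ box (-1) 1 n = withScalar (scal 2) (box a m n) :=
  (Category.assoc _ _ _).symm.trans
    ((cls_rule (.hs1 m n a)).trans (cls_tensor_scalar (.H m n a) 2))

theorem greyUnit_discard : greyUnit ≫ discard = 𝟙 _ :=
  (cls_rule (.ba1 0 0)).trans (cls_bipartite_zero_zero _ _)

theorem greyUnit_fork : greyUnit ≫ fork = (λ_ _).inv ≫ (greyUnit ⊗ₘ greyUnit) :=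
  (cls_rule (.ba1 0 2)).trans (cls_bipartite_zero_two _ _)

theorem greyJoin_discard : greyJoin ≫ discard = (discard ⊗ₘ discard) ≫ (λ_ _).hom :=
  (cls_rule (.ba1 2 0)).trans (cls_bipartite_two_zero _ _)

theorem greyJoin_fork :
    greyJoin ≫ fork = (fork ⊗ₘ fork) ≫ tensorμ A A A A ≫ (greyJoin ⊗ₘ greyJoin) :=
  (cls_rule (.ba1 2 2)).trans (cls_bipartite_two_two _ _)

theorem state_greyDiscard : state (-1) ≫ greyDiscard = 𝟙 _ :=
  (cls_rule (.ba2 0 0)).trans (cls_bipartite_zero_zero _ _)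

theorem state_grey_one_one : state (-1) ≫ grey 1 1 = state (-1) :=
  (cls_rule (.ba2 0 1)).trans (cls_bipartite_zero_one _ _)

theorem state_greyFork :
    state (-1) ≫ greyFork = (λ_ _).inv ≫ (state (-1) ⊗ₘ state (-1)) :=
  (cls_rule (.ba2 0 2)).trans (cls_bipartite_zero_two _ _)

theorem boxJoin_greyDiscard : boxJoin ≫ greyDiscard = (discard ⊗ₘ discard) ≫ (λ_ _).hom :=
  (cls_rule (.ba2 2 0)).trans (cls_bipartite_two_zero _ _)

theorem boxJoin_greyFork :
    boxJoin ≫ greyFork = (fork ⊗ₘ fork) ≫ tensorμ A A A A ≫ (boxJoin ⊗ₘ boxJoin) :=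
  (cls_rule (.ba2 2 2)).trans (cls_bipartite_two_two _ _)

end ZH.Wires

/-! ### The bialgebra rules turned upside down -/

namespace ZH.Wires

open SelfDual

theorem leftUnitor_whiskerRight_leftUnitor {C : Type*} [Category* C] [MonoidalCategory C] :
    (λ_ (𝟙_ C)).hom ▷ 𝟙_ C ≫ (λ_ _).hom = (𝟙_ C ⊗ 𝟙_ C) ◁ (λ_ (𝟙_ C)).inv ≫
      ((λ_ (𝟙_ C)).hom ⊗ₘ (λ_ _).hom) ≫ (λ_ _).hom := by
  monoidal

theorem mate_leftUnitor : Mate (λ_ (𝟙_ Wires)).hom (λ_ (𝟙_ Wires)).inv := by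
  change (λ_ (𝟙_ Wires)).hom ▷ _ ≫ (λ_ _).hom = (𝟙_ Wires ⊗ 𝟙_ Wires) ◁ (λ_ (𝟙_ Wires)).inv ≫
    tensorμ (𝟙_ Wires) (𝟙_ _) (𝟙_ _) (𝟙_ _) ≫ ((λ_ (𝟙_ Wires)).hom ⊗ₘ (λ_ _).hom) ≫ (λ_ _).hom
  rw [reassoc_of% (tensorμ_unit (C := Wires))]
  exact leftUnitor_whiskerRight_leftUnitor

theorem mate_join : Mate join fork := spider_zed.mate_two_one
theorem mate_unit : Mate unit discard := spider_zed.mate_zero_one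
theorem mate_had : Mate had had := (spider_box (-1)).mate_one_one
theorem mate_boxJoin : Mate boxJoin boxFork := (spider_box (-1)).mate_two_one
theorem mate_state (a : ℂ) : Mate (state a) (effect a) := (spider_box a).mate_zero_one

theorem mate_greyUnit : Mate greyUnit greyDiscard := by
  rw [greyUnit_eq, greyDiscard_eq]
  exact (mate_unit.comp mate_had).withScalar _

theorem mate_greyJoin : Mate greyJoin greyFork := by
  rw [greyJoin_eq, greyFork_eq, ← Category.assoc had]
  exact ((mate_had.tensor mate_had).comp (mate_join.comp mate_had)).withScalar _

/-- Here and below, both sides of a bialgebra rule have known mates, so uniqueness of mates gives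
the transposed equation. -/
theorem unit_greyDiscard : unit ≫ greyDiscard = 𝟙 _ := by
  have h := mate_greyUnit.comp mate_unit.symm
  rw [greyUnit_discard] at h
  exact h.unique Mate.id

theorem join_greyDiscard : join ≫ greyDiscard = (greyDiscard ⊗ₘ greyDiscard) ≫ (λ_ _).hom := by
  have h := mate_greyUnit.comp mate_join.symm
  rw [greyUnit_fork] at h
  exact h.unique (mate_leftUnitor.symm.comp (mate_greyUnit.tensor mate_greyUnit))

theorem unit_greyFork : unit ≫ greyFork = (λ_ _).inv ≫ (unit ⊗ₘ unit) := by
  have h := mate_greyJoin.comp mate_unit.symm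
  rw [greyJoin_discard] at h
  exact h.unique ((mate_unit.symm.tensor mate_unit.symm).comp mate_leftUnitor)

theorem join_greyFork :
    join ≫ greyFork = (greyFork ⊗ₘ greyFork) ≫ tensorμ A A A A ≫ (join ⊗ₘ join) := by
  have h := mate_greyJoin.comp mate_join.symm
  rw [greyJoin_fork] at h
  exact (h.unique ((mate_join.symm.tensor mate_join.symm).comp
    (mate_tensorμ.comp (mate_greyJoin.tensor mate_greyJoin)))).trans (Category.assoc _ _ _)

theorem greyUnit_effect : greyUnit ≫ effect (-1) = 𝟙 _ := by
  have h := (mate_state (-1)).comp mate_greyUnit.symm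
  rw [state_greyDiscard] at h
  exact h.unique Mate.id

theorem greyJoin_effect :
    greyJoin ≫ effect (-1) = (effect (-1) ⊗ₘ effect (-1)) ≫ (λ_ _).hom := by
  have h := (mate_state (-1)).comp mate_greyJoin.symm
  rw [state_greyFork] at h
  exact h.unique (mate_leftUnitor.symm.comp ((mate_state _).tensor (mate_state _)))

theorem greyUnit_boxFork : greyUnit ≫ boxFork = (λ_ _).inv ≫ (unit ⊗ₘ unit) := by
  have h := mate_boxJoin.comp mate_greyUnit.symm
  rw [boxJoin_greyDiscard] at h
  exact h.unique ((mate_unit.symm.tensor mate_unit.symm).comp mate_leftUnitor)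

theorem greyJoin_boxFork :
    greyJoin ≫ boxFork = (boxFork ⊗ₘ boxFork) ≫ tensorμ A A A A ≫ (join ⊗ₘ join) := by
  have h := mate_boxJoin.comp mate_greyJoin.symm
  rw [boxJoin_greyFork] at h
  exact (h.unique ((mate_join.symm.tensor mate_join.symm).comp
    (mate_tensorμ.comp (mate_boxJoin.tensor mate_boxJoin)))).trans (Category.assoc _ _ _)

/-! ### Scalars -/

/-- `grey 1 1` is a plain wire with the scalars ½ and 2 beside it. Rule BA2 lets the state with
label -1 absorb it, and `greyDiscard` then removes the state. -/
theorem scal_half_two : scal 2 ≫ scal (1 / 2) = 𝟙 _ := by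
  have h := state_grey_one_one
  rw [grey_one_one, had_had, withScalar_withScalar, comp_withScalar, Category.comp_id] at h
  have h₂ := congrArg (· ≫ greyDiscard) h
  simpa only [withScalar_comp, state_greyDiscard, withScalar_id] using h₂

theorem scal_two_half : scal (1 / 2) ≫ scal 2 = 𝟙 _ := by
  rw [scalar_comm, scal_half_two]

/-- The map from the ring of variables that sends the variable to the constant one. -/
noncomputable def one : A ⟶ 𝟙_ Wires := withScalar (scal (1 / 2)) (had ≫ effect (-1))

/-- The map that sends a variable to the product of two variables. -/
noncomputable def conj : A ⟶ A ⊗ A := withScalar (scal (1 / 2)) (had ≫ boxFork)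

end ZH.Wires

/-! ### Convolution, and tensor products as coproducts of commutative monoids -/

namespace ZH

section Convolution

variable {C : Type*} [Category* C] [MonoidalCategory C] {B X Y : C} [MonObj X] [MonObj Y]

/-- The convolution of two morphisms to a monoid object. -/
def conv (D : B ⟶ B ⊗ B) (p q : B ⟶ X) : B ⟶ X := D ≫ (p ⊗ₘ q) ≫ μ

theorem conv_assoc {D : B ⟶ B ⊗ B} (h : D ≫ D ▷ B ≫ (α_ B B B).hom = D ≫ B ◁ D)
    (p q r : B ⟶ X) : conv D (conv D p q) r = conv D p (conv D q r) := by
  have h₁ : conv D p (conv D q r) = (D ≫ B ◁ D) ≫ (p ⊗ₘ (q ⊗ₘ r)) ≫ X ◁ μ ≫ μ := by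
    simp only [conv, Category.assoc, ← id_tensorHom, tensorHom_comp_tensorHom_assoc,
      Category.id_comp, Category.comp_id]
  have h₂ : conv D (conv D p q) r = (D ≫ D ▷ B ≫ (α_ B B B).hom) ≫
      (p ⊗ₘ (q ⊗ₘ r)) ≫ X ◁ μ ≫ μ := by
    rw [Category.assoc, Category.assoc, ← associator_naturality_assoc, ← MonObj.mul_assoc]
    simp only [conv, ← tensorHom_id, tensorHom_comp_tensorHom_assoc,
      Category.id_comp, Category.comp_id]
  rw [h₁, h₂, h]

theorem conv_comm [BraidedCategory C] [IsCommMonObj X] {D : B ⟶ B ⊗ B}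
    (h : D ≫ (β_ B B).hom = D) (p q : B ⟶ X) : conv D p q = conv D q p := by
  calc conv D p q = D ≫ (β_ B B).hom ≫ (p ⊗ₘ q) ≫ μ := by rw [reassoc_of% h]; rfl
    _ = conv D q p := by
      rw [← BraidedCategory.braiding_naturality_assoc, IsCommMonObj.mul_comm]; rfl

theorem conv_const (D : B ⟶ B ⊗ B) (e : B ⟶ 𝟙_ C) (p : B ⟶ X) :
    conv D p (e ≫ η) = (D ≫ B ◁ e ≫ (ρ_ B).hom) ≫ p := by
  simp only [conv, MonoidalCategory.tensorHom_def, Category.assoc, MonoidalCategory.whiskerLeft_comp, MonObj.mul_one]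
  rw [← whisker_exchange_assoc, rightUnitor_naturality]

theorem conv_one {D : B ⟶ B ⊗ B} {e : B ⟶ 𝟙_ C} (h : D ≫ B ◁ e ≫ (ρ_ B).hom = 𝟙 B)
    (p : B ⟶ X) : conv D p (e ≫ η) = p := by
  rw [conv_const, h, Category.id_comp]

theorem conv_comp (D : B ⟶ B ⊗ B) (p q : B ⟶ X) (f : X ⟶ Y) [IsMonHom f] :
    conv D p q ≫ f = conv D (p ≫ f) (q ≫ f) := by
  simp [conv, IsMonHom.mul_hom]

instance [BraidedCategory C] [IsCommMonObj X] : IsMonHom μ[X] where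
  one_hom := by
    change ((λ_ (𝟙_ C)).inv ≫ (η ⊗ₘ η)) ≫ μ = η
    rw [Category.assoc, MonObj.one_mul_hom, Iso.inv_hom_id_assoc]
  mul_hom := by
    change (tensorμ X X X X ≫ (μ ⊗ₘ μ)) ≫ μ = _
    rw [Category.assoc, MonObj.mul_mul_mul_comm]

/-- Commutativity of `X` makes its multiplication a homomorphism, and the convolution is then a
composite of homomorphisms. -/
theorem isMonHom_conv [BraidedCategory C] [IsCommMonObj X] [MonObj B] (D : B ⟶ B ⊗ B)
    [IsMonHom D] (p q : B ⟶ X) [IsMonHom p] [IsMonHom q] : IsMonHom (conv D p q) :=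
  inferInstanceAs (IsMonHom (D ≫ (p ⊗ₘ q) ≫ μ))

end Convolution

section Injections

variable {C : Type*} [Category* C] [MonoidalCategory C] {X Y : C} [MonObj X] [MonObj Y]

theorem leftUnitor_inv_assoc : (λ_ (𝟙_ C)).inv ≫ (λ_ (𝟙_ C)).inv ▷ 𝟙_ C ≫ (α_ _ _ _).hom =
    (λ_ (𝟙_ C)).inv ≫ 𝟙_ C ◁ (λ_ (𝟙_ C)).inv := by monoidal

theorem leftUnitor_inv_rightUnitor :
    (λ_ (𝟙_ C)).inv ≫ 𝟙_ C ◁ 𝟙 (𝟙_ C) ≫ (ρ_ (𝟙_ C)).hom = 𝟙 _ := by monoidal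

variable (X Y) in
/-- The homomorphism to the left factor. -/
def inl : X ⟶ X ⊗ Y := (ρ_ X).inv ≫ X ◁ η

variable (X Y) in
/-- The homomorphism to the right factor. -/
def inr : Y ⟶ X ⊗ Y := (λ_ Y).inv ≫ η ▷ Y

instance : IsMonHom η[X] where
  one_hom := Category.id_comp _
  mul_hom := by
    rw [MonoidalCategory.tensorHom_def, Category.assoc, MonObj.mul_one, rightUnitor_naturality, ← unitors_equal]
    rfl

variable [BraidedCategory C]

instance : IsMonHom (inl X Y) := inferInstanceAs (IsMonHom ((ρ_ X).inv ≫ X ◁ η))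

instance : IsMonHom (inr X Y) := inferInstanceAs (IsMonHom ((λ_ Y).inv ≫ η ▷ Y))

/-- The homomorphism from a coproduct. -/
def lift {B B' : C} (f : B ⟶ X) (g : B' ⟶ X) : B ⊗ B' ⟶ X := (f ⊗ₘ g) ≫ μ

theorem isMonHom_lift {B B' : C} [MonObj B] [MonObj B'] [IsCommMonObj X] (f : B ⟶ X) (g : B' ⟶ X)
    [IsMonHom f] [IsMonHom g] : IsMonHom (lift f g) :=
  inferInstanceAs (IsMonHom ((f ⊗ₘ g) ≫ μ))

omit [MonObj Y] [BraidedCategory C] in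
theorem lift_assoc {B B' B'' : C} (f : B ⟶ X) (g : B' ⟶ X) (h : B'' ⟶ X) :
    lift (lift f g) h = (α_ B B' B'').hom ≫ lift f (lift g h) := by
  have h₁ : lift f (lift g h) = (f ⊗ₘ (g ⊗ₘ h)) ≫ X ◁ μ ≫ μ := by
    simp only [lift, ← id_tensorHom, tensorHom_comp_tensorHom_assoc, Category.comp_id]
  have h₂ : lift (lift f g) h = ((f ⊗ₘ g) ⊗ₘ h) ≫ μ ▷ X ≫ μ := by
    simp only [lift, ← tensorHom_id, tensorHom_comp_tensorHom_assoc, Category.comp_id]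
  rw [h₁, h₂, MonObj.mul_assoc, associator_naturality_assoc]

omit [BraidedCategory C] in
theorem lift_comp {B B' : C} (f : B ⟶ X) (g : B' ⟶ X) (h : X ⟶ Y) [IsMonHom h] :
    lift f g ≫ h = lift (f ≫ h) (g ≫ h) := by
  simp only [lift, Category.assoc, IsMonHom.mul_hom, tensorHom_comp_tensorHom_assoc]

omit [MonObj Y] [BraidedCategory C] in
theorem lift_comp_right {B B' B'' : C} (f : B ⟶ X) (g : B' ⟶ B'') (h : B'' ⟶ X) :
    lift f (g ≫ h) = B ◁ g ≫ lift f h := by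
  simp only [lift, ← id_tensorHom, tensorHom_comp_tensorHom_assoc, Category.id_comp]

omit [BraidedCategory C] [MonObj Y] in
theorem lift_one_right {B B' : C} (f : B ⟶ X) (g : B' ⟶ 𝟙_ C) :
    lift f (g ≫ η) = B ◁ g ≫ (ρ_ B).hom ≫ f := by
  rw [lift_comp_right, lift, MonObj.mul_one_hom]

theorem inl_lift {B B' : C} [MonObj B] [MonObj B'] (f : B ⟶ X) (g : B' ⟶ X) [IsMonHom g] :
    inl B B' ≫ lift f g = f := by
  simp only [inl, lift, Category.assoc]
  rw [← id_tensorHom, tensorHom_comp_tensorHom_assoc, IsMonHom.one_hom, MonObj.mul_one_hom,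
    Category.id_comp, Iso.inv_hom_id_assoc]

theorem inr_lift {B B' : C} [MonObj B] [MonObj B'] (f : B ⟶ X) (g : B' ⟶ X) [IsMonHom f] :
    inr B B' ≫ lift f g = g := by
  simp only [inr, lift, Category.assoc]
  rw [← tensorHom_id, tensorHom_comp_tensorHom_assoc, IsMonHom.one_hom, MonObj.one_mul_hom,
    Category.id_comp, Iso.inv_hom_id_assoc]

theorem inl_tensor_inr_mul : (inl X Y ⊗ₘ inr X Y) ≫ μ = 𝟙 (X ⊗ Y) := by
  have h : (inl X Y ⊗ₘ inr X Y) ≫ μ =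
      ((ρ_ X).inv ⊗ₘ (λ_ Y).inv) ≫ ((𝟙 X ⊗ₘ η[Y]) ⊗ₘ (η[X] ⊗ₘ 𝟙 Y)) ≫ tensorμ X Y X Y ≫ (μ ⊗ₘ μ) := by
    simp only [inl, inr, ← tensorHom_id, ← id_tensorHom, tensorHom_comp_tensorHom_assoc]
    rfl
  rw [h, tensorμ_natural_assoc, tensorHom_comp_tensorHom, MonObj.mul_one_hom, MonObj.one_mul_hom,
    Category.comp_id, Category.comp_id]
  simp only [tensorμ, braiding_tensorUnit_left]
  monoidal

theorem lift_inl_inr : lift (inl X Y) (inr X Y) = 𝟙 (X ⊗ Y) := inl_tensor_inr_mul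

/-- Exhibits the joining of two wires as a substitution of variables, as `lift_inl_inl` does for
splitting a wire and `whiskerLeft_braid` for crossing two. This is how these operations are computed
on normal forms. -/
theorem lift_id_inr : lift (𝟙 (X ⊗ Y)) (inr X Y) = (α_ X Y Y).hom ≫ X ◁ μ := by
  have h : lift (inr X Y) (inr X Y) = μ ≫ inr X Y := (IsMonHom.mul_hom _).symm
  rw [← lift_inl_inr, lift_assoc, h, lift_comp_right, lift_inl_inr, Category.comp_id]

theorem lift_inl_inl {B Z : C} [MonObj Z] (D : B ⟶ Y ⊗ Z) :
    lift (inl X Y ≫ inl (X ⊗ Y) Z) (D ≫ (inr X Y ≫ inl (X ⊗ Y) Z ⊗ₘ inr (X ⊗ Y) Z) ≫ μ) =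
      X ◁ D ≫ (α_ X Y Z).inv := by
  have h : lift (inl X Y ≫ inl (X ⊗ Y) Z) (lift (inr X Y ≫ inl (X ⊗ Y) Z) (inr (X ⊗ Y) Z)) =
      (α_ X Y Z).inv := by
    rw [← cancel_epi (α_ X Y Z).hom, ← lift_assoc, ← lift_comp, lift_inl_inr, Category.id_comp,
      lift_inl_inr, Iso.hom_inv_id]
  rw [lift_comp_right]
  exact congrArg _ h

omit [MonObj Y] in
theorem braid_lift [IsCommMonObj X] {B B' : C} (f : B ⟶ X) (g : B' ⟶ X) :
    (β_ B' B).hom ≫ lift f g = lift g f := by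
  rw [lift, ← BraidedCategory.braiding_naturality_assoc, IsCommMonObj.mul_comm, lift]

theorem whiskerLeft_braid {Z : C} [MonObj Z] [IsCommMonObj ((X ⊗ Y) ⊗ Z)] :
    (α_ X Z Y).hom ≫ X ◁ (β_ Z Y).hom ≫ (α_ X Y Z).inv =
      lift (lift (inl X Y ≫ inl (X ⊗ Y) Z) (inr (X ⊗ Y) Z)) (inr X Y ≫ inl (X ⊗ Y) Z) := by
  have h : lift (inl X Y ≫ inl (X ⊗ Y) Z) (lift (inr X Y ≫ inl (X ⊗ Y) Z) (inr (X ⊗ Y) Z)) =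
      (α_ X Y Z).inv := by
    rw [← cancel_epi (α_ X Y Z).hom, ← lift_assoc, ← lift_comp, lift_inl_inr, Category.id_comp,
      lift_inl_inr, Iso.hom_inv_id]
  rw [lift_assoc, ← h, ← lift_comp_right, braid_lift]

omit [BraidedCategory C] in
theorem inl_whiskerRight {X' : C} [MonObj X'] (f : X ⟶ X') : inl X Y ≫ f ▷ Y = f ≫ inl X' Y := by
  rw [inl, inl, Category.assoc, whisker_exchange, ← rightUnitor_inv_naturality_assoc]

omit [BraidedCategory C] in
theorem inr_whiskerRight {X' : C} [MonObj X'] (f : X ⟶ X') [IsMonHom f] :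
    inr X Y ≫ f ▷ Y = inr X' Y := by
  rw [inr, inr, Category.assoc, ← comp_whiskerRight, IsMonHom.one_hom]

theorem tensor_inl_inr {B B' : C} (f : B ⟶ X) (g : B' ⟶ Y) :
    ((f ≫ inl X Y) ⊗ₘ (g ≫ inr X Y)) ≫ μ = f ⊗ₘ g := by
  rw [← tensorHom_comp_tensorHom_assoc, inl_tensor_inr_mul, Category.comp_id]

omit [MonObj Y] in
theorem lift_tensor_lift_mul [IsCommMonObj X] {B B' D D' : C} (f : B ⟶ X) (g : B' ⟶ X)
    (f' : D ⟶ X) (g' : D' ⟶ X) : (lift f g ⊗ₘ lift f' g') ≫ μ =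
      tensorμ B B' D D' ≫ lift (lift f f') (lift g g') := by
  simp only [lift]
  rw [← tensorHom_comp_tensorHom_assoc, ← MonObj.mul_mul_mul_comm, tensorμ_natural_assoc,
    tensorHom_comp_tensorHom_assoc]

/-- A projection formula: with `d` the summation over a variable, a factor that does not involve
this variable leaves the sum. -/
theorem inl_mul_whiskerLeft (d : Y ⟶ 𝟙_ C) :
    inl X Y ▷ (X ⊗ Y) ≫ μ[X ⊗ Y] ≫ X ◁ d ≫ (ρ_ X).hom = X ◁ (X ◁ d ≫ (ρ_ X).hom) ≫ μ := by
  have h : μ[X ⊗ Y] = tensorμ X Y X Y ≫ (μ ⊗ₘ μ) := rfl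
  have h₁ : (X ◁ η[Y]) ▷ (X ⊗ Y) ≫ tensorμ X Y X Y =
     tensorμ X (𝟙_ C) X Y ≫ (X ⊗ X) ◁ (η[Y] ▷ Y) := by
    simpa using tensorμ_natural_left (𝟙 X) η[Y] X Y
  have h₂ : tensorμ X (𝟙_ C) X Y = (ρ_ X).hom ▷ _ ≫ (α_ X X Y).inv ≫ (X ⊗ X) ◁ (λ_ Y).inv := by
    simp only [tensorμ, braiding_tensorUnit_left]
    monoidal
  rw [h, inl, comp_whiskerRight]
  simp only [Category.assoc]
  rw [reassoc_of% h₁, MonoidalCategory.tensorHom_def', Category.assoc,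
    ← MonoidalCategory.whiskerLeft_comp_assoc (X ⊗ X) (η[Y] ▷ Y), MonObj.one_mul, h₂]
  simp only [Category.assoc]
  rw [← MonoidalCategory.whiskerLeft_comp_assoc (X ⊗ X), Iso.inv_hom_id,
    ← comp_whiskerRight_assoc, Iso.inv_hom_id, ← whisker_exchange_assoc, rightUnitor_naturality]
  simp

theorem inl_tensor_mul_whiskerLeft {B B' : C} (f : B ⟶ X) (g : B' ⟶ X ⊗ Y) (d : Y ⟶ 𝟙_ C) :
    (f ≫ inl X Y ⊗ₘ g) ≫ μ ≫ X ◁ d ≫ (ρ_ X).hom = (f ⊗ₘ (g ≫ X ◁ d ≫ (ρ_ X).hom)) ≫ μ := by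
  have h₁ : (f ≫ inl X Y ⊗ₘ g) = (f ⊗ₘ g) ≫ inl X Y ▷ (X ⊗ Y) := by
    rw [← tensorHom_id, tensorHom_comp_tensorHom, Category.comp_id]
  have h₂ : (f ⊗ₘ (g ≫ X ◁ d ≫ (ρ_ X).hom)) = (f ⊗ₘ g) ≫ X ◁ (X ◁ d ≫ (ρ_ X).hom) := by
    rw [← id_tensorHom, ← id_tensorHom, tensorHom_comp_tensorHom, Category.comp_id]
  rw [h₁, h₂, Category.assoc, Category.assoc, inl_mul_whiskerLeft]

end Injections

end ZH

/-! ### The Boolean operations on a wire and their laws -/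

namespace ZH.Wires

open SelfDual

@[simp] theorem two_half {X Y : Wires} (f : X ⟶ Y) :
    withScalar (scal 2) (withScalar (scal (1 / 2)) f) = f := by
  rw [withScalar_withScalar, scal_two_half, one_withScalar]

@[simp] theorem half_two {X Y : Wires} (f : X ⟶ Y) :
    withScalar (scal (1 / 2)) (withScalar (scal 2) f) = f := by
  rw [withScalar_withScalar, scal_half_two, one_withScalar]

theorem had_had_assoc {X : Wires} (f : A ⟶ X) : had ≫ had ≫ f = withScalar (scal 2) f := by
  rw [← Category.assoc, had_had, withScalar_comp, Category.id_comp]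

theorem had_tensor_had_assoc {X : Wires} (f : A ⊗ A ⟶ X) :
    (had ⊗ₘ had) ≫ (had ⊗ₘ had) ≫ f = withScalar (scal 2) (withScalar (scal 2) f) := by
  rw [tensorHom_comp_tensorHom_assoc, had_had, withScalar_tensor, tensor_withScalar,
    withScalar_comp, withScalar_comp, id_tensorHom_id, Category.id_comp]

/-! ### The constants and the operations are homomorphisms -/

instance : IsMonHom greyDiscard where
  one_hom := unit_greyDiscard
  mul_hom := join_greyDiscard

instance : IsMonHom greyFork where
  one_hom := unit_greyFork
  mul_hom := join_greyFork

theorem unit_had : unit ≫ had = withScalar (scal 2) greyUnit := by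
  rw [greyUnit_eq, two_half]

/-- Moves a Hadamard box past `join` at the price of a grey spider, to which the transposed rule BA2
applies. This gives the homomorphism laws of `one` and `conj`. -/
theorem had_join_had : join ≫ had = withScalar (scal (1 / 2)) ((had ⊗ₘ had) ≫ greyJoin) := by
  rw [greyJoin_eq, comp_withScalar, had_tensor_had_assoc, half_two, half_two]

instance : IsMonHom one where
  one_hom := by
    change unit ≫ withScalar _ (had ≫ effect _) = 𝟙 _
    rw [comp_withScalar, ← Category.assoc, unit_had, withScalar_comp, half_two, greyUnit_effect]
  mul_hom := by
    change join ≫ withScalar _ (had ≫ effect _) = (withScalar _ _ ⊗ₘ withScalar _ _) ≫ (λ_ _).hom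
    rw [comp_withScalar, ← Category.assoc, had_join_had, withScalar_comp, Category.assoc,
      greyJoin_effect, withScalar_tensor, tensor_withScalar, withScalar_comp, withScalar_comp,
      ← tensorHom_comp_tensorHom, Category.assoc]

instance : IsMonHom conj where
  one_hom := by
    change unit ≫ withScalar _ (had ≫ boxFork) = (λ_ _).inv ≫ (unit ⊗ₘ unit)
    rw [comp_withScalar, ← Category.assoc, unit_had, withScalar_comp, half_two, greyUnit_boxFork]
  mul_hom := by
    change join ≫ withScalar _ (had ≫ boxFork) = (withScalar _ _ ⊗ₘ withScalar _ _) ≫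
      tensorμ A A A A ≫ (join ⊗ₘ join)
    rw [comp_withScalar, ← Category.assoc, had_join_had, withScalar_comp, Category.assoc,
      greyJoin_boxFork, withScalar_tensor, tensor_withScalar, withScalar_comp, withScalar_comp,
      ← tensorHom_comp_tensorHom, Category.assoc]

/-! ### Commutativity, associativity and units -/

theorem fork_braid : fork ≫ (β_ A A).hom = fork := spider_zed.perm_out 1 2 _

theorem boxFork_braid : boxFork ≫ (β_ A A).hom = boxFork := (spider_box (-1)).perm_out 1 2 _

/-- Cocommutativity makes the two iterated forks differ by a permutation of the three outputs, and
`T` is invariant under those. -/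
theorem coassoc_of_perm {F : A ⟶ A ⊗ A} {T : A ⟶ (A ⊗ A) ⊗ A} (h : F ≫ F ▷ A = T)
    (hT : ∀ e : Fin 3 ≃ Fin 3, T ≫ (isoWires e).hom = T) (hF : F ≫ (β_ A A).hom = F) :
    F ≫ F ▷ A ≫ (α_ A A A).hom = F ≫ A ◁ F := by
  have h₁ : F ≫ A ◁ F = T ≫ (β_ (A ⊗ A) A).hom := by
    rw [← h, Category.assoc, BraidedCategory.braiding_naturality_left, reassoc_of% hF]
  rw [h₁, reassoc_of% h]
  exact (hT (finCongr (Nat.add_assoc 1 1 1))).trans (hT (finAddFlip (m := 2) (n := 1))).symm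

theorem bendIn_join : bendIn join = fork := spider_zed.bendIn 1 1

theorem fork_fork : fork ≫ fork ▷ A = (zed 1 3 : A ⟶ (A ⊗ A) ⊗ A) := by
  have h : fork ≫ fork ▷ A = bendIn (join ≫ fork) := by rw [← bendIn_comp, bendIn_join]
  rw [h]
  exact (congrArg bendIn (zed_comp 2 2)).trans (spider_zed.bendIn 1 2)

theorem fork_assoc : fork ≫ fork ▷ A ≫ (α_ A A A).hom = fork ≫ A ◁ fork :=
  coassoc_of_perm fork_fork (spider_zed.perm_out 1 3) fork_braid

theorem fork_discard : fork ≫ A ◁ discard ≫ (ρ_ A).hom = 𝟙 A := by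
  have h : fork ≫ discard ▷ A = (λ_ A).inv := by
    rw [← bendIn_join, bendIn_comp]
    exact (congrArg bendIn (zed_comp 2 0)).trans ((spider_zed.bendIn 1 0).trans zed_one_one)
  rw [← fork_braid, Category.assoc, ← BraidedCategory.braiding_naturality_left_assoc,
    reassoc_of% h, braiding_rightUnitor, Iso.inv_hom_id]

theorem greyFork_braid : greyFork ≫ (β_ A A).hom = greyFork := by
  simp only [greyFork_eq, withScalar_comp, Category.assoc, BraidedCategory.braiding_naturality]
  rw [reassoc_of% fork_braid]

theorem greyFork_assoc : greyFork ≫ greyFork ▷ A ≫ (α_ A A A).hom = greyFork ≫ A ◁ greyFork := by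
  have h₁ : greyFork ≫ greyFork ▷ A = withScalar (scal (1 / 2))
      (had ≫ (fork ≫ fork ▷ A) ≫ ((had ⊗ₘ had) ⊗ₘ had)) := by
    rw [greyFork_eq, withScalar_whiskerRight, withScalar_comp, comp_withScalar]
    simp only [Category.assoc, ← tensorHom_id, tensorHom_comp_tensorHom, Category.comp_id,
      Category.id_comp]
    rw [had_had_assoc, withScalar_tensor, comp_withScalar, comp_withScalar, half_two]
  have h₂ : greyFork ≫ A ◁ greyFork = withScalar (scal (1 / 2))
      (had ≫ (fork ≫ A ◁ fork) ≫ (had ⊗ₘ (had ⊗ₘ had))) := by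
    rw [greyFork_eq, whiskerLeft_withScalar, withScalar_comp, comp_withScalar]
    simp only [Category.assoc, ← id_tensorHom, tensorHom_comp_tensorHom, Category.comp_id,
      Category.id_comp]
    rw [had_had_assoc, tensor_withScalar, comp_withScalar, comp_withScalar, half_two]
  rw [reassoc_of% h₁, h₂, ← fork_assoc, withScalar_comp]
  simp only [Category.assoc, associator_naturality]

theorem greyFork_greyDiscard : greyFork ≫ A ◁ greyDiscard ≫ (ρ_ A).hom = 𝟙 A := by
  rw [greyFork_eq, greyDiscard_eq, whiskerLeft_withScalar, withScalar_comp, withScalar_comp,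
    comp_withScalar]
  simp only [Category.assoc]
  rw [← id_tensorHom, tensorHom_comp_tensorHom_assoc, Category.comp_id, had_had_assoc,
    tensor_withScalar, withScalar_comp, comp_withScalar, comp_withScalar, half_two,
    MonoidalCategory.tensorHom_def', Category.assoc, rightUnitor_naturality,
    reassoc_of% fork_discard, had_had, half_two]

theorem box_half_had_box (m n : ℕ) (a : ℂ) :
    box a m 1 ≫ withScalar (scal (1 / 2)) (had ≫ box (-1) 1 n) = box a m n := by
  rw [comp_withScalar, box_had_box, half_two]

/-- Rule HS1 adds legs to a box with one output only. The other outputs are bent into inputs, hence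
the induction on `n` for all `m`. -/
theorem box_conj_whiskerRight (a : ℂ) (m n : ℕ) :
    (box a m (1 + n) : (⟨m⟩ : Wires) ⟶ A ⊗ ⟨n⟩) ≫ conj ▷ (⟨n⟩ : Wires) = box a m (2 + n) := by
  induction n generalizing m with
  | zero =>
    exact (congrArg (Mor.comp (box a m 1)) (Mor.tensor_zero conj)).trans (box_half_had_box m 2 a)
  | succ n ih =>
    have h₁ : (box a m (1 + n + 1) : (⟨m⟩ : Wires) ⟶ (A ⊗ ⟨n⟩) ⊗ A) =
        bendIn (X := ⟨m⟩) (box a (m + 1) (1 + n)) := ((spider_box a).bendIn m (1 + n)).symm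
    have h₂ : (box a m (2 + n + 1) : (⟨m⟩ : Wires) ⟶ ((A ⊗ A) ⊗ ⟨n⟩) ⊗ A) =
        bendIn (X := ⟨m⟩) (box a (m + 1) (2 + n)) := ((spider_box a).bendIn m (2 + n)).symm
    have h₃ : (box a m (1 + n + 1) : (⟨m⟩ : Wires) ⟶ (A ⊗ ⟨n⟩) ⊗ A) ≫ conj ▷ (⟨n⟩ : Wires) ▷ A =
        (box a m (2 + n + 1) : (⟨m⟩ : Wires) ⟶ ((A ⊗ A) ⊗ ⟨n⟩) ⊗ A) := by
      rw [h₁, h₂, bendIn_comp]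
      exact congrArg (bendIn (X := ⟨m⟩)) (ih (m + 1))
    have h₄ : conj ▷ (⟨n⟩ : Wires) ▷ A = Mor.tensor conj (Mor.wires (Equiv.refl (Fin (n + 1)))) := by
      have h := Mor.tensor_assoc conj (Mor.wires (Equiv.refl (Fin n))) (Mor.wires (Equiv.refl (Fin 1)))
      rw [Mor.wires_tensor, Mor.sumWires_refl] at h
      exact (Mor.comp_id _).symm.trans (h.trans (Mor.id_comp _))
    exact (congrArg (Mor.comp (box a m (1 + n + 1))) h₄.symm).trans h₃

theorem conj_braid : conj ≫ (β_ A A).hom = conj := by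
  rw [conj, withScalar_comp, Category.assoc, boxFork_braid]

theorem conj_assoc : conj ≫ conj ▷ A ≫ (α_ A A A).hom = conj ≫ A ◁ conj := by
  have h : boxFork ≫ conj ▷ A = (box (-1) 1 3 : A ⟶ (A ⊗ A) ⊗ A) :=
    box_conj_whiskerRight (-1) 1 1
  refine coassoc_of_perm (T := withScalar (scal (1 / 2)) (had ≫ (box (-1) 1 3 : A ⟶ (A ⊗ A) ⊗ A)))
    ?_ (fun e => ?_) conj_braid
  · rw [← h]
    conv_lhs => rw [conj, withScalar_comp, ← conj, Category.assoc]
  · rw [withScalar_comp, Category.assoc]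
    exact congrArg (fun t => withScalar _ (had ≫ t)) ((spider_box (-1)).perm_out 1 3 e)

theorem conj_one : conj ≫ A ◁ one ≫ (ρ_ A).hom = 𝟙 A := by
  have h₁ : bendIn boxJoin = boxFork := (spider_box (-1)).bendIn 1 1
  have h : boxFork ≫ one ▷ A = had ≫ (λ_ A).inv := by
    rw [← h₁, bendIn_comp]
    exact (congrArg bendIn (box_half_had_box 2 0 (-1))).trans (((spider_box (-1)).bendIn 1 0).trans
      (Category.comp_id had).symm)
  rw [← conj_braid, Category.assoc, ← BraidedCategory.braiding_naturality_left_assoc,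
    braiding_rightUnitor, conj, withScalar_comp, Category.assoc, reassoc_of% h, Iso.inv_hom_id,
    Category.comp_id, had_had, half_two]

/-! ### Cups -/

theorem state_conj (a : ℂ) : state a ≫ conj = state₂ a := box_half_had_box 0 2 a

theorem state_one (a : ℂ) : state a ≫ one = scal a := box_half_had_box 0 0 a

theorem cup_box (a : ℂ) : cup ≫ box a 1 1 ▷ A = state₂ a := by
  have key : ∀ f : A ⟶ A, cup ≫ f ▷ A = bendIn ((λ_ A).hom ≫ f) := fun f => by
    simp [bendIn, ← unitors_inv_equal]
  exact (key _).trans ((congrArg bendIn (Mor.id_comp _)).trans ((spider_box a).bendIn 0 1))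

theorem bendOut_cup {Y : Wires} (f : A ⟶ Y) : bendOut (cup ≫ f ▷ A) = (λ_ A).hom ≫ f := by
  have h : bendOut (cup ≫ f ▷ A) = (λ_ A).hom ≫ ((λ_ A).inv ≫ cup ▷ A ≫ (α_ A A A).hom ≫
      A ◁ cap ≫ (ρ_ A).hom) ≫ f := by
    simp only [bendOut, comp_whiskerRight, Category.assoc, associator_naturality_left_assoc,
      ← whisker_exchange_assoc, Iso.hom_inv_id_assoc, rightUnitor_naturality]
  rw [h, snake_left, Category.id_comp]

/-- `Mate` is defined by sliding past caps; bending both sides gives the same law for cups. -/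
theorem cup_whiskerRight {Y : Wires} [SelfDual Y] {f : A ⟶ Y} {g : Y ⟶ A} (h : Mate g f) :
    cup ≫ f ▷ A = cu (X := Y) ≫ Y ◁ g := by
  rw [← bendIn_bendOut (cup ≫ f ▷ A), ← bendIn_bendOut (cu (X := Y) ≫ Y ◁ g)]
  congr 1
  have h₂ : bendOut (cu (X := Y) ≫ Y ◁ g) = (λ_ A).hom ≫ f ≫ ((λ_ Y).inv ≫ cu ▷ Y ≫
      (α_ Y Y Y).hom ≫ Y ◁ cp ≫ (ρ_ Y).hom) := by
    have h' : g ▷ A ≫ cap = Y ◁ f ≫ cp := h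
    simp only [bendOut, comp_whiskerRight, Category.assoc, whisker_assoc, Iso.inv_hom_id_assoc,
      ← whiskerLeft_comp_assoc, h']
    rw [← leftUnitor_naturality_assoc, Iso.hom_inv_id_assoc, whisker_exchange_assoc]
    simp
  rw [bendOut_cup, h₂, zigzag, Category.comp_id]

theorem cup_had : cup ≫ had ▷ A = cup ≫ A ◁ had := cup_whiskerRight mate_had

end ZH.Wires

/-! ### The monoid of states and the ring of polynomials -/

namespace ZH.Wires

open SelfDual

variable {X Y Z : Wires} [MonObj X] [IsCommMonObj X] [MonObj Y] [IsCommMonObj Y] [MonObj Z]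
  [IsCommMonObj Z]

/-! ### States -/

/-- Diagrams without inputs. -/
@[ext] structure State (X : Wires) where
  /-- The underlying morphism. -/
  hom : 𝟙_ Wires ⟶ X

namespace State

instance : Mul (State X) := ⟨fun s t => ⟨conv (λ_ _).inv s.hom t.hom⟩⟩
instance : One (State X) := ⟨⟨η[X]⟩⟩

omit [IsCommMonObj X] in
theorem mul_hom (s t : State X) : (s * t).hom = (λ_ _).inv ≫ (s.hom ⊗ₘ t.hom) ≫ μ := rfl

instance : CommMonoid (State X) where
  mul_assoc s t u := State.ext (conv_assoc leftUnitor_inv_assoc s.hom t.hom u.hom)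
  mul_comm s t := State.ext (conv_comm (by simp [unitors_inv_equal]) s.hom t.hom)
  mul_one s := State.ext ((congrArg (conv _ s.hom) (Category.id_comp _)).symm.trans
    (conv_one leftUnitor_inv_rightUnitor s.hom))
  one_mul s := State.ext ((conv_comm (by simp [unitors_inv_equal]) _ _).trans
    ((congrArg (conv _ s.hom) (Category.id_comp _)).symm.trans
      (conv_one leftUnitor_inv_rightUnitor s.hom)))

/-- Homomorphisms act on states. -/
def map (f : X ⟶ Y) [IsMonHom f] : State X →* State Y where
  toFun s := ⟨s.hom ≫ f⟩
  map_one' := State.ext (IsMonHom.one_hom f)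
  map_mul' s t := State.ext (conv_comp _ s.hom t.hom f)

theorem map_hom (f : X ⟶ Y) [IsMonHom f] (s : State X) : (map f s).hom = s.hom ≫ f := rfl

end State

/-! ### The ring of polynomials -/

variable (X) in
/-- Homomorphisms from a wire. -/
@[ext] structure Poly where
  /-- The underlying morphism. -/
  hom : A ⟶ X
  isMonHom : IsMonHom hom

namespace Poly

attribute [instance] Poly.isMonHom

noncomputable instance : Add (Poly X) :=
  ⟨fun p q => ⟨conv greyFork p.hom q.hom, isMonHom_conv _ _ _⟩⟩
noncomputable instance : Mul (Poly X) := ⟨fun p q => ⟨conv conj p.hom q.hom, isMonHom_conv _ _ _⟩⟩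
noncomputable instance : Zero (Poly X) := ⟨⟨greyDiscard ≫ η, inferInstance⟩⟩
noncomputable instance : One (Poly X) := ⟨⟨one ≫ η, inferInstance⟩⟩

theorem add_hom (p q : Poly X) : (p + q).hom = conv greyFork p.hom q.hom := rfl
theorem mul_hom (p q : Poly X) : (p * q).hom = conv conj p.hom q.hom := rfl
theorem zero_hom : (0 : Poly X).hom = greyDiscard ≫ η := rfl
theorem one_hom : (1 : Poly X).hom = one ≫ η := rfl

noncomputable instance : AddCommMonoid (Poly X) where
  nsmul := nsmulRec
  add_assoc p q r := Poly.ext (conv_assoc greyFork_assoc _ _ _)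
  add_comm p q := Poly.ext (conv_comm greyFork_braid _ _)
  add_zero p := Poly.ext (conv_one greyFork_greyDiscard _)
  zero_add p := Poly.ext ((conv_comm greyFork_braid _ _).trans (conv_one greyFork_greyDiscard _))

noncomputable instance : CommMonoid (Poly X) where
  mul_assoc p q r := Poly.ext (conv_assoc conj_assoc _ _ _)
  mul_comm p q := Poly.ext (conv_comm conj_braid _ _)
  mul_one p := Poly.ext (conv_one conj_one _)
  one_mul p := Poly.ext ((conv_comm conj_braid _ _).trans (conv_one conj_one _))

/-- Substitution of a polynomial into an H-box. -/
def H (a : ℂ) (p : Poly X) : State X := ⟨state a ≫ p.hom⟩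

theorem state_mul (a b : ℂ) : (λ_ _).inv ≫ (state a ⊗ₘ state b) ≫ join = state (a * b) :=
  (Mor.id_comp _).trans (cls_rule (.mul a b))

theorem state_eq_unit : state 1 = unit := cls_rule .unit

theorem H_mul (a b : ℂ) (p : Poly X) : H a p * H b p = H (a * b) p := by
  have h := _root_.map_mul (State.map p.hom) ⟨state a⟩ ⟨state b⟩
  refine h.symm.trans (State.ext ?_)
  exact congrArg (· ≫ p.hom) (state_mul a b)

theorem H_one (p : Poly X) : H 1 p = 1 := by
  refine State.ext ?_
  rw [H, state_eq_unit]
  exact IsMonHom.one_hom p.hom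

theorem cup_had_whiskerRight : cup ≫ had ▷ A = state₂ (-1) := cup_box (-1)

/-- The bilinearity of xy in the exponent of -1: a Hadamard box turns `greyFork` into `fork`, which
slides round the cup and becomes `join`. -/
theorem state₂_greyFork : state₂ (-1) ≫ greyFork ▷ A = (λ_ _).inv ≫
    (state₂ (-1) ⊗ₘ state₂ (-1)) ≫ tensorμ A A A A ≫ (A ⊗ A) ◁ join := by
  have h : had ≫ greyFork = fork ≫ (had ⊗ₘ had) := by
    rw [greyFork_eq, comp_withScalar, had_had_assoc, half_two]
  have h₂ : cu (X := A ⊗ A) = (λ_ _).inv ≫ (cup ⊗ₘ cup) ≫ tensorμ A A A A := rfl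
  have h₃ : tensorμ A A A A ≫ (had ⊗ₘ had) ▷ (A ⊗ A) = (had ▷ A ⊗ₘ had ▷ A) ≫ tensorμ A A A A := by
    simpa using (tensorμ_natural had (𝟙 A) had (𝟙 A)).symm
  rw [← cup_had_whiskerRight, Category.assoc, ← comp_whiskerRight,
    h, comp_whiskerRight, ← Category.assoc, cup_whiskerRight mate_join, Category.assoc,
    whisker_exchange, h₂]
  simp only [Category.assoc]
  rw [reassoc_of% h₃, tensorHom_comp_tensorHom_assoc]

/-- By `state₂_greyFork` the two resulting factors share one argument through a `join`. Since `s` is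
a homomorphism it splits over this `join`, and each factor receives its own copy. -/
theorem H_add_mul (p q s : Poly X) : H (-1) ((p + q) * s) = H (-1) (p * s) * H (-1) (q * s) := by
  have h : ∀ p : A ⟶ X, state (-1) ≫ conv conj p s.hom = state₂ (-1) ≫ (p ⊗ₘ s.hom) ≫ μ := fun p => by
    rw [← state_conj, Category.assoc]; rfl
  have h₂ : (greyFork ≫ (p.hom ⊗ₘ q.hom) ≫ μ) ⊗ₘ s.hom =
      greyFork ▷ A ≫ ((p.hom ⊗ₘ q.hom) ⊗ₘ s.hom) ≫ μ ▷ X := by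
    simp only [← tensorHom_id, tensorHom_comp_tensorHom, Category.id_comp, Category.comp_id]
  have h₃ : (A ⊗ A) ◁ join ≫ ((p.hom ⊗ₘ q.hom) ⊗ₘ s.hom) ≫ μ ▷ X ≫ μ =
      ((p.hom ⊗ₘ q.hom) ⊗ₘ (s.hom ⊗ₘ s.hom)) ≫ (μ ⊗ₘ μ) ≫ μ := by
    have h₄ : join ≫ s.hom = (s.hom ⊗ₘ s.hom) ≫ μ := IsMonHom.mul_hom s.hom
    simp only [← tensorHom_id, ← id_tensorHom, tensorHom_comp_tensorHom_assoc, Category.id_comp,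
      Category.comp_id, h₄]
  refine State.ext ?_
  simp only [H, mul_hom, add_hom, State.mul_hom, h]
  rw [conv, h₂, Category.assoc, reassoc_of% state₂_greyFork, Category.assoc, h₃,
    ← tensorμ_natural_assoc, MonObj.mul_mul_mul_comm]
  simp only [tensorHom_comp_tensorHom_assoc]

/-- Substitution of variables. -/
def subst (f : X ⟶ Y) [IsMonHom f] (p : Poly X) : Poly Y := ⟨p.hom ≫ f, inferInstance⟩

variable (X) in
/-- The new variable. -/
def var : Poly (X ⊗ A) := ⟨inr X A, inferInstance⟩

theorem subst_mul (f : X ⟶ Y) [IsMonHom f] (p q : Poly X) : subst f (p * q) = subst f p * subst f q :=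
  Poly.ext (conv_comp _ _ _ _)

theorem subst_add (f : X ⟶ Y) [IsMonHom f] (p q : Poly X) : subst f (p + q) = subst f p + subst f q :=
  Poly.ext (conv_comp _ _ _ _)

/-- With a fresh variable y, the state (-1)^{py} is `p` bent round a cup with a Hadamard box on the
other leg. Both operations can be undone, so ring identities may be tested in exponents of -1. -/
theorem eq_of_H {p q : Poly X} (h : H (-1) (subst (inl X A) p * var X) =
    H (-1) (subst (inl X A) q * var X)) : p = q := by
  have key : ∀ p : Poly X, H (-1) (subst (inl X A) p * var X) = ⟨cup ≫ p.hom ▷ A ≫ X ◁ had⟩ := by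
    intro p
    have h : (p.hom ≫ inl X A ⊗ₘ inr X A) ≫ μ = p.hom ⊗ₘ 𝟙 A := by
      simpa using tensor_inl_inr p.hom (𝟙 A)
    simp only [H, mul_hom, conv, subst, var]
    rw [h, reassoc_of% state_conj, ← cup_had_whiskerRight, cup_had, tensorHom_id, Category.assoc, whisker_exchange]
  rw [key, key, State.mk.injEq] at h
  have h₂ := congrArg (fun t => withScalar (scal (1 / 2)) (t ≫ X ◁ had)) h
  simp only [Category.assoc, ← whiskerLeft_comp, had_had, whiskerLeft_withScalar,
    comp_withScalar, half_two, whiskerLeft_id, Category.comp_id] at h₂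
  have h₃ := congrArg bendOut h₂
  rw [bendOut_cup, bendOut_cup, cancel_epi] at h₃
  exact Poly.ext h₃

/-- In the exponent of -1, against a fresh variable, `H_add_mul` turns both sums into the same
product. -/
theorem mul_add_distrib (p q r : Poly X) : p * (q + r) = p * q + p * r := by
  refine eq_of_H ?_
  generalize var X = y
  rw [subst_mul, subst_add, subst_add, subst_mul, subst_mul]
  generalize subst (inl X A) p = p, subst (inl X A) q = q, subst (inl X A) r = r
  have h : ∀ q r : Poly (X ⊗ A), p * q * r = q * (p * r) := fun q r => by
    rw [mul_comm p, mul_assoc]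
  rw [h, H_add_mul, H_add_mul, h, h]

theorem H_neg_one_mul_self (p : Poly X) : H (-1) p * H (-1) p = 1 := by
  rw [H_mul, neg_mul_neg, mul_one, H_one]

/-- As 0 + 0 = 0, this state equals its own square, and the square is 1. -/
theorem H_zero_mul (p : Poly X) : H (-1) (0 * p) = 1 := by
  have h := H_add_mul 0 0 p
  rw [add_zero] at h
  calc H (-1) (0 * p) = H (-1) (0 * p) * H (-1) (0 * p) := h
    _ = 1 := H_neg_one_mul_self _

theorem subst_zero (f : X ⟶ Y) [IsMonHom f] : subst f 0 = 0 :=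
  Poly.ext (by simp only [subst, zero_hom, Category.assoc, IsMonHom.one_hom])

theorem subst_one (f : X ⟶ Y) [IsMonHom f] : subst f 1 = 1 :=
  Poly.ext (by simp only [subst, one_hom, Category.assoc, IsMonHom.one_hom])

theorem add_self (p : Poly X) : p + p = 0 := by
  refine eq_of_H ?_
  rw [subst_add, H_add_mul, H_neg_one_mul_self, subst_zero, H_zero_mul]

theorem zero_mul' (p : Poly X) : 0 * p = 0 := by
  refine eq_of_H ?_
  rw [subst_mul, subst_zero, mul_assoc, H_zero_mul, H_zero_mul]

/-- The characteristic is 2, by `add_self`. -/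
noncomputable instance : Neg (Poly X) := ⟨id⟩

noncomputable instance : CommRing (Poly X) where
  zsmul := zsmulRec
  left_distrib := mul_add_distrib
  right_distrib p q r := by rw [mul_comm, mul_add_distrib, mul_comm r, mul_comm r]
  neg_add_cancel := add_self
  zero_mul := zero_mul'
  mul_zero p := by rw [mul_comm, zero_mul']
  mul_comm := mul_comm

end Poly

end ZH.Wires

/-! ### Negation, and the rules A and I for states -/

namespace ZH.Wires

open SelfDual

/-! ### Negation -/

/-- Negation. -/
noncomputable def neg : A ⟶ A := cls Diagram.neg

/-- NOT is XOR with the constant one: the Hadamard boxes around its spider, with one more pair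
cancelled, form `greyFork`. -/
theorem neg_eq : neg = greyFork ≫ A ◁ one ≫ (ρ_ A).hom := by
  have h : neg = withScalar (scal (1 / 2))
      (((had ≫ fork) ≫ (𝟙 A ⊗ₘ effect (-1)) : A ⟶ A ⊗ 𝟙_ _) ≫ had) := cls_tensor_scalar _ _
  have h' : (((had ≫ fork) ≫ (𝟙 A ⊗ₘ effect (-1)) : A ⟶ A ⊗ 𝟙_ _) ≫ had) =
      had ≫ fork ≫ A ◁ effect (-1) ≫ (ρ_ A).hom ≫ had := by
    have h₂ : (ρ_ A).hom ≫ had = had := Mor.id_comp had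
    rw [h₂, id_tensorHom]
    exact (Mor.assoc _ _ _).trans (Mor.assoc _ _ _)
  rw [h, h', greyFork_eq, one, whiskerLeft_withScalar, withScalar_comp, withScalar_comp,
    comp_withScalar]
  simp only [Category.assoc]
  rw [← id_tensorHom, ← id_tensorHom, tensorHom_comp_tensorHom_assoc, Category.comp_id,
    had_had_assoc, tensor_withScalar, withScalar_comp, comp_withScalar, comp_withScalar, half_two,
    MonoidalCategory.tensorHom_def' had, id_tensorHom]
  simp only [Category.assoc, rightUnitor_naturality]

theorem mul_state_comm {C : Type*} [Category* C] [MonoidalCategory C] [SymmetricCategory C] {X : C}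
    [MonObj X] [IsCommMonObj X] (s : 𝟙_ C ⟶ X) :
    ((ρ_ X).inv ≫ X ◁ s ≫ μ) ▷ X ≫ μ = X ◁ ((ρ_ X).inv ≫ X ◁ s ≫ μ) ≫ μ := by
  have h : (λ_ X).inv ≫ s ▷ X ≫ μ = (ρ_ X).inv ≫ X ◁ s ≫ μ := by
    rw [← IsCommMonObj.mul_comm X, BraidedCategory.braiding_naturality_left_assoc]
    simp
  conv_rhs => rw [← h]
  simp

theorem mate_rightUnitor {X : Wires} [SelfDual X] :
    @Mate (X ⊗ 𝟙_ Wires) X instSelfDualTensorObj _ (ρ_ X).hom (ρ_ X).inv := by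
  have key : ∀ {C : Type} [Category C] [MonoidalCategory C] [SymmetricCategory C] {X : C}
      (c : X ⊗ X ⟶ 𝟙_ C), (ρ_ X).hom ▷ X ≫ c = (X ⊗ 𝟙_ C) ◁ (ρ_ X).inv ≫
        tensorμ X (𝟙_ C) X (𝟙_ C) ≫ (c ⊗ₘ (λ_ _).hom) ≫ (λ_ _).hom := by
    intro C _ _ _ X c
    simp only [tensorμ, braiding_tensorUnit_left, MonoidalCategory.tensorHom_def]
    monoidal
  exact key (cp (X := X))

theorem join_discard : join ≫ discard = cap := by
  have h := spider_zed.bend_one 1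
  rw [zed_one_one] at h
  exact (zed_comp 2 0).trans (h.symm.trans (by rw [id_whiskerRight, Category.id_comp]))

/-- The left side is the transpose of multiplication by `state a`. That multiplication is
self-adjoint for the cap, which equals `join ≫ discard`, because `join` is associative and
commutative. -/
theorem fork_effect (a : ℂ) :
    fork ≫ A ◁ effect a ≫ (ρ_ A).hom = (ρ_ A).inv ≫ A ◁ state a ≫ join := by
  have h₁ : Mate (fork ≫ (𝟙 A ⊗ₘ effect a) ≫ (ρ_ A).hom)
      (((ρ_ A).inv ≫ (𝟙 A ⊗ₘ state a)) ≫ join) :=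
    mate_join.symm.comp ((Mate.id.tensor (mate_state a).symm).comp mate_rightUnitor)
  have h₂ : Mate (((ρ_ A).inv ≫ (𝟙 A ⊗ₘ state a)) ≫ join)
      (((ρ_ A).inv ≫ (𝟙 A ⊗ₘ state a)) ≫ join) := by
    change _ ▷ A ≫ cap = A ◁ _ ≫ cap
    rw [← join_discard, id_tensorHom, Category.assoc]
    have h := mul_state_comm (state a)
    exact (Category.assoc _ _ _).symm.trans ((congrArg (· ≫ discard) h).trans (Category.assoc _ _ _))
  have h₃ := h₁.symm.unique h₂
  rw [id_tensorHom, id_tensorHom, Category.assoc] at h₃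
  exact h₃

theorem mate_neg : Mate neg neg := by
  have h₁ : Mate (fork ≫ (𝟙 A ⊗ₘ effect (-1)) ≫ (ρ_ A).hom)
      (((ρ_ A).inv ≫ (𝟙 A ⊗ₘ state (-1))) ≫ join) :=
    mate_join.symm.comp ((Mate.id.tensor (mate_state _).symm).comp mate_rightUnitor)
  rw [id_tensorHom, id_tensorHom, Category.assoc, ← fork_effect] at h₁
  have h := (mate_had.comp (h₁.comp mate_had)).withScalar (scal (1 / 2))
  have h₂ : neg = withScalar (scal (1 / 2))
      (had ≫ (fork ≫ A ◁ effect (-1) ≫ (ρ_ A).hom) ≫ had) := by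
    rw [neg_eq, greyFork_eq, one, whiskerLeft_withScalar, withScalar_comp, withScalar_comp,
      comp_withScalar]
    simp only [Category.assoc]
    rw [← id_tensorHom, ← id_tensorHom, tensorHom_comp_tensorHom_assoc, Category.comp_id,
      had_had_assoc, tensor_withScalar, withScalar_comp, comp_withScalar, comp_withScalar, half_two,
      MonoidalCategory.tensorHom_def' had, id_tensorHom]
    simp only [Category.assoc, rightUnitor_naturality]
  rw [h₂]
  rwa [Category.assoc had] at h

/-! ### The rules, for states -/

theorem cup_eq : unit ≫ fork = cup := by
  have key : ∀ f : A ⟶ A, cup ≫ f ▷ A = bendIn ((λ_ A).hom ≫ f) := fun f => by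
    simp [bendIn, ← unitors_inv_equal]
  have h := ((congrArg bendIn (Mor.id_comp _)).trans (spider_zed.bendIn 0 1)).symm.trans
    (key (zed 1 1)).symm
  rw [zed_one_one, id_whiskerRight, Category.comp_id] at h
  exact (zed_comp 0 2).trans h

/-- The marginal of a state. -/
def State.sum {X : Wires} (s : State (X ⊗ A)) : State X := ⟨s.hom ≫ X ◁ discard ≫ (ρ_ X).hom⟩

theorem sum_cup : cu (X := A ⊗ A) ≫ (A ⊗ A) ◁ (join ≫ discard) ≫ (ρ_ (A ⊗ A)).hom = cup := by
  have h₁ : cup ≫ A ◁ discard ≫ (ρ_ A).hom = unit := by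
    rw [← cup_eq, Category.assoc, fork_discard, Category.comp_id]
  rw [MonoidalCategory.whiskerLeft_comp, Category.assoc, ← Category.assoc cu,
    ← cup_whiskerRight mate_join, Category.assoc, ← whisker_exchange_assoc, rightUnitor_naturality,
    reassoc_of% h₁, cup_eq]

/-- Reads the loop in rule A as a sum over a shared bit of a product of two states. -/
theorem sum_cup_mul_cup (f g : A ⟶ A) : State.sum ((⟨cup ≫ f ▷ A⟩ : State (A ⊗ A)) *
    ⟨cup ≫ g ▷ A⟩) = ⟨cup ≫ (f ⊗ₘ g) ≫ join⟩ := by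
  refine State.ext ?_
  have h : (λ_ _).inv ≫ (cup ⊗ₘ cup) ≫ tensorμ A A A A = cu (X := A ⊗ A) := rfl
  have h₂ : tensorμ A A A A ≫ (f ⊗ₘ g) ▷ (A ⊗ A) = (f ▷ A ⊗ₘ g ▷ A) ≫ tensorμ A A A A := by
    simpa using (tensorμ_natural f (𝟙 A) g (𝟙 A)).symm
  change ((λ_ _).inv ≫ (cup ≫ f ▷ A ⊗ₘ cup ≫ g ▷ A) ≫ tensorμ A A A A ≫ (join ⊗ₘ join)) ≫
    A ◁ discard ≫ (ρ_ A).hom = cup ≫ (f ⊗ₘ g) ≫ join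
  rw [← tensorHom_comp_tensorHom_assoc, ← reassoc_of% h₂]
  conv_rhs => rw [← sum_cup, ← h]
  simp only [Category.assoc, MonoidalCategory.whiskerLeft_comp, MonoidalCategory.tensorHom_def' join]
  rw [← whisker_exchange_assoc, ← whisker_exchange_assoc, ← whisker_exchange_assoc,
    rightUnitor_naturality, rightUnitor_naturality_assoc]

theorem average (a b : ℂ) : State.sum ((⟨state₂ a⟩ : State (A ⊗ A)) * ⟨state₂ b ≫ A ◁ neg⟩) =
    ⟨withScalar (scal 2) (state ((a + b) / 2))⟩ := by
  have h : state₂ b ≫ A ◁ neg = cup ≫ (neg ≫ box b 1 1) ▷ A := by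
    have h' : cup ≫ A ◁ neg = cup ≫ neg ▷ A := (cup_whiskerRight mate_neg).symm
    rw [← cup_box, comp_whiskerRight]
    refine (Category.assoc _ _ _).trans ?_
    rw [← whisker_exchange, reassoc_of% h']
  rw [h, ← cup_box, sum_cup_mul_cup]
  refine State.ext ?_
  exact (Category.assoc _ _ _).symm.trans ((cls_rule (.average a b)).trans (cls_tensor_scalar _ 2))

theorem introduction (a : ℂ) : (λ_ _).inv ≫ (state a ⊗ₘ unit) =
    (λ_ _).inv ≫ (state₂ a ⊗ₘ (state₂ a ≫ A ◁ neg)) ≫ tensorμ A A A A ≫ (join ⊗ₘ join) := by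
  have h := cls_rule (.intro a)
  rw [tensorμ_A]
  have e : ∀ {n : ℕ} (f : Mor 0 n), Mor.comp (λ_ (𝟙_ Wires)).inv f = f := Mor.id_comp
  refine (e _).trans (h.trans ?_)
  exact (Mor.assoc (Mor.tensor (state₂ a) (state₂ a ≫ A ◁ neg))
    (Mor.mk (.wires (Equiv.swap (1 : Fin 4) 2))) (Mor.tensor join join)).trans (e _).symm

end ZH.Wires

/-! ### Powers as states: splitting, summation and the label zero -/

namespace ZH.Wires

open SelfDual

variable {X Y Z : Wires} [MonObj X] [IsCommMonObj X] [MonObj Y] [IsCommMonObj Y]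

theorem tensor_mul_mul {s t : 𝟙_ Wires ⟶ A ⊗ A} (p q : Poly X) :
    ((λ_ _).inv ≫ (s ⊗ₘ t) ≫ tensorμ A A A A ≫ (join ⊗ₘ join)) ≫ (p.hom ⊗ₘ q.hom) ≫ μ =
      (λ_ _).inv ≫ ((s ≫ (p.hom ⊗ₘ q.hom) ≫ μ) ⊗ₘ (t ≫ (p.hom ⊗ₘ q.hom) ≫ μ)) ≫ μ := by
  have h : ∀ p : Poly X, join ≫ p.hom = (p.hom ⊗ₘ p.hom) ≫ μ := fun p => IsMonHom.mul_hom p.hom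
  simp only [Category.assoc]
  rw [tensorHom_comp_tensorHom_assoc, h, h, ← tensorHom_comp_tensorHom_assoc,
    ← tensorμ_natural_assoc, MonObj.mul_mul_mul_comm]
  simp only [tensorHom_comp_tensorHom_assoc]

namespace Poly

theorem H_mul_eq (a : ℂ) (p q : Poly X) : H a (p * q) = ⟨state₂ a ≫ (p.hom ⊗ₘ q.hom) ≫ μ⟩ := by
  rw [H, mul_hom, conv, reassoc_of% state_conj]

theorem one_add_hom (p : Poly X) : (1 + p).hom = neg ≫ p.hom := by
  rw [add_comm, add_hom, one_hom, conv_const, neg_eq]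

/-- Rule I with `p` and `q` substituted for its two wires; the free output on its left side vanishes
because `q` preserves units. -/
theorem H_eq_mul (a : ℂ) (p q : Poly X) : H a p = H a (p * q) * H a (p * (1 + q)) := by
  rw [H_mul_eq, H_mul_eq, one_add_hom]
  refine State.ext ?_
  have h := tensor_mul_mul (s := state₂ a) (t := state₂ a ≫ A ◁ neg) p q
  rw [← introduction] at h
  have h₁ : unit ≫ q.hom = η := IsMonHom.one_hom q.hom
  have h₂ : p.hom ⊗ₘ neg ≫ q.hom = A ◁ neg ≫ (p.hom ⊗ₘ q.hom) := by
    rw [← id_tensorHom, tensorHom_comp_tensorHom, Category.id_comp]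
  rw [Category.assoc, tensorHom_comp_tensorHom_assoc, h₁, MonObj.mul_one_hom,
    ← unitors_equal, Iso.inv_hom_id_assoc, Category.assoc] at h
  rw [State.mul_hom, h₂]
  simp only [Category.assoc]
  exact h

theorem subst_H (f : X ⟶ Y) [IsMonHom f] (a : ℂ) (p : Poly X) :
    State.map f (H a p) = H a (subst f p) := State.ext (Category.assoc _ _ _)

theorem H_one_mul (a : ℂ) (s : State X) : H a 1 * s = ⟨withScalar (scal a) s.hom⟩ := by
  refine State.ext ?_
  have h : state a ≫ one ≫ η[X] = scal a ≫ η[X] := by rw [← state_one, Category.assoc]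
  rw [mul_comm]
  change conv _ s.hom (state a ≫ one ≫ η) = _
  rw [h, conv_const, withScalar]
  simp only [Category.assoc, MonoidalCategory.tensorHom_def', rightUnitor_naturality, unitors_inv_equal]

theorem inl_mul_var (p : Poly X) (q : A ⟶ A) [IsMonHom q] :
    ((subst (inl X A) p).hom ⊗ₘ q ≫ (var X).hom) ≫ μ = p.hom ⊗ₘ q :=
  tensor_inl_inr p.hom q

theorem H_inl_mul_var (a : ℂ) (p : Poly X) :
    H a (subst (inl X A) p * var X) = ⟨state₂ a ≫ p.hom ▷ A⟩ := by
  have h := inl_mul_var p (𝟙 A)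
  rw [Category.id_comp, tensorHom_id] at h
  rw [H_mul_eq, h]

instance : IsMonHom neg := by
  have h := (1 + (⟨𝟙 A, inferInstance⟩ : Poly A)).isMonHom
  rwa [one_add_hom, Category.comp_id] at h

theorem H_inl_mul_one_add_var (a : ℂ) (p : Poly X) :
    H a (subst (inl X A) p * (1 + var X)) = ⟨state₂ a ≫ A ◁ neg ≫ p.hom ▷ A⟩ := by
  have h := inl_mul_var p neg
  rw [H_mul_eq, one_add_hom, h, whisker_exchange, ← MonoidalCategory.tensorHom_def]

end Poly

theorem State.sum_map (f : X ⟶ Y) [IsMonHom f] (s : State (X ⊗ A)) :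
    (State.map (f ▷ A) s).sum = State.map f s.sum := by
  refine State.ext ?_
  simp only [State.sum, State.map_hom, Category.assoc]
  rw [← whisker_exchange_assoc, rightUnitor_naturality]

open ZH.Wires.Poly

/-- Rule A pushed forward along `p`. The two values of the summed bit contribute a^p and b^p, with
a^p + b^p = 2((a+b)/2)^p. -/
theorem sum_average (a b : ℂ) (p : Poly X) :
    (H a (subst (inl X A) p * var X) * H b (subst (inl X A) p * (1 + var X))).sum =
      H 2 1 * H ((a + b) / 2) p := by
  have h := congrArg (State.map p.hom) (average a b)
  rw [← State.sum_map, map_mul] at h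
  rw [H_inl_mul_var, H_inl_mul_one_add_var, H_one_mul]
  refine Eq.trans ?_ (h.trans (State.ext (withScalar_comp _ _ _)))
  congr 2
  exact State.ext (Category.assoc _ _ _).symm

theorem sum_H (a : ℂ) (p : Poly X) :
    (H a (subst (inl X A) p * var X)).sum = H 2 1 * H ((a + 1) / 2) p := by
  rw [← sum_average, H_one, mul_one]

theorem sum_one : (1 : State (X ⊗ A)).sum = H 2 1 := by
  have h := sum_H 1 (1 : Poly X)
  rwa [H_one, add_self_div_two, H_one, mul_one] at h

theorem H_two_mul_half (p : Poly X) : H 2 p * H (1 / 2) p = 1 := by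
  rw [H_mul]; norm_num [H_one]

theorem H_two_cancel {s t : State X} (p : Poly X) (h : H 2 p * s = H 2 p * t) : s = t := by
  rw [← one_mul s, ← one_mul t, ← H_two_mul_half p, mul_comm (H 2 p), mul_assoc, mul_assoc, h]

/-- The sum of the constant 1 over a bit is computed in two ways, writing 1 as (-1)^{0·y}; the
average of -1 and 1 is 0. -/
theorem H_zero_zero : H 0 (0 : Poly X) = 1 := by
  have h := sum_H (-1) (0 : Poly X)
  rw [subst_zero, zero_mul, neg_add_cancel, zero_div] at h
  have h₂ : H (-1) (0 : Poly (X ⊗ A)) = 1 := by simpa using H_zero_mul (0 : Poly (X ⊗ A))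
  rw [h₂, sum_one] at h
  exact (H_two_cancel 1 ((mul_one _).trans h)).symm

/-- Summing (-1)^{xy} over y gives 2·0^x by rule A, while as a diagram it is `unit ≫ had`, which is
twice `greyUnit`. -/
theorem state_zero : state 0 = greyUnit := by
  have h := congrArg State.hom (sum_H (-1) (⟨𝟙 A, inferInstance⟩ : Poly A))
  rw [H_inl_mul_var, neg_add_cancel, zero_div, H_one_mul] at h
  have h₁ : cup ≫ A ◁ discard ≫ (ρ_ A).hom = unit := by
    rw [← cup_eq, Category.assoc, fork_discard, Category.comp_id]
  simp only [State.sum, id_whiskerRight, Category.comp_id, H] at h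
  rw [← cup_had_whiskerRight, Category.assoc, ← whisker_exchange_assoc, rightUnitor_naturality,
    reassoc_of% h₁, unit_had] at h
  have h₂ := congrArg (withScalar (scal (1 / 2))) h
  rw [half_two, half_two] at h₂
  exact h₂.symm

theorem copyState_whiskerRight {C : Type*} [Category* C] [MonoidalCategory C] {X : C}
    (u : 𝟙_ C ⟶ X) (c : X ⊗ X ⟶ 𝟙_ C) : (λ_ X).inv ≫ ((λ_ _).inv ≫ (u ⊗ₘ u)) ▷ X ≫
      (α_ X X X).hom ≫ X ◁ c ≫ (ρ_ X).hom = (λ_ X).inv ≫ (u ▷ X ≫ c) ≫ u := by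
  calc _ = 𝟙 _ ⊗≫ (u ▷ (𝟙_ C ⊗ X) ≫ X ◁ (u ▷ X ≫ c)) ⊗≫ 𝟙 _ := by
        rw [MonoidalCategory.tensorHom_def]; monoidal
    _ = _ := by rw [← whisker_exchange]; monoidal

/-- `greyUnit` is the indicator of 0: since `fork` copies it, multiplying by it retains only the
value at 0. -/
theorem greyUnit_join : (λ_ A).inv ≫ greyUnit ▷ A ≫ join = greyDiscard ≫ greyUnit := by
  have h : join = bendOut fork := (spider_zed.bendOut 1 1).symm
  have h₁ : greyUnit ▷ A ≫ cap = (λ_ A).hom ≫ greyDiscard := by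
    have h₂ : greyUnit ▷ A ≫ cap = 𝟙_ Wires ◁ greyDiscard ≫ (λ_ _).hom := mate_greyUnit
    rw [h₂, leftUnitor_naturality]
  rw [h, whiskerRight_bendOut, greyUnit_fork, bendOut, copyState_whiskerRight, h₁,
    Category.assoc, Iso.inv_hom_id_assoc]

/-- The hypothesis says that `p` sends `greyUnit` to the unit, so composing `greyUnit_join` with `p`
leaves `p` on one side and the zero polynomial on the other. -/
theorem eq_zero_of_H_zero {p : Poly X} (h : H 0 p = 1) : p = 0 := by
  have h₁ : greyUnit ≫ p.hom = η := by rw [← state_zero]; exact congrArg State.hom h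
  have h₂ := congrArg (· ≫ p.hom) greyUnit_join
  have h₃ : join ≫ p.hom = (p.hom ⊗ₘ p.hom) ≫ μ := IsMonHom.mul_hom p.hom
  simp only [Category.assoc, h₃] at h₂
  rw [h₁, ← tensorHom_id, tensorHom_comp_tensorHom_assoc, h₁, Category.id_comp, MonObj.one_mul_hom,
    Iso.inv_hom_id_assoc] at h₂
  exact Poly.ext h₂

end ZH.Wires

/-! ### The ortho rule and idempotence -/

namespace ZH.Wires

open SelfDual

variable {X Y Z : Wires} [MonObj X] [IsCommMonObj X] [MonObj Y] [IsCommMonObj Y]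

theorem cls_orthoTop : cls Diagram.orthoTop = tensorμ A A A A ≫
    (𝟙 (A ⊗ A) ⊗ₘ (neg ⊗ₘ 𝟙 A)) ≫ (boxJoin ⊗ₘ boxJoin) := by
  have h : cls (Diagram.idn 2 ⊠ Diagram.neg ⊠ Diagram.wire) = (𝟙 (A ⊗ A) ⊗ₘ (neg ⊗ₘ 𝟙 A)) :=
    (Mor.comp_id _).symm.trans ((Mor.tensor_assoc (Mor.wires (Equiv.refl (Fin 2))) neg
      (Mor.wires (Equiv.refl (Fin 1)))).trans (Mor.id_comp (Mor.tensor _ (Mor.tensor neg _))))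
  change Mor.comp (Mor.comp (cls (.wires (Equiv.swap (1 : Fin 4) 2))) (cls (Diagram.idn 2 ⊠ Diagram.neg ⊠ Diagram.wire)))
    (Mor.tensor (m := 2) (n := 1) (m' := 2) (n' := 1) boxJoin boxJoin) = _
  rw [h, tensorμ_A]
  exact Mor.assoc _ _ _

theorem ortho_rule : withScalar (scal 2) ((fork ⊗ₘ (unit ≫ fork)) ≫ tensorμ A A A A ≫
      (𝟙 (A ⊗ A) ⊗ₘ (neg ⊗ₘ 𝟙 A)) ≫ (boxJoin ⊗ₘ boxJoin)) =
    (fork ⊗ₘ ((λ_ _).inv ≫ (unit ⊗ₘ unit))) ≫ tensorμ A A A A ≫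
      (𝟙 (A ⊗ A) ⊗ₘ (neg ⊗ₘ 𝟙 A)) ≫ (boxJoin ⊗ₘ boxJoin) := by
  have h := cls_rule .ortho
  rw [cls_tensor_scalar, cls_comp, cls_comp, cls_orthoTop] at h
  have h₁ : unit ≫ fork = cls (.Z 0 2) := zed_comp 0 2
  have h₂ : (λ_ _).inv ≫ (unit ⊗ₘ unit) = cls (.Z 0 1 ⊠ .Z 0 1) := Mor.id_comp _
  rw [h₁, h₂]
  exact h

theorem ortho_mate : withScalar (scal 2) ((boxFork ⊗ₘ boxFork) ≫ (𝟙 (A ⊗ A) ⊗ₘ (neg ⊗ₘ 𝟙 A)) ≫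
      tensorμ A A A A ≫ (join ⊗ₘ (join ≫ discard))) =
    (boxFork ⊗ₘ boxFork) ≫ (𝟙 (A ⊗ A) ⊗ₘ (neg ⊗ₘ 𝟙 A)) ≫
      tensorμ A A A A ≫ (join ⊗ₘ ((discard ⊗ₘ discard) ≫ (λ_ _).hom)) := by
  have h₁ : Mate (tensorμ A A A A ≫ (𝟙 (A ⊗ A) ⊗ₘ (neg ⊗ₘ 𝟙 A)) ≫ (boxJoin ⊗ₘ boxJoin)) _ :=
    mate_tensorμ.comp ((Mate.id.tensor (mate_neg.tensor Mate.id)).comp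
      (mate_boxJoin.tensor mate_boxJoin))
  have h₂ := ((mate_join.symm.tensor (mate_unit.comp mate_join.symm)).comp h₁).withScalar (scal 2)
  have h₃ := (mate_join.symm.tensor
    (mate_leftUnitor.symm.comp (mate_unit.tensor mate_unit))).comp h₁
  rw [ortho_rule] at h₂
  simpa only [Category.assoc] using h₂.unique h₃

/-- Summation over the second wire. -/
def marginal (X : Wires) : X ⊗ A ⟶ X := X ◁ discard ≫ (ρ_ X).hom

theorem tensorμ_join_discard_discard :
    tensorμ A A A A ≫ (join ⊗ₘ ((discard ⊗ₘ discard) ≫ (λ_ _).hom)) ≫ (ρ_ A).hom =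
      (marginal A ⊗ₘ marginal A) ≫ join := by
  have h₁ : (join ⊗ₘ ((discard ⊗ₘ discard) ≫ (λ_ (𝟙_ Wires)).hom)) ≫ (ρ_ A).hom =
      ((𝟙 A ⊗ₘ 𝟙 A) ⊗ₘ (discard ⊗ₘ discard)) ≫ (A ⊗ A) ◁ (λ_ _).hom ≫ (ρ_ _).hom ≫ join := by
    rw [← rightUnitor_naturality, ← tensorHom_id, ← id_tensorHom, tensorHom_comp_tensorHom_assoc,
      tensorHom_comp_tensorHom_assoc]
    simp
  rw [h₁, ← tensorμ_natural_assoc, marginal, ← tensorHom_comp_tensorHom, rightUnitor_monoidal]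
  simp

/-- In terms of functions, 2 ∑ₖ f(xk) g((1+x)k) = (∑ₖ f(xk)) (∑ₖ g((1+x)k)). Hadamard boxes and the
scalar ½ twice turn each `boxFork` of the transposed rule O into `conj`. -/
theorem ortho_one : withScalar (scal 2) ((conj ⊗ₘ (conj ≫ neg ▷ A)) ≫ μ ≫ marginal A) =
    ((conj ≫ marginal A) ⊗ₘ (conj ≫ neg ▷ A ≫ marginal A)) ≫ join := by
  have h₁ : ∀ {Y : Wires} (t : (A ⊗ A) ⊗ (A ⊗ A) ⟶ Y), withScalar (scal (1 / 2))
      (withScalar (scal (1 / 2)) ((had ⊗ₘ had) ≫ (boxFork ⊗ₘ boxFork) ≫ t)) = (conj ⊗ₘ conj) ≫ t := by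
    intro Y t
    rw [conj, withScalar_tensor, tensor_withScalar, withScalar_comp, withScalar_comp,
      tensorHom_comp_tensorHom_assoc]
  have h₂ : conj ⊗ₘ (conj ≫ neg ▷ A) = (conj ⊗ₘ conj) ≫ (𝟙 (A ⊗ A) ⊗ₘ (neg ⊗ₘ 𝟙 A)) := by
    rw [tensorHom_comp_tensorHom, Category.comp_id, tensorHom_id]
  have h₃ : (conj ≫ marginal A) ⊗ₘ (conj ≫ neg ▷ A ≫ marginal A) =
      (conj ⊗ₘ conj) ≫ (𝟙 (A ⊗ A) ⊗ₘ (neg ⊗ₘ 𝟙 A)) ≫ (marginal A ⊗ₘ marginal A) := by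
    rw [tensorHom_comp_tensorHom, tensorHom_comp_tensorHom, tensorHom_id, Category.id_comp]
  have h₄ : μ ≫ marginal A = tensorμ A A A A ≫ (join ⊗ₘ (join ≫ discard)) ≫ (ρ_ A).hom := by
    change (tensorμ A A A A ≫ (join ⊗ₘ join)) ≫ A ◁ discard ≫ (ρ_ A).hom = _
    rw [Category.assoc, ← id_tensorHom, tensorHom_comp_tensorHom_assoc, Category.comp_id]
  have h := congrArg (fun t => withScalar (scal (1 / 2)) (withScalar (scal (1 / 2))
    ((had ⊗ₘ had) ≫ t ≫ (ρ_ A).hom))) ortho_mate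
  simp only [withScalar_comp, comp_withScalar, Category.assoc, h₁, tensorμ_join_discard_discard,
    withScalar_comm _ (scal 2)] at h
  rw [h₂, h₃, h₄]
  simpa only [Category.assoc] using h

/-- Substitution of a polynomial for the last variable. -/
def substLast (q : Poly (X ⊗ A)) : X ⊗ A ⟶ X ⊗ A := lift (inl X A) q.hom

instance (q : Poly (X ⊗ A)) : IsMonHom (substLast q) := isMonHom_lift _ _

namespace Poly

theorem subst_substLast_inl (q : Poly (X ⊗ A)) (p : Poly X) :
    subst (substLast q) (subst (inl X A) p) = subst (inl X A) p :=
  Poly.ext (by simp only [subst, substLast, Category.assoc, inl_lift])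

theorem subst_substLast_var (q : Poly (X ⊗ A)) : subst (substLast q) (var X) = q :=
  Poly.ext (inr_lift _ _)

end Poly

open ZH.Wires.Poly

/-- Where `p` holds the second factor does not depend on the summed variable, and where `p` fails
the first does not. Formally this is `ortho_one` followed by `p`. -/
theorem sum_ortho (p : Poly X) (s t : State (X ⊗ A)) :
    H 2 1 * (State.map (substLast (subst (inl X A) p * var X)) s *
      State.map (substLast (subst (inl X A) (1 + p) * var X)) t).sum =
    (State.map (substLast (subst (inl X A) p * var X)) s).sum *
      (State.map (substLast (subst (inl X A) (1 + p) * var X)) t).sum := by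
  have hφ : ∀ p : Poly X, (subst (inl X A) p * var X).hom = conj ≫ p.hom ▷ A := fun p => by
    have h := inl_mul_var p (𝟙 A)
    rw [Category.id_comp, tensorHom_id] at h
    rw [mul_hom, conv, h]
  have hS : p.hom ▷ A ≫ marginal X = marginal A ≫ p.hom := by
    rw [marginal, marginal, ← whisker_exchange_assoc, rightUnitor_naturality, Category.assoc]
  have hj : join ≫ p.hom = (p.hom ⊗ₘ p.hom) ≫ μ := IsMonHom.mul_hom p.hom
  have hO : withScalar (scal 2) (lift (conj ≫ p.hom ▷ A) (conj ≫ (neg ≫ p.hom) ▷ A) ≫ marginal X) =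
      lift ((conj ≫ p.hom ▷ A) ≫ marginal X) ((conj ≫ (neg ≫ p.hom) ▷ A) ≫ marginal X) := by
    have h := congrArg (· ≫ p.hom) ortho_one
    have hm : μ ≫ p.hom ▷ A = (p.hom ▷ A ⊗ₘ p.hom ▷ A) ≫ μ := IsMonHom.mul_hom (p.hom ▷ A)
    simp only [withScalar_comp, Category.assoc, hj, ← hS, reassoc_of% hm,
      tensorHom_comp_tensorHom_assoc] at h
    simpa only [lift, Category.assoc, comp_whiskerRight] using h
  -- The projection formula takes the variables of `X` out of the sum; what remains under it is the
  -- Boolean part, to which `hO` applies.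
  have key : ∀ (s t : State (X ⊗ A)) (φ ψ : A ⟶ X ⊗ A),
      ((λ_ _).inv ≫ (s.hom ≫ lift (inl X A) φ ⊗ₘ t.hom ≫ lift (inl X A) ψ) ≫ μ) ≫ marginal X =
        (λ_ _).inv ≫ (s.hom ⊗ₘ t.hom) ≫ tensorμ X A X A ≫ lift μ (lift φ ψ ≫ marginal X) := by
    intro s t φ ψ
    have h : lift (inl X A) (inl X A) = μ ≫ inl X A := (IsMonHom.mul_hom (inl X A)).symm
    rw [← tensorHom_comp_tensorHom]
    simp only [Category.assoc]
    rw [reassoc_of% lift_tensor_lift_mul, h]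
    simp only [lift, Category.assoc, marginal, inl_tensor_mul_whiskerLeft]
  have key₂ : ∀ (s : State (X ⊗ A)) (φ : A ⟶ X ⊗ A),
      (s.hom ≫ lift (inl X A) φ) ≫ marginal X = s.hom ≫ lift (𝟙 X) (φ ≫ marginal X) := by
    intro s φ
    simp only [lift, Category.assoc, marginal, ← inl_tensor_mul_whiskerLeft, Category.id_comp]
  rw [H_one_mul]
  refine State.ext ?_
  simp only [State.sum, State.map_hom, State.mul_hom, substLast, hφ, one_add_hom]
  have e := key s t (conj ≫ p.hom ▷ A) (conj ≫ (neg ≫ p.hom) ▷ A)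
  have e₁ := key₂ s (conj ≫ p.hom ▷ A)
  have e₂ := key₂ t (conj ≫ (neg ≫ p.hom) ▷ A)
  have hL : lift (𝟙 X) (𝟙 X) = μ := by simp [lift]
  rw [← marginal, e, e₁, e₂, ← tensorHom_comp_tensorHom_assoc, lift_tensor_lift_mul, hL, ← hO]
  simp only [lift, tensor_withScalar, withScalar_comp, comp_withScalar]

/-! ### Polynomials form a Boolean ring -/

namespace Poly

/-- With q = p(1+p), the factors (-1)^{(1+p)y} and (-1)^{py} both become (-1)^{qy} in `sum_ortho`.
Their product is 1, with sum 2, and each separate sum is 2·0^q. Cancelling the 2s leaves 0^q · 0^q =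
0^q = 1, whence q = 0. -/
theorem mul_one_add_self (p : Poly X) : p * (1 + p) = 0 := by
  refine eq_zero_of_H_zero ?_
  have h := sum_ortho p (H (-1) (subst (inl X A) (1 + p) * var X)) (H (-1) (subst (inl X A) p * var X))
  have h₁ : ∀ q r : Poly X, State.map (substLast (subst (inl X A) q * var X))
      (H (-1) (subst (inl X A) r * var X)) = H (-1) (subst (inl X A) (q * r) * var X) := fun q r => by
    rw [subst_H, subst_mul, subst_substLast_inl, subst_substLast_var, subst_mul, ← mul_assoc,
      mul_comm (subst _ r)]
  rw [h₁, h₁, mul_comm (1 + p) p, H_neg_one_mul_self, sum_one, sum_H, neg_add_cancel, zero_div,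
    mul_assoc] at h
  have h₂ := H_two_cancel 1 h
  rw [mul_left_comm (H 0 _)] at h₂
  have h₃ := H_two_cancel 1 ((mul_one _).trans h₂)
  rw [H_mul, mul_zero] at h₃
  exact h₃.symm

theorem mul_self (p : Poly X) : p * p = p := by
  have h := mul_one_add_self p
  rw [mul_add, mul_one] at h
  calc p * p = p + p + p * p := by rw [add_self, zero_add]
    _ = p := by rw [add_assoc, h, add_zero]

end Poly

end ZH.Wires

/-! ### Minterms and normal forms -/

namespace ZH.Wires

variable {X Y : Wires} [MonObj X] [IsCommMonObj X] [MonObj Y] [IsCommMonObj Y]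

namespace Poly

/-- Substitution of variables, as a homomorphism of rings. -/
noncomputable def substHom (f : X ⟶ Y) [IsMonHom f] : Poly X →+* Poly Y where
  toFun := subst f
  map_one' := subst_one f
  map_mul' := subst_mul f
  map_zero' := subst_zero f
  map_add' := subst_add f

/-- Rule I with both polynomials zero makes the state idempotent, and for nonzero `a` it is
invertible. -/
theorem H_zero (a : ℂ) : H a (0 : Poly X) = 1 := by
  by_cases ha : a = 0
  · rw [ha, H_zero_zero]
  · have h := H_eq_mul a (0 : Poly X) 0
    rw [zero_mul, zero_mul] at h
    have h₂ : H a⁻¹ (0 : Poly X) * H a 0 = 1 := by rw [H_mul, inv_mul_cancel₀ ha, H_one]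
    calc H a (0 : Poly X) = H a⁻¹ (0 : Poly X) * H a 0 * H a 0 := by rw [h₂, one_mul]
      _ = 1 := by rw [mul_assoc, ← h, h₂]

/-- Split the exponent along `p`: (p+q)p = p and (p+q)(1+p) = q. -/
theorem H_add_of_mul_eq_zero (a : ℂ) {p q : Poly X} (h : p * q = 0) :
    H a (p + q) = H a p * H a q := by
  rw [H_eq_mul a (p + q) p]
  congr 2
  · rw [add_mul, mul_self, mul_comm q, h, add_zero]
  · calc (p + q) * (1 + p) = p * (1 + p) + p * q + q := by ring
      _ = q := by rw [mul_one_add_self, h, zero_add, zero_add]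

/-- A variable or its negation. -/
noncomputable def lit (k : Fin 2) (p : Poly X) : Poly X := if k = 1 then p else 1 + p

theorem lit_zero (p : Poly X) : lit 0 p = 1 + p := if_neg (by decide)
theorem lit_one (p : Poly X) : lit 1 p = p := if_pos rfl

theorem lit_mul_lit (k l : Fin 2) (p : Poly X) :
    lit k p * lit l p = if l = k then lit l p else 0 := by
  have h : (1 + p) * p = 0 := by rw [mul_comm, mul_one_add_self]
  fin_cases k <;> fin_cases l <;> simp [lit_zero, lit_one, mul_self, mul_one_add_self, h]

theorem subst_lit (f : X ⟶ Y) [IsMonHom f] (k : Fin 2) (p : Poly X) :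
    subst f (lit k p) = lit k (subst f p) := by
  fin_cases k <;> simp [lit_zero, lit_one, subst_add, subst_one]

section Minterm

variable {I J : Type*} [Fintype I] [Fintype J] [DecidableEq I] [DecidableEq J]

/-- A conjunction of variables and negations of variables. -/
noncomputable def minterm (v : I → Poly X) (b : I → Fin 2) : Poly X := ∏ i, lit (b i) (v i)

theorem sum_minterm (v : I → Poly X) : ∑ b, minterm v b = 1 := by
  have h := Finset.prod_univ_sum (fun _ : I => (Finset.univ : Finset (Fin 2)))
    (fun i k => lit k (v i))
  rw [Fintype.piFinset_univ] at h
  simp only [minterm]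
  rw [← h]
  refine Finset.prod_eq_one fun i _ => ?_
  rw [Fin.sum_univ_two, lit_zero, lit_one, add_assoc, add_self, add_zero]

theorem lit_mul_minterm (v : I → Poly X) (b : I → Fin 2) (i : I) (k : Fin 2) :
    lit k (v i) * minterm v b = if b i = k then minterm v b else 0 := by
  rw [minterm, ← Finset.mul_prod_erase _ _ (Finset.mem_univ i), ← mul_assoc, lit_mul_lit]
  split_ifs <;> simp

theorem lit_mul_of_mul {p q : Poly X} {l : Fin 2} (h : p * q = if l = 1 then q else 0) (k : Fin 2) :
    lit k p * q = if l = k then q else 0 := by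
  fin_cases k <;> fin_cases l <;> simp_all [lit_zero, lit_one, add_mul, add_self]

/-- The hypothesis `h` means that `v i`, as a function of the variables `w`, has the value `F c i`
at the string `c`. -/
theorem prod_lit_mul_minterm {v : I → Poly X} {w : J → Poly X} {F : (J → Fin 2) → I → Fin 2}
    (h : ∀ c i, v i * minterm w c = if F c i = 1 then minterm w c else 0) (b : I → Fin 2)
    (c : J → Fin 2) (s : Finset I) : (∏ i ∈ s, lit (b i) (v i)) * minterm w c =
      if ∀ i ∈ s, F c i = b i then minterm w c else 0 := by
  induction s using Finset.induction_on with
  | empty => simp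
  | insert i s hi ih =>
    rw [Finset.prod_insert hi, mul_assoc, ih, mul_ite, mul_zero, lit_mul_of_mul (h c i)]
    simp only [Finset.mem_insert, forall_eq_or_imp]
    split_ifs <;> simp_all

theorem var_mul_minterm (w : J → Poly X) (c : J → Fin 2) (i : J) :
    w i * minterm w c = if c i = 1 then minterm w c else 0 := by
  simpa only [lit_one] using lit_mul_minterm w c i 1

theorem minterm_mul_minterm (v : I → Poly X) (b c : I → Fin 2) :
    minterm v b * minterm v c = if b = c then minterm v b else 0 := by
  have h := prod_lit_mul_minterm (F := id) (var_mul_minterm v) b c Finset.univ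
  simp only [id, Finset.mem_univ, true_imp_iff] at h
  refine (show _ = _ from h).trans ?_
  split_ifs with h₁ h₂ h₂
  · rw [h₂]
  · exact absurd (funext fun i => (h₁ i).symm) h₂
  · exact absurd (fun i => congrFun h₂.symm i) h₁
  · rfl

theorem H_sum_minterm (a : ℂ) (v : I → Poly X) (s : Finset (I → Fin 2)) :
    H a (∑ b ∈ s, minterm v b) = ∏ b ∈ s, H a (minterm v b) := by
  induction s using Finset.induction_on with
  | empty => simp [H_zero]
  | insert b s hb ih =>
    rw [Finset.sum_insert hb, Finset.prod_insert hb, H_add_of_mul_eq_zero, ih]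
    rw [Finset.mul_sum]
    refine Finset.sum_eq_zero fun c hc => ?_
    rw [minterm_mul_minterm, if_neg]
    rintro rfl
    exact hb hc

theorem minterm_eq_sum {v : I → Poly X} {w : J → Poly X} {F : (J → Fin 2) → I → Fin 2}
    (h : ∀ c i, v i * minterm w c = if F c i = 1 then minterm w c else 0) (b : I → Fin 2) :
    minterm v b = ∑ c with F c = b, minterm w c := by
  rw [← mul_one (minterm _ b), ← sum_minterm w, Finset.mul_sum, Finset.sum_filter]
  refine Finset.sum_congr rfl fun c _ => ?_
  have h := prod_lit_mul_minterm h b c Finset.univ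
  simp only [Finset.mem_univ, true_imp_iff] at h
  simp only [funext_iff]
  exact h

/-- The normal form of a state. -/
noncomputable def normalForm (v : I → Poly X) (f : (I → Fin 2) → ℂ) : State X :=
  ∏ b, H (f b) (minterm v b)

theorem normalForm_mul (v : I → Poly X) (f g : (I → Fin 2) → ℂ) :
    normalForm v f * normalForm v g = normalForm v (f * g) := by
  simp only [normalForm, ← Finset.prod_mul_distrib, H_mul, Pi.mul_apply]

/-- Change of variables along `F`: a minterm of `v` is the orthogonal sum of the minterms of `w` in
its fibre, and `H` turns orthogonal sums into products. -/
theorem normalForm_eq {v : I → Poly X} {w : J → Poly X} (F : (J → Fin 2) → I → Fin 2)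
    (h : ∀ c i, v i * minterm w c = if F c i = 1 then minterm w c else 0)
    (f : (I → Fin 2) → ℂ) : normalForm v f = normalForm w (f ∘ F) := by
  simp only [normalForm, minterm_eq_sum h, H_sum_minterm]
  rw [← Finset.prod_fiberwise Finset.univ F]
  refine Finset.prod_congr rfl fun b _ => Finset.prod_congr rfl fun c hc => ?_
  rw [Function.comp_apply, (Finset.mem_filter.1 hc).2]

theorem normalForm_comp (w : J → Poly X) (e : I → J) (f : (I → Fin 2) → ℂ) :
    normalForm (w ∘ e) f = normalForm w fun c => f (c ∘ e) :=
  normalForm_eq _ (fun c i => var_mul_minterm w c (e i)) f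

theorem subst_minterm (f : X ⟶ Y) [IsMonHom f] (v : I → Poly X) (b : I → Fin 2) :
    subst f (minterm v b) = minterm (fun i => subst f (v i)) b := by
  have h := map_prod (substHom f) (fun i => lit (b i) (v i)) Finset.univ
  simp only [substHom, RingHom.coe_mk, MonoidHom.coe_mk, OneHom.coe_mk, subst_lit] at h
  exact h

theorem map_normalForm (f : X ⟶ Y) [IsMonHom f] (v : I → Poly X) (g : (I → Fin 2) → ℂ) :
    State.map f (normalForm v g) = normalForm (fun i => subst f (v i)) g := by
  simp only [normalForm, map_prod, subst_H, subst_minterm]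

theorem H_prod (a : ℂ) (v : I → Poly X) :
    H a (∏ i, v i) = normalForm v fun b => if b = 1 then a else 1 := by
  rw [normalForm, Finset.prod_eq_single (1 : I → Fin 2)]
  · simp [minterm, lit_one]
  · intro b _ hb
    rw [if_neg hb, H_one]
  · simp

end Minterm

/-- The variables, together with a new one. -/
noncomputable def snocVar {n : ℕ} (v : Fin n → Poly X) : Fin (n + 1) → Poly (X ⊗ A) :=
  Fin.snoc (α := fun _ => Poly (X ⊗ A)) (fun i => subst (inl X A) (v i)) (var X)

theorem snocVar_last {n : ℕ} (v : Fin n → Poly X) : snocVar v (Fin.last n) = var X := by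
  simp [snocVar]

theorem snocVar_castSucc {n : ℕ} (v : Fin n → Poly X) (i : Fin n) :
    snocVar v i.castSucc = subst (inl X A) (v i) := by
  simp [snocVar]

theorem minterm_snocVar {n : ℕ} (v : Fin n → Poly X) (b : Fin n → Fin 2) (k : Fin 2) :
    minterm (snocVar v) (Fin.snoc b k : Fin (n + 1) → Fin 2) =
      subst (inl X A) (minterm v b) * lit k (var X) := by
  rw [subst_minterm]
  simp [minterm, Fin.prod_univ_castSucc, snocVar]

/-- By induction on `s`: the factors treated so far live below the sum `p` of their minterms and the
new one below 1 + p. So `sum_ortho` separates them, and `sum_average` evaluates the new factor. -/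
theorem sum_prod_minterm {I : Type*} [Fintype I] [DecidableEq I] (v : I → Poly X)
    (f g : (I → Fin 2) → ℂ) (s : Finset (I → Fin 2)) :
    (∏ b ∈ s, (H (f b) (subst (inl X A) (minterm v b) * var X) *
      H (g b) (subst (inl X A) (minterm v b) * (1 + var X)))).sum =
    H 2 1 * ∏ b ∈ s, H ((f b + g b) / 2) (minterm v b) := by
  induction s using Finset.induction_on with
  | empty => rw [Finset.prod_empty, Finset.prod_empty, sum_one, mul_one]
  | insert b s hb ih =>
    set p := ∑ c ∈ s, minterm v c
    -- A factor whose minterm lies below `q` is unchanged when the summed variable y is replaced by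
    -- qy, so it already has the shape required by `sum_ortho`.
    have key : ∀ (q : Poly X) (c : I → Fin 2), minterm v c * q = minterm v c →
        State.map (substLast (subst (inl X A) q * var X))
          (H (f c) (subst (inl X A) (minterm v c) * var X) *
            H (g c) (subst (inl X A) (minterm v c) * (1 + var X))) =
          H (f c) (subst (inl X A) (minterm v c) * var X) *
            H (g c) (subst (inl X A) (minterm v c) * (1 + var X)) := by
      intro q c hq
      have h : subst (inl X A) (minterm v c) * (subst (inl X A) q * var X) =
          subst (inl X A) (minterm v c) * var X := by
        rw [← mul_assoc, ← subst_mul, hq]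
      rw [map_mul, subst_H, subst_H, subst_mul, subst_mul, subst_add, subst_one,
        subst_substLast_inl, subst_substLast_var, mul_add, mul_add, h]
    have hp : ∀ c ∈ s, minterm v c * p = minterm v c := by
      intro c hc
      rw [Finset.mul_sum]
      simp [minterm_mul_minterm, hc]
    have hp' : minterm v b * (1 + p) = minterm v b := by
      rw [mul_add, mul_one, Finset.mul_sum]
      simp [minterm_mul_minterm, hb]
    have h := sum_ortho p (∏ c ∈ s, (H (f c) (subst (inl X A) (minterm v c) * var X) *
      H (g c) (subst (inl X A) (minterm v c) * (1 + var X))))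
      (H (f b) (subst (inl X A) (minterm v b) * var X) *
      H (g b) (subst (inl X A) (minterm v b) * (1 + var X)))
    rw [map_prod, Finset.prod_congr rfl fun c hc => key p c (hp c hc), key _ b hp', ih,
      sum_average, mul_assoc (H 2 1)] at h
    have h₂ := H_two_cancel 1 h
    rw [Finset.prod_insert hb, Finset.prod_insert hb, mul_comm, h₂]
    exact ((mul_left_comm _ _ _).trans (congrArg _ (mul_comm _ _)))

theorem sum_normalForm {n : ℕ} (v : Fin n → Poly X) (f : (Fin (n + 1) → Fin 2) → ℂ) :
    (normalForm (snocVar v) f).sum =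
      normalForm v fun b => f (Fin.snoc b 0) + f (Fin.snoc b 1) := by
  have h : normalForm (snocVar v) f =
      ∏ b : Fin n → Fin 2, (H (f (Fin.snoc b 1)) (subst (inl X A) (minterm v b) * var X) *
        H (f (Fin.snoc b 0)) (subst (inl X A) (minterm v b) * (1 + var X))) := by
    have e := Fintype.prod_equiv (Fin.snocEquiv fun _ : Fin (n + 1) => Fin 2)
      (fun x => H (f (Fin.snoc x.2 x.1)) (minterm (snocVar v) (Fin.snoc x.2 x.1)))
      (fun b => H (f b) (minterm (snocVar v) b)) (fun _ => rfl)
    rw [normalForm, ← e, Fintype.prod_prod_type_right]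
    refine Finset.prod_congr rfl fun b _ => ?_
    rw [Fin.prod_univ_two, minterm_snocVar, minterm_snocVar, lit_zero, lit_one, mul_comm]
  -- The single factor 2 is spread over the minterms, whose sum is 1; it turns each average into a
  -- sum.
  rw [h, sum_prod_minterm, ← sum_minterm v, H_sum_minterm, ← Finset.prod_mul_distrib, normalForm]
  refine Finset.prod_congr rfl fun b _ => ?_
  rw [H_mul]
  congr 1
  ring

end Poly

end ZH.Wires

/-! ### Diagrammatic operations on normal forms -/

namespace ZH.Wires

open ZH.Wires.Poly

section Lift

variable {X Y : Wires} [MonObj X] [IsCommMonObj X] [MonObj Y] [IsCommMonObj Y]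

theorem map_lift_normalForm {n : ℕ} (φ : X ⟶ Y) [IsMonHom φ] (q : Poly Y) (v : Fin n → Poly X)
    (f : (Fin (n + 1) → Fin 2) → ℂ) :
    haveI := isMonHom_lift φ q.hom
    State.map (lift φ q.hom) (normalForm (snocVar v) f) =
      normalForm (Fin.snoc (α := fun _ => Poly Y) (fun i => subst φ (v i)) q) f := by
  have := isMonHom_lift φ q.hom
  rw [map_normalForm]
  congr 1
  funext i
  induction i using Fin.lastCases with
  | last => simpa [snocVar] using Poly.ext (inr_lift φ q.hom)
  | cast i => simpa [snocVar] using Poly.ext ((Category.assoc _ _ _).trans (congrArg _ (inl_lift φ q.hom)))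

theorem normalForm_join {n : ℕ} (v : Fin n → Poly X) (f : (Fin (n + 2) → Fin 2) → ℂ) :
    (normalForm (snocVar (snocVar v)) f).hom ≫ (α_ X A A).hom ≫ X ◁ join =
      (normalForm (snocVar v) fun c => f (Fin.snoc (α := fun _ => Fin 2) c (c (Fin.last n)))).hom := by
  have h := congrArg State.hom (map_lift_normalForm (𝟙 (X ⊗ A)) (var X) (snocVar v) f)
  rw [State.map_hom] at h
  refine ((congrArg _ lift_id_inr).symm.trans h).trans ?_
  rw [normalForm_eq (w := snocVar v)
    (fun c => (Fin.snoc (α := fun _ => Fin 2) c (c (Fin.last n)) : Fin (n + 2) → Fin 2))]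
  · rfl
  · intro c i
    have hs : ∀ p : Poly (X ⊗ A), subst (𝟙 _) p = p := fun p => Poly.ext (Category.comp_id _)
    induction i using Fin.lastCases with
    | last =>
      have h := var_mul_minterm (snocVar v) c (Fin.last n)
      simpa [snocVar] using h
    | cast i =>
      have h := var_mul_minterm (snocVar v) c i
      simpa [hs] using h

theorem normalForm_one {n : ℕ} (v : Fin n → Poly X) (f : (Fin (n + 1) → Fin 2) → ℂ) :
    (normalForm (snocVar v) f).hom ≫ X ◁ one ≫ (ρ_ X).hom =
      (normalForm v fun c => f (Fin.snoc (α := fun _ => Fin 2) c 1)).hom := by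
  have h := congrArg State.hom (map_lift_normalForm (𝟙 X) 1 v f)
  rw [State.map_hom] at h
  have h₂ : lift (𝟙 X) (1 : Poly X).hom = X ◁ one ≫ (ρ_ X).hom :=
    (lift_one_right _ _).trans (by rw [Category.comp_id])
  rw [← h₂]
  refine h.trans ?_
  rw [normalForm_eq (w := v) (fun c => (Fin.snoc (α := fun _ => Fin 2) c 1 : Fin (n + 1) → Fin 2))]
  · rfl
  · intro c i
    have hs : ∀ p : Poly X, subst (𝟙 _) p = p := fun p => Poly.ext (Category.comp_id _)
    induction i using Fin.lastCases with
    | last => simp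
    | cast i => simpa [hs] using var_mul_minterm v c i

theorem normalForm_conj {n : ℕ} (v : Fin n → Poly X) (f : (Fin (n + 1) → Fin 2) → ℂ) :
    (normalForm (snocVar v) f).hom ≫ X ◁ conj ≫ (α_ X A A).inv =
      (normalForm (snocVar (snocVar v)) fun c => f (Fin.snoc (α := fun _ => Fin 2)
        (fun i => c i.castSucc.castSucc) (c (Fin.last n).castSucc * c (Fin.last (n + 1))))).hom := by
  have h := congrArg State.hom (map_lift_normalForm (inl X A ≫ inl (X ⊗ A) A)
    (subst (inl (X ⊗ A) A) (var X) * var (X ⊗ A)) v f)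
  rw [State.map_hom] at h
  rw [← lift_inl_inl conj]
  refine h.trans ?_
  rw [normalForm_eq (w := snocVar (snocVar v)) (fun c => (Fin.snoc (α := fun _ => Fin 2)
        (fun i => c i.castSucc.castSucc) (c (Fin.last n).castSucc * c (Fin.last (n + 1))) : Fin (n + 1) → Fin 2))]
  · rfl
  · intro c i
    have key := var_mul_minterm (snocVar (snocVar v)) c
    induction i using Fin.lastCases with
    | last =>
      have h₁ := key (Fin.last n).castSucc
      have h₂ := key (Fin.last (n + 1))
      simp only [snocVar, Fin.snoc_castSucc, Fin.snoc_last] at h₁ h₂ ⊢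
      rw [mul_assoc, h₂, mul_ite, h₁, mul_zero]
      generalize c (Fin.last n).castSucc = k, c (Fin.last (n + 1)) = l
      fin_cases k <;> fin_cases l <;> simp
    | cast i =>
      have h := key i.castSucc.castSucc
      have h' : ∀ p : Poly X, subst (inl X A ≫ inl (X ⊗ A) A) p =
        subst (inl (X ⊗ A) A) (subst (inl X A) p) := fun p => Poly.ext (Category.assoc _ _ _).symm
      simpa [snocVar, h'] using h

/-- An H-box on a fresh wire is the power of `a` by the new variable, itself a normal form, so the
values multiply. -/
theorem normalForm_state {n : ℕ} (a : ℂ) (v : Fin n → Poly X) (f : (Fin n → Fin 2) → ℂ) :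
    (normalForm v f).hom ≫ (ρ_ X).inv ≫ X ◁ state a =
      (normalForm (snocVar v) fun c => f (fun i => c i.castSucc) *
        if c (Fin.last n) = 1 then a else 1).hom := by
  have h₁ : State.map (inl X A) (normalForm v f) =
      normalForm (snocVar v) fun c => f (fun i => c i.castSucc) := by
    rw [map_normalForm]
    have h := normalForm_comp (snocVar v) Fin.castSucc f
    refine Eq.trans ?_ h
    congr 1
    funext i
    simp [snocVar]
  have h₂ : H a (var X) = normalForm (snocVar v) fun c => if c (Fin.last n) = 1 then a else 1 := by
    have h := H_prod a (fun _ : Unit => var X)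
    rw [Fintype.prod_unique] at h
    rw [h]
    have h := normalForm_comp (snocVar v) (fun _ : Unit => Fin.last n) (fun b => if b = 1 then a else 1)
    refine (Eq.trans ?_ h).trans ?_
    · congr 1
      funext i
      simp [snocVar]
    · congr 1
      funext c
      simp [funext_iff]
  have h₃ := normalForm_mul (snocVar v) (fun c => f (fun i => c i.castSucc))
    (fun c => if c (Fin.last n) = 1 then a else 1)
  rw [← h₁, ← h₂] at h₃
  refine Eq.trans ?_ (congrArg State.hom h₃)
  have h₄ := tensor_inl_inr (normalForm v f).hom (state a)
  rw [State.mul_hom, State.map_hom, H, var, h₄, MonoidalCategory.tensorHom_def,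
    unitors_inv_equal, ← rightUnitor_inv_naturality_assoc]

theorem subst_whiskerRight_inl (φ : X ⟶ Y) [IsMonHom φ] (p : Poly X) :
    subst (φ ▷ A) (subst (inl X A) p) = subst (inl Y A) (subst φ p) :=
  Poly.ext (by simp only [subst, Category.assoc, inl_whiskerRight])

theorem subst_whiskerRight_var (φ : X ⟶ Y) [IsMonHom φ] : subst (φ ▷ A) (var X) = var Y :=
  Poly.ext (inr_whiskerRight φ)

variable (X) in
/-- The crossing of the last two wires. -/
def swapLast : (X ⊗ A) ⊗ A ⟶ (X ⊗ A) ⊗ A :=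
  (α_ X A A).hom ≫ X ◁ (β_ A A).hom ≫ (α_ X A A).inv

instance : IsMonHom (swapLast X) := by
  rw [swapLast, whiskerLeft_braid]
  have := isMonHom_lift (inl X A ≫ inl (X ⊗ A) A) (inr (X ⊗ A) A)
  exact isMonHom_lift _ _

theorem subst_swapLast {n : ℕ} (v : Fin n → Poly X) (i : Fin (n + 2)) :
    subst (swapLast X) (snocVar (snocVar v) i) =
      snocVar (snocVar v) (Equiv.swap (Fin.last n).castSucc (Fin.last (n + 1)) i) := by
  have := isMonHom_lift (inl X A ≫ inl (X ⊗ A) A) (inr (X ⊗ A) A)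
  have hi : ∀ j : Fin (n + 1), j.castSucc ≠ Fin.last (n + 1) := fun j => (Fin.castSucc_lt_last j).ne
  refine Poly.ext ?_
  simp only [subst, swapLast, whiskerLeft_braid]
  induction i using Fin.lastCases with
  | last =>
    rw [Equiv.swap_apply_right, snocVar_last, snocVar_castSucc, snocVar_last]
    exact inr_lift _ _
  | cast i =>
    induction i using Fin.lastCases with
    | last =>
      rw [Equiv.swap_apply_left, snocVar_last, snocVar_castSucc, snocVar_last]
      simp only [subst, var, Category.assoc, inl_lift, inr_lift]
    | cast i =>
      rw [Equiv.swap_apply_of_ne_of_ne (fun h => (Fin.castSucc_lt_last i).ne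
        (Fin.castSucc_injective _ h)) (hi _), snocVar_castSucc, snocVar_castSucc]
      simp only [subst, Category.assoc, inl_lift]

end Lift

end ZH.Wires

/-! ### Normal forms on n wires and permutations of wires -/

namespace ZH.Wires

open ZH.Wires.Poly

/-! ### Powers of the wire -/

/-- The `n`-th power of the wire. -/
def pw (n : ℕ) : Wires := ⟨n⟩

/-- The structure of a monoid on the powers of the wire. -/
@[reducible]
def pwMonObj : (n : ℕ) → MonObj (pw n)
  | 0 => inferInstanceAs (MonObj (𝟙_ Wires))
  | n + 1 => letI := pwMonObj n; inferInstanceAs (MonObj (pw n ⊗ A))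

instance (n : ℕ) : MonObj (pw n) := pwMonObj n

theorem isCommMonObj_pw : (n : ℕ) → IsCommMonObj (pw n)
  | 0 => inferInstanceAs (IsCommMonObj (𝟙_ Wires))
  | n + 1 => letI := isCommMonObj_pw n; inferInstanceAs (IsCommMonObj (pw n ⊗ A))

instance (n : ℕ) : IsCommMonObj (pw n) := isCommMonObj_pw n

/-- The variables of the polynomial ring of a power of the wire. -/
noncomputable def vars : (n : ℕ) → Fin n → Poly (pw n)
  | 0 => Fin.elim0
  | n + 1 => (snocVar (vars n) : Fin (n + 1) → Poly (pw n ⊗ A))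

/-- States in normal form. -/
noncomputable def nf (n : ℕ) (f : (Fin n → Fin 2) → ℂ) : 𝟙_ Wires ⟶ ⟨n⟩ :=
  (normalForm (vars n) f).hom

theorem nf_zero_one : nf 0 1 = 𝟙 _ := by
  have h : normalForm (vars 0) 1 = 1 := Finset.prod_eq_one fun b _ => H_one _
  rw [nf, h]
  rfl

theorem nf_discard (n : ℕ) (f : (Fin (n + 1) → Fin 2) → ℂ) :
    nf (n + 1) f ≫ (⟨n⟩ : Wires) ◁ discard =
      nf n fun y => f (Fin.snoc y 0) + f (Fin.snoc y 1) := by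
  have h := congrArg State.hom (sum_normalForm (vars n) f)
  exact (congrArg (Mor.comp _) (Mor.comp_id _)).symm.trans h

theorem nf_one (n : ℕ) (f : (Fin (n + 1) → Fin 2) → ℂ) :
    nf (n + 1) f ≫ (⟨n⟩ : Wires) ◁ one = nf n fun y => f (Fin.snoc (α := fun _ => Fin 2) y 1) :=
  (congrArg (Mor.comp _) (Mor.comp_id _).symm).trans (normalForm_one (vars n) f)

theorem nf_join (n : ℕ) (f : (Fin (n + 2) → Fin 2) → ℂ) :
    nf (n + 2) f ≫ (⟨n⟩ : Wires) ◁ join =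
      nf (n + 1) fun y => f (Fin.snoc (α := fun _ => Fin 2) y (y (Fin.last n))) :=
  (congrArg (Mor.comp _) (Mor.id_comp _).symm).trans (normalForm_join (vars n) f)

theorem nf_conj (n : ℕ) (f : (Fin (n + 1) → Fin 2) → ℂ) :
    nf (n + 1) f ≫ (⟨n⟩ : Wires) ◁ conj =
      nf (n + 2) fun y => f (Fin.snoc (α := fun _ => Fin 2)
        (fun i => y i.castSucc.castSucc) (y (Fin.last n).castSucc * y (Fin.last (n + 1)))) :=
  (congrArg (Mor.comp _) (Mor.comp_id _).symm).trans (normalForm_conj (vars n) f)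

theorem nf_state (n : ℕ) (a : ℂ) (f : (Fin n → Fin 2) → ℂ) :
    nf n f ≫ (⟨n⟩ : Wires) ◁ state a =
      nf (n + 1) fun y => f (fun i => y i.castSucc) * if y (Fin.last n) = 1 then a else 1 :=
  (congrArg (Mor.comp _) (Mor.id_comp _).symm).trans (normalForm_state a (vars n) f)

/-! ### Permutations of wires -/

/-- A bijection as a morphism. -/
def perm {m n : ℕ} (e : Fin m ≃ Fin n) : pw m ⟶ pw n := Mor.wires e

/-- The permutation of wires `e` is a homomorphism that permutes the variables. -/
structure Permutes {n : ℕ} (e : Equiv.Perm (Fin n)) : Prop where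
  isMonHom : IsMonHom (perm e)
  vars_comp : ∀ i, (vars n i).hom ≫ perm e = (vars n (e i)).hom

theorem perm_trans {m n k : ℕ} (e : Fin m ≃ Fin n) (f : Fin n ≃ Fin k) :
    perm (e.trans f) = perm e ≫ perm f := (Mor.wires_comp e f).symm

theorem permutes_one (n : ℕ) : Permutes (1 : Equiv.Perm (Fin n)) where
  isMonHom := inferInstanceAs (IsMonHom (𝟙 (pw n)))
  vars_comp _ := Category.comp_id _

theorem Permutes.mul {n : ℕ} {e f : Equiv.Perm (Fin n)} (he : Permutes e) (hf : Permutes f) :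
    Permutes (e * f) := by
  have h : perm (e * f) = perm f ≫ perm e := perm_trans f e
  refine ⟨?_, fun i => ?_⟩
  · rw [h]
    have := he.isMonHom
    have := hf.isMonHom
    infer_instance
  · rw [h, ← Category.assoc, hf.vars_comp, he.vars_comp, Equiv.Perm.mul_apply]

theorem permutes_succ {n : ℕ} (i j : Fin n) (h : Permutes (Equiv.swap i j)) :
    Permutes (Equiv.swap i.castSucc j.castSucc) := by
  have hl := Equiv.swap_apply_of_ne_of_ne (Fin.castSucc_lt_last i).ne' (Fin.castSucc_lt_last j).ne'
  have hc := (Fin.castSucc_injective n).swap_apply i j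
  have e : perm (Equiv.swap i.castSucc j.castSucc) =
      (perm (Equiv.swap i j) ▷ A : pw n ⊗ A ⟶ pw n ⊗ A) := by
    refine Eq.trans ?_ (Mor.wires_tensor _ _).symm
    refine Mor.wires_congr fun k => congrArg _ ?_
    induction k using Fin.lastCases with
    | last => exact hl.trans (Mor.sumWires_natAdd (Equiv.swap i j) (Equiv.refl (Fin 1)) 0).symm
    | cast k =>
      exact (hc k).trans (Mor.sumWires_castAdd (Equiv.swap i j) (Equiv.refl (Fin 1)) k).symm
  have := h.isMonHom
  refine ⟨?_, fun k => ?_⟩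
  · rw [e]
    exact inferInstanceAs (IsMonHom (perm (Equiv.swap i j) ▷ A))
  · rw [e]
    induction k using Fin.lastCases with
    | last =>
      rw [hl]
      have h₁ := subst_whiskerRight_var (perm (Equiv.swap i j))
      rw [← snocVar_last (vars n)] at h₁
      exact congrArg hom h₁
    | cast k =>
      rw [hc]
      have h₁ := subst_whiskerRight_inl (perm (Equiv.swap i j)) (vars n k)
      have h₂ : subst (perm (Equiv.swap i j)) (vars n k) = vars n (Equiv.swap i j k) :=
        Poly.ext (h.vars_comp k)
      rw [h₂, ← snocVar_castSucc, ← snocVar_castSucc] at h₁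
      exact congrArg hom h₁

theorem refl_sumWires_flip (n : ℕ) :
    Mor.sumWires (Equiv.refl (Fin n)) (finAddFlip (m := 1) (n := 1)) =
      Equiv.swap (Fin.last n).castSucc (Fin.last (n + 1)) := by
  refine Equiv.ext fun k => ?_
  refine Fin.ext ((Mor.sumWires_val _ _ k).trans ?_)
  have hk : (k : ℕ) < n + 2 := k.2
  rw [Equiv.swap_apply_def]
  simp only [Mor.finAddFlip_val, Equiv.refl_apply, Fin.ext_iff, apply_ite Fin.val]
  simp
  split_ifs <;> omega

theorem permutes_last (n : ℕ) :
    Permutes (Equiv.swap (Fin.last n).castSucc (Fin.last (n + 1))) := by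
  have e : perm (Equiv.swap (Fin.last n).castSucc (Fin.last (n + 1))) = swapLast (pw n) := by
    have h : swapLast (pw n) =
        Mor.wires (Mor.sumWires (Equiv.refl (Fin n)) (finAddFlip (m := 1) (n := 1))) :=
      ((Mor.id_comp (Mor.comp (Mor.tensor (Mor.wires (Equiv.refl (Fin n)))
        (Mor.wires (finAddFlip (m := 1) (n := 1)))) _)).trans (Mor.comp_id _)).trans
        (Mor.wires_tensor _ _)
    refine Eq.trans ?_ h.symm
    exact congrArg Mor.wires (refl_sumWires_flip n).symm
  refine ⟨?_, fun k => ?_⟩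
  · rw [e]
    exact inferInstanceAs (IsMonHom (swapLast (pw n)))
  · rw [e]
    exact congrArg hom (subst_swapLast (vars n) k)

/-- Only the crossing of the last two wires needs an argument of its own; the other adjacent
transpositions come from fewer wires. -/
theorem permutes_swap : ∀ {n : ℕ} (i : Fin n), Permutes (Equiv.swap i.castSucc i.succ)
  | n + 1, i => by
    induction i using Fin.lastCases with
    | last => exact permutes_last n
    | cast i => exact permutes_succ _ _ (permutes_swap i)

theorem permutes {n : ℕ} (e : Equiv.Perm (Fin n)) : Permutes e := by
  cases n with
  | zero => rw [Subsingleton.elim e 1]; exact permutes_one 0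
  | succ n =>
    have h : e ∈ Submonoid.closure (Set.range fun i : Fin n => Equiv.swap i.castSucc i.succ) := by
      rw [Equiv.Perm.mclosure_swap_castSucc_succ]; trivial
    induction h using Submonoid.closure_induction with
    | mem x hx => obtain ⟨i, rfl⟩ := hx; exact permutes_swap i
    | one => exact permutes_one _
    | mul x y _ _ hx hy => exact hx.mul hy

theorem nf_perm {m n : ℕ} (e : Fin m ≃ Fin n) (f : (Fin m → Fin 2) → ℂ) :
    nf m f ≫ perm e = nf n fun y => f (y ∘ e) := by
  obtain rfl : m = n := by simpa using Fintype.card_congr e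
  have := (permutes e).isMonHom
  have h := congrArg State.hom (map_normalForm (perm e) (vars m) f)
  have h₂ : (fun i => subst (perm e) (vars m i)) = vars m ∘ e :=
    funext fun i => Poly.ext ((permutes e).vars_comp i)
  rw [h₂, normalForm_comp] at h
  exact h

end ZH.Wires

/-! ### The action of morphisms on normal forms -/

namespace ZH.Wires

/-! ### Morphisms act on normal forms by matrices -/

/-- Matrices that are indexed by bit strings. -/
abbrev Mat (a b : ℕ) := Matrix (Fin b → Fin 2) (Fin a → Fin 2) ℂ

/-- The morphism `φ` acts on normal forms as the matrix `M`. -/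
def Represents {a b : ℕ} (φ : (⟨a⟩ : Wires) ⟶ ⟨b⟩) (M : Mat a b) : Prop :=
  ∀ k f, nf (k + a) f ≫ (⟨k⟩ : Wires) ◁ φ = nf (k + b) fun y =>
    ∑ x, M (fun i => y (Fin.natAdd k i)) x * f (Fin.append (fun i => y (Fin.castAdd b i)) x)

/-- The matrix of a juxtaposition. -/
def tens {a b a' b' : ℕ} (M : Mat a b) (N : Mat a' b') : Mat (a + a') (b + b') :=
  Matrix.of fun y x => M (fun j => y (Fin.castAdd b' j)) (fun i => x (Fin.castAdd a' i)) *
    N (fun j => y (Fin.natAdd b j)) (fun i => x (Fin.natAdd a i))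

/-- The matrix of a pullback. -/
def pull {a b : ℕ} (F : (Fin b → Fin 2) → Fin a → Fin 2) : Mat a b :=
  Matrix.of fun y x => if F y = x then 1 else 0

theorem pull_mul {a b c : ℕ} (F : (Fin c → Fin 2) → Fin b → Fin 2) (M : Mat a b) :
    pull F * M = Matrix.of fun y x => M (F y) x := by
  ext y x
  simp [pull, Matrix.mul_apply]

theorem mul_pull {a b : ℕ} {c : ℕ} (M : Mat b c) (e : Fin a ≃ Fin b) :
    M * pull (fun y => y ∘ e) = Matrix.of fun y x => M y (x ∘ e.symm) := by
  ext y x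
  have h : ∀ z : Fin b → Fin 2, z ∘ e = x ↔ z = x ∘ e.symm := fun z =>
    (Equiv.eq_comp_symm e z x).symm
  simp [pull, Matrix.mul_apply, h]

theorem sum_append {a b : ℕ} (g : (Fin (a + b) → Fin 2) → ℂ) :
    ∑ z, g z = ∑ x, ∑ y, g (Fin.append x y) := by
  rw [← Fintype.sum_prod_type' (f := fun x y => g (Fin.append x y))]
  exact (Fintype.sum_equiv (Fin.appendEquiv a b) _ _ fun _ => rfl).symm

theorem tens_append {a b a' b' : ℕ} (M : Mat a b) (N : Mat a' b') (y : Fin (b + b') → Fin 2)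
    (x : Fin a → Fin 2) (x' : Fin a' → Fin 2) : tens M N y (Fin.append x x') =
      M (fun j => y (Fin.castAdd b' j)) x * N (fun j => y (Fin.natAdd b j)) x' := by
  simp [tens]

theorem tens_mul_tens {a b c a' b' c' : ℕ} (M : Mat a b) (N : Mat b c) (M' : Mat a' b')
    (N' : Mat b' c') : tens N N' * tens M M' = tens (N * M) (N' * M') := by
  ext y x
  rw [Matrix.mul_apply, sum_append]
  simp only [tens_append]
  simp only [tens, Matrix.of_apply, Fin.append_left, Fin.append_right, Matrix.mul_apply,
    Finset.sum_mul_sum]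
  exact Finset.sum_congr rfl fun u _ => Finset.sum_congr rfl fun v _ => by ring

theorem Represents.congr {a b : ℕ} {φ ψ : (⟨a⟩ : Wires) ⟶ ⟨b⟩} {M N : Mat a b}
    (h : Represents φ M) (h₁ : φ = ψ) (h₂ : M = N) : Represents ψ N := h₁ ▸ h₂ ▸ h

theorem Represents.comp {a b c : ℕ} {φ : (⟨a⟩ : Wires) ⟶ ⟨b⟩} {ψ : (⟨b⟩ : Wires) ⟶ ⟨c⟩}
    {M : Mat a b} {N : Mat b c} (h : Represents φ M) (h' : Represents ψ N) :
    Represents (φ ≫ ψ) (N * M) := by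
  intro k f
  have h₁ := congrArg (· ≫ (⟨k⟩ : Wires) ◁ ψ) (h k f)
  simp only [h' k] at h₁
  rw [MonoidalCategory.whiskerLeft_comp]
  refine (Category.assoc _ _ _).symm.trans (h₁.trans ?_)
  congr 1
  funext y
  simp only [Fin.append_left, Fin.append_right, Matrix.mul_apply, Finset.sum_mul, Finset.mul_sum]
  rw [Finset.sum_comm]
  exact Finset.sum_congr rfl fun u _ => Finset.sum_congr rfl fun v _ => by ring

theorem represents_pull {a b : ℕ} {φ : (⟨a⟩ : Wires) ⟶ ⟨b⟩} (F : (Fin b → Fin 2) → Fin a → Fin 2)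
    (h : ∀ k f, nf (k + a) f ≫ (⟨k⟩ : Wires) ◁ φ = nf (k + b) fun y =>
      f (Fin.append (fun i => y (Fin.castAdd b i)) (F fun i => y (Fin.natAdd k i)))) :
    Represents φ (pull F) := by
  intro k f
  rw [h]
  congr 1
  funext y
  simp [pull]

theorem represents_perm {a b : ℕ} (e : Fin a ≃ Fin b) :
    Represents (a := a) (b := b) (perm e) (pull fun y => y ∘ e) := by
  refine represents_pull _ fun k f => ?_
  have h : (⟨k⟩ : Wires) ◁ perm e = perm (Mor.sumWires (Equiv.refl (Fin k)) e) :=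
    Mor.wires_tensor _ _
  refine (congrArg (Mor.comp (nf (k + a) f)) h).trans ?_
  refine (nf_perm _ f).trans (congrArg _ (funext fun y => congrArg f (funext fun i => ?_)))
  induction i using Fin.addCases <;> simp

/-- The spectator wires in `Represents` absorb the `j` new ones; the rest is reassociation. -/
theorem Represents.whiskerLeft {a b : ℕ} {φ : (⟨a⟩ : Wires) ⟶ ⟨b⟩} {M : Mat a b}
    (h : Represents φ M) (j : ℕ) :
    Represents (a := j + a) (b := j + b) ((⟨j⟩ : Wires) ◁ φ) (tens 1 M) := by
  intro k f
  have h₁ := Mor.tensor_assoc (Mor.wires (Equiv.refl (Fin k))) (Mor.wires (Equiv.refl (Fin j))) φ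
  rw [Mor.wires_tensor, Mor.sumWires_refl] at h₁
  set e := finCongr (Nat.add_assoc k j a)
  have h₂ : nf (k + (j + a)) f =
      Mor.comp (nf (k + j + a) fun y => f (y ∘ e.symm)) (Mor.wires e) := by
    refine ((nf_perm e _).trans (congrArg _ (funext fun y => congrArg f ?_))).symm
    rw [Function.comp_assoc, Equiv.self_comp_symm, Function.comp_id]
  rw [h₂]
  refine (Mor.assoc _ _ _).trans ((congrArg (Mor.comp _) h₁.symm).trans
    ((Mor.assoc _ _ _).symm.trans ((congrArg (Mor.comp · _) (h (k + j) _)).trans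
    ((nf_perm _ _).trans (congrArg _ (funext fun y => ?_))))))
  rw [sum_append]
  simp only [tens_append, Matrix.one_apply, ite_mul, one_mul, zero_mul]
  rw [Finset.sum_comm]
  simp only [Finset.sum_ite_eq, Finset.mem_univ, if_true]
  refine Finset.sum_congr rfl fun x _ => congrArg₂ _ ?_ (congrArg f ?_)
  · congr 1
    funext i
    simp only [Function.comp_apply, finCongr_apply]
    congr 1
    ext
    simp [Nat.add_assoc]
  · rw [Equiv.comp_symm_eq]
    have h₄ := Fin.append_assoc (fun i : Fin k => y (Fin.castAdd (j + b) i))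
      (fun i : Fin j => y (Fin.natAdd k (Fin.castAdd b i))) x
    refine Eq.trans ?_ h₄
    congr 1
    funext i
    induction i using Fin.addCases <;> simp <;> congr 1

theorem Represents.whiskerRight {a b : ℕ} {φ : (⟨a⟩ : Wires) ⟶ ⟨b⟩} {M : Mat a b}
    (h : Represents φ M) (j : ℕ) :
    Represents (a := a + j) (b := b + j) (φ ▷ (⟨j⟩ : Wires)) (tens M 1) := by
  have h₁ : φ ▷ (⟨j⟩ : Wires) = (β_ _ _).hom ≫ (⟨j⟩ : Wires) ◁ φ ≫ (β_ _ _).hom := by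
    simp
  have h₂ := ((represents_perm finAddFlip).comp ((h.whiskerLeft j).comp
    (represents_perm finAddFlip)))
  refine h₂.congr h₁.symm ?_
  rw [pull_mul, mul_pull]
  have h₃ : ∀ i, (finAddFlip (m := a) (n := j)).symm (Fin.natAdd j i) = Fin.castAdd j i := fun i => by
    rw [Equiv.symm_apply_eq, finAddFlip_apply_castAdd]
  have h₄ : ∀ i, (finAddFlip (m := a) (n := j)).symm (Fin.castAdd a i) = Fin.natAdd a i := fun i => by
    rw [Equiv.symm_apply_eq, finAddFlip_apply_natAdd]
  ext y x
  simp only [tens, Matrix.of_apply, Function.comp_apply, finAddFlip_apply_natAdd, h₃, mul_comm]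
  exact congrArg₂ _ rfl (congrArg₂ (1 : Mat j j)
    (funext fun i => congrArg y (finAddFlip_apply_castAdd i b)) (funext fun i => congrArg x (h₄ i)))

theorem Represents.tensor {a b a' b' : ℕ} {φ : (⟨a⟩ : Wires) ⟶ ⟨b⟩} {ψ : (⟨a'⟩ : Wires) ⟶ ⟨b'⟩}
    {M : Mat a b} {N : Mat a' b'} (h : Represents φ M) (h' : Represents ψ N) :
    Represents (a := a + a') (b := b + b') (φ ⊗ₘ ψ) (tens M N) :=
  ((h.whiskerRight a').comp (h'.whiskerLeft b)).congr (MonoidalCategory.tensorHom_def φ ψ).symm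
    (by rw [tens_mul_tens, Matrix.one_mul, Matrix.mul_one])

theorem sum_fin_one (g : (Fin 1 → Fin 2) → ℂ) : ∑ x, g x = g (fun _ => 0) + g fun _ => 1 := by
  rw [← Equiv.sum_comp (Equiv.funUnique (Fin 1) (Fin 2)).symm g, Fin.sum_univ_two]
  rfl

theorem snoc_eq_append {n : ℕ} (y : Fin n → Fin 2) (k : Fin 2) :
    (Fin.snoc y k : Fin (n + 1) → Fin 2) = Fin.append y fun _ => k :=
  (Fin.append_right_eq_snoc y fun _ => k).symm

theorem represents_join : Represents (a := 2) (b := 1) join (pull fun y _ => y 0) := by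
  refine represents_pull _ fun k f => (nf_join k f).trans (congrArg _ (funext fun y =>
    congrArg f (funext fun i => ?_)))
  have hl := Fin.append_left (fun i => y (Fin.castAdd 1 i)) fun _ : Fin 2 => y (Fin.natAdd k 0)
  have hr := Fin.append_right (fun i => y (Fin.castAdd 1 i)) fun _ : Fin 2 => y (Fin.natAdd k 0)
  induction i using Fin.lastCases with
  | last => exact (Fin.snoc_last (α := fun _ => Fin 2) _ y).trans (hr 1).symm
  | cast i =>
    refine (Fin.snoc_castSucc (α := fun _ => Fin 2) _ y i).trans ?_
    induction i using Fin.lastCases with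
    | last => exact (hr 0).symm
    | cast i => exact (hl i).symm

theorem represents_one : Represents (a := 1) (b := 0) one (pull fun _ _ => 1) := by
  refine represents_pull _ fun k f => (nf_one k f).trans (congrArg _ (funext fun y =>
    congrArg f (snoc_eq_append y 1)))

theorem represents_conj : Represents (a := 1) (b := 2) conj (pull fun y _ => y 0 * y 1) := by
  refine represents_pull _ fun k f => (nf_conj k f).trans (congrArg _ (funext fun y =>
    congrArg f (snoc_eq_append _ _)))

theorem represents_discard :
    Represents (a := 1) (b := 0) discard (Matrix.of fun _ _ => 1) := by
  refine fun k f => (nf_discard k f).trans (congrArg _ (funext fun y => ?_))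
  rw [sum_fin_one]
  simp [Fin.append_right_eq_snoc]

theorem represents_state (a : ℂ) :
    Represents (a := 0) (b := 1) (state a) (Matrix.of fun y _ => if y 0 = 1 then a else 1) := by
  refine fun k f => (nf_state k a f).trans (congrArg _ (funext fun y => ?_))
  rw [Fintype.sum_unique]
  rw [mul_comm]
  refine congrArg₂ _ rfl (congrArg f (funext fun i => ?_))
  exact (Fin.append_left (n := 0) (fun i => y (Fin.castAdd 1 i)) _ i).symm

end ZH.Wires

/-! ### The matrices of all diagrams, and completeness -/

namespace ZH.Wires

open ZH.Wires.Poly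

/-- The matrix of a cap. -/
theorem represents_cap : Represents (a := 2) (b := 0) cap (Diagram.interp .cap) := by
  have h := represents_join.comp represents_discard
  refine h.congr join_discard ?_
  ext y x
  simp only [Matrix.mul_apply, sum_fin_one, pull, Diagram.interp, Matrix.of_apply, one_mul,
    funext_iff, Fin.forall_fin_two]
  generalize x 0 = k, x 1 = l
  fin_cases k <;> fin_cases l <;> simp

theorem sum_fin_two (g : (Fin 2 → Fin 2) → ℂ) : ∑ x, g x = ∑ k, ∑ l, g ![k, l] := by
  rw [← Fintype.sum_prod_type' (f := fun k l => g ![k, l])]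
  exact (Fintype.sum_equiv (finTwoArrowEquiv (Fin 2)).symm _ _ fun _ => rfl).symm

theorem one_fin_one (u v : Fin 1 → Fin 2) : (1 : Mat 1 1) u v = if u 0 = v 0 then 1 else 0 := by
  simp [Matrix.one_apply, funext_iff]

theorem append_castAdd_one {n : ℕ} (y : Fin n → Fin 2) (v : Fin 2 → Fin 2) (i : Fin (n + 1)) :
    (Fin.append y v : Fin (n + 2) → Fin 2) i.castSucc =
      (Fin.snoc y (v 0) : Fin (n + 1) → Fin 2) i := by
  induction i using Fin.lastCases with
  | last =>
    rw [Fin.snoc_last]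
    exact Fin.append_right y v 0
  | cast i =>
    rw [Fin.snoc_castSucc]
    exact Fin.append_left y v i

theorem append_last_one {n : ℕ} (y : Fin n → Fin 2) (v : Fin 2 → Fin 2) :
    (Fin.append y v : Fin (n + 2) → Fin 2) (Fin.last (n + 1)) = v 1 :=
  Fin.append_right y v 1

theorem tens_one_apply {m n : ℕ} (M : Mat m n) (y : Fin (n + 1) → Fin 2)
    (x : Fin (m + 1) → Fin 2) : tens M (1 : Mat 1 1) y x =
      if y (Fin.last n) = x (Fin.last m) then M (fun i => y i.castSucc) (fun i => x i.castSucc)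
      else 0 := by
  have h : tens M (1 : Mat 1 1) y x = M (fun i => y i.castSucc) (fun i => x i.castSucc) *
    (1 : Mat 1 1) (fun _ => y (Fin.last n)) fun _ => x (Fin.last m) := by
    refine congrArg₂ (· * ·) rfl (congrArg₂ (1 : Mat 1 1) (funext fun i => congrArg y ?_)
      (funext fun i => congrArg x ?_)) <;> rw [Subsingleton.elim i 0] <;> rfl
  rw [h, one_fin_one, mul_ite, mul_one, mul_zero]

theorem Represents.bendOut {m n : ℕ} {φ : (⟨m⟩ : Wires) ⟶ ⟨n⟩ ⊗ A} {M : Mat m (n + 1)}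
    (h : Represents (b := n + 1) φ M) : Represents (a := m + 1) (bendOut φ)
      (Matrix.of fun y x => M (Fin.snoc (α := fun _ => Fin 2) y (x (Fin.last m)))
        fun i => x i.castSucc) := by
  refine ((h.whiskerRight 1).comp (represents_cap.whiskerLeft n)).congr (bendOut_eq φ).symm ?_
  ext y x
  refine (Matrix.mul_apply ..).trans ((sum_append (a := n) (b := 2) _).trans ?_)
  have h₁ : ∀ u v, tens (1 : Mat n n) (Diagram.interp .cap) y (Fin.append u v) =
      if y = u then if v 0 = v 1 then 1 else 0 else 0 := fun u v => by
    rw [tens_append, Matrix.one_apply, ite_mul, one_mul, zero_mul]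
    rfl
  simp only [h₁, tens_one_apply, append_last_one, append_castAdd_one]
  rw [Finset.sum_comm]
  simp only [ite_mul, one_mul, zero_mul, Finset.sum_ite_eq, Finset.mem_univ, if_true, sum_fin_two]
  simp

theorem represents_state₂ (a : ℂ) : Represents (a := 0) (b := 2) (state₂ a) (Diagram.interp (.H 0 2 a)) := by
  refine ((represents_state a).comp represents_conj).congr (state_conj a) ?_
  rw [pull_mul]
  ext y x
  simp only [Diagram.interp, Matrix.of_apply, Finset.univ_eq_empty, Finset.prod_empty, one_mul, Fin.prod_univ_two]
  generalize y 0 = k, y 1 = l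
  fin_cases k <;> fin_cases l <;> simp

theorem represents_scal (a : ℂ) : Represents (a := 0) (b := 0) (scal a) (Diagram.interp (.H 0 0 a)) := by
  refine ((represents_state a).comp represents_one).congr (state_one a) ?_
  rw [pull_mul]
  ext y x
  simp [Diagram.interp]

/-- Boxes without inputs come from `state` and `conj`; inputs are then obtained by bending with the
cap, whose matrix is already known. -/
theorem represents_had : Represents (a := 1) (b := 1) had (Diagram.interp Diagram.had) := by
  refine (represents_state₂ (-1)).bendOut.congr ((spider_box (-1)).bendOut 0 1) ?_
  ext y x
  have h : ∀ k, (Fin.snoc y k : Fin 2 → Fin 2) 1 = k := fun k => Fin.snoc_last (α := fun _ => Fin 2) k y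
  simp [Diagram.interp, Diagram.had, Fin.prod_univ_castSucc, mul_comm, h]

theorem Represents.withScalar {a b : ℕ} {φ : (⟨a⟩ : Wires) ⟶ ⟨b⟩} {M : Mat a b}
    (h : Represents φ M) (c : ℂ) : Represents (withScalar (scal c) φ) (c • M) := by
  refine (h.tensor (represents_scal c)).congr ((Mor.id_comp _).trans (Mor.comp_id _)).symm ?_
  ext y x
  simp [tens, Diagram.interp, mul_comm]

/-- Up to the scalar ½, a cup is the state (-1)^{xy} with a Hadamard box on one leg, and those
matrices are known. -/
theorem represents_cup : Represents (a := 0) (b := 2) cup (Diagram.interp .cup) := by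
  have e : ZH.withScalar (scal (1 / 2)) (state₂ (-1) ≫ had ▷ A) = cup := by
    rw [← cup_had_whiskerRight, Category.assoc, ← comp_whiskerRight, had_had,
      withScalar_whiskerRight, comp_withScalar, half_two, id_whiskerRight, Category.comp_id]
  refine (((represents_state₂ (-1)).comp (represents_had.whiskerRight 1)).withScalar (1 / 2)).congr
    e ?_
  ext y x
  rw [Matrix.smul_apply]
  refine (congrArg (_ • ·) ((Matrix.mul_apply ..).trans (sum_fin_two _))).trans ?_
  simp only [tens_one_apply]
  simp [Diagram.interp, Diagram.had]
  generalize y 0 = k, y 1 = l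
  fin_cases k <;> fin_cases l <;> norm_num

theorem Represents.bendIn {m n : ℕ} {φ : (⟨m⟩ : Wires) ⊗ A ⟶ ⟨n⟩} {M : Mat (m + 1) n}
    (h : Represents (a := m + 1) φ M) : Represents (b := n + 1) (bendIn φ)
      (Matrix.of fun y x => M (fun i => y i.castSucc)
        (Fin.snoc (α := fun _ => Fin 2) x (y (Fin.last n)))) := by
  refine ((represents_cup.whiskerLeft m).comp (h.whiskerRight 1)).congr (bendIn_eq φ).symm ?_
  ext y x
  refine (Matrix.mul_apply ..).trans ((sum_append (a := m) (b := 2) _).trans ?_)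
  have h₁ : ∀ u v, tens (1 : Mat m m) (Diagram.interp .cup) (Fin.append u v) x =
      if u = x then if v 0 = v 1 then 1 else 0 else 0 := fun u v => by
    have h₂ : tens (1 : Mat m m) (Diagram.interp .cup) (Fin.append u v) x =
        (1 : Mat m m) u x * if v 0 = v 1 then 1 else 0 := by
      simp only [tens, Diagram.interp, Matrix.of_apply, Fin.append_right]
      exact congrArg (· * _) (congrArg₂ (1 : Mat m m) (funext fun i => Fin.append_left u v i) rfl)
    rw [h₂, Matrix.one_apply, ite_mul, one_mul, zero_mul]
  simp only [h₁, tens_one_apply, append_last_one, append_castAdd_one]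
  rw [Finset.sum_comm]
  simp only [mul_ite, mul_one, mul_zero, Finset.sum_ite_eq', Finset.mem_univ, if_true, sum_fin_two]
  simp

/-- Each further leg arises by splitting the first leg with `conj`. -/
theorem represents_box_state (a : ℂ) : ∀ n, Represents (box a 0 n) (Diagram.interp (.H 0 n a))
  | 0 => represents_scal a
  | 1 => by
    refine (represents_state a).congr rfl ?_
    ext y x
    simp only [Diagram.interp, Matrix.of_apply, Finset.univ_eq_empty, Finset.prod_empty, one_mul,
      Fin.prod_univ_one]
    generalize y 0 = k
    fin_cases k <;> simp
  | n + 2 => by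
    have h : Represents (box a 0 (2 + n)) (Diagram.interp (.H 0 (2 + n) a)) := by
      refine ((represents_box_state a (1 + n)).comp (represents_conj.whiskerRight n)).congr
        (box_conj_whiskerRight a 0 n) ?_
      ext y x
      rw [Matrix.mul_apply, sum_append, Finset.sum_comm]
      simp only [tens_append, pull, Matrix.one_apply, Diagram.interp, Matrix.of_apply,
        Fin.prod_univ_add, Fin.append_left, Fin.append_right, ite_mul, one_mul, zero_mul,
        Finset.sum_ite_eq, Finset.mem_univ, if_true]
      congr 2
      rw [Fin.prod_univ_one, Fin.prod_univ_two]
      generalize y (Fin.castAdd n 0) = k, y (Fin.castAdd n 1) = l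
      fin_cases k <;> fin_cases l <;> rfl
    exact Nat.add_comm 2 n ▸ h
termination_by n => n

theorem represents_box (a : ℂ) (m n : ℕ) : Represents (box a m n) (Diagram.interp (.H m n a)) := by
  induction m generalizing n with
  | zero => exact represents_box_state a n
  | succ m ih =>
    refine (ih (n + 1)).bendOut.congr ((spider_box a).bendOut m n) ?_
    ext y x
    simp only [Diagram.interp, Matrix.of_apply, Fin.prod_univ_castSucc, Fin.snoc_castSucc,
      Fin.snoc_last]
    congr 1
    ring

theorem represents_zed_one (m : ℕ) : Represents (zed m 1) (Diagram.interp (.Z m 1)) := by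
  induction m with
  | zero =>
    refine (represents_state 1).congr state_eq_unit ?_
    ext y x
    simp only [Diagram.interp, Matrix.of_apply, Fin.forall_fin_one]
    generalize y 0 = k
    fin_cases k <;> simp
  | succ m ih =>
    refine ((ih.whiskerRight 1).comp represents_join).congr (zed_succ_one m) ?_
    rw [pull_mul]
    ext y x
    rw [Matrix.of_apply, tens_one_apply]
    simp only [Diagram.interp, Matrix.of_apply, Fin.forall_fin_succ']
    have hy : y (Fin.last 0) = y 0 := rfl
    rw [hy]
    generalize y 0 = k, x (Fin.last m) = l
    fin_cases k <;> fin_cases l <;> simp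

theorem represents_zed (m n : ℕ) : Represents (zed m n) (Diagram.interp (.Z m n)) := by
  induction n generalizing m with
  | zero =>
    refine ((represents_zed_one m).comp represents_discard).congr (zed_comp m 0) ?_
    ext y x
    simp [Matrix.mul_apply, sum_fin_one, Diagram.interp]
  | succ n ih =>
    refine (ih (m + 1)).bendIn.congr (spider_zed.bendIn m n) ?_
    ext y x
    simp only [Diagram.interp, Matrix.of_apply, Fin.forall_fin_succ', Fin.snoc_castSucc,
      Fin.snoc_last]
    congr 2 <;> simp only [eq_iff_iff] <;> tauto

theorem represents_interp {m n : ℕ} (D : Diagram m n) : Represents (cls D) D.interp := by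
  induction D with
  | Z m n => exact represents_zed m n
  | H m n a => exact represents_box a m n
  | wires e =>
    refine (represents_perm e).congr rfl ?_
    ext y x
    simp [pull, Diagram.interp, funext_iff]
  | cup => exact represents_cup
  | cap => exact represents_cap
  | comp D E hD hE => exact hD.comp hE
  | tensor D E hD hE => exact hD.tensor hE

/-- Without inputs, a morphism is recovered by applying it to `nf 0 1`, the empty diagram. Inputs
are bent into outputs, which loses nothing and changes the matrix in a prescribed way. -/
theorem Represents.unique {m n : ℕ} {φ ψ : (⟨m⟩ : Wires) ⟶ ⟨n⟩} {M : Mat m n}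
    (h : Represents φ M) (h' : Represents ψ M) : φ = ψ := by
  induction m generalizing n with
  | zero =>
    have key : ∀ φ : (⟨0⟩ : Wires) ⟶ ⟨n⟩,
        Mor.comp (Mor.comp (nf (0 + 0) 1) (Mor.tensor (Mor.wires (Equiv.refl (Fin 0))) φ))
          (Mor.wires (finCongr (Nat.zero_add n))) = φ := fun φ => by
      have h₁ : nf (0 + 0) 1 = Mor.wires (Equiv.refl (Fin 0)) := nf_zero_one
      rw [h₁, Mor.assoc, Mor.zero_tensor]
      exact (Mor.id_comp _).trans (Mor.id_comp φ)
    rw [← key φ, ← key ψ]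
    exact congrArg (Mor.comp · _) ((h 0 1).trans (h' 0 1).symm)
  | succ m ih =>
    have h₁ : Wires.bendIn (X := ⟨m⟩) (Y := ⟨n⟩) φ = Wires.bendIn (X := ⟨m⟩) (Y := ⟨n⟩) ψ :=
      ih h.bendIn h'.bendIn
    rw [← bendOut_bendIn (X := ⟨m⟩) (Y := ⟨n⟩) φ, h₁, bendOut_bendIn]

end ZH.Wires

theorem mainTheorem1 {m n : ℕ} (D₁ D₂ : ZH.Diagram m n)
    (h : ZH.Diagram.interp D₁ = ZH.Diagram.interp D₂) :
    ZH.Diagram.Convertible D₁ D₂ := by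
  have h₁ := ZH.Wires.represents_interp D₁
  rw [h] at h₁
  exact ZH.Wires.cls_eq.1 (h₁.unique (ZH.Wires.represents_interp D₂))
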